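/- **Setting.** Let $n\ge 1$, $m>0$, and let $\mathcal D=C_0^\infty(\mathbb R^n)\oplus C_0^\infty(\mathbb R^n)$ (complex-valued functions), with the real scalar product $\langle Y,\Psi\rangle=\sum_{i=0,1}\mathrm{Re}\int Y^i(x)\overline{\Psi^i(x)}\,dx$. Let $\mathcal H=H^1_{\rm loc}(\mathbb R^n)\oplus L^2_{\rm loc}(\mathbb R^n)$ with the seminorms $\|(u,v)\|_R^2=\int_{|x|<R}(|v|^2+|\nabla u|^2+m^2|u|^2)\,dx$, and let $U_0(t):\mathcal H\to\mathcal H$ be the solution operator $Y(0)\mapsto Y(t)=(u(\cdot,t),\dot u(\cdot,t))$, $Y\in C(\mathbb R,\mathcal H)$, of the Klein–Gordon equation $\ddot u=\Delta u-m^2u$. Its formal adjoint $U_0'(t):\mathcal D\to\mathcal D$ is defined by $\langle Y,U_0'(t)\Psi\rangle=\langle U_0(t)Y,\Psi\rangle$ for all $Y\in\mathcal H$. Let $Y_0=(Y_0^0,Y_0^1)=(u_0,v_0)$ be a measurable random function with values in $\mathcal H$ on a probability space $(\Omega,\Sigma,P)$ with expectation $E$, such that * (S0) $EY_0(x)=0$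 for almost all $x$; * (S1) $E(Y_0^i(x)\otimes Y_0^j(y))=q_0^{ij}(x-y)$ for almost all $x,y$ and $i,j=0,1$ ($\otimes$ is the tensor product of real vectors, $\mathbb C=\mathbb R^2$); * (S2) $E(|v_0(x)|^2+|\nabla u_0(x)|^2+m^2|u_0(x)|^2)=e_0<\infty$ for almost all $x$; * (S3) $\varphi(r)\to0$ as $r\to\infty$ and $\overline\varphi:=\int_0^\infty r^{n-1}\varphi^{1/2}(r)\,dr<\infty$, where $$\varphi(r)=\sup\frac{|P(A\cap B)-P(A)P(B)|}{P(B)},$$ the supremum over all open bounded $\mathcal A,\mathcal B\subset\mathbb R^n$ at distance $\ge r$ and all $A\in\sigma(\mathcal A)$, $B\in\sigma(\mathcal B)$ with $P(B)>0$; here $\sigma(\mathcal A)$ is generated by the random variables $\langle Y_0,\Psi\rangle$, $\Psi\in\mathcal D$, $\mathrm{supp}\,\Psi\subset\mathcal A$. Assume moreover that for some $\Lambda$, almost surely, $|u_0(x)|+|v_0(x)|\le\Lambda$ for almost all $x\in\mathbb R^n$. For $t>0$ let $d_t\ge1$ and $\rho_t>0$ be arbitrary, put $h_t=d_t+\rho_t$,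 let $\chi_r^j$ be the indicator of the room $\{x\in\mathbb R^n: jh_t\le x^n\le jh_t+d_t\}$ ($x^n$ the last coordinate of $x$), and for $\Psi\in\mathcal D$ put $$r_t^j=\langle Y_0,\chi_r^j\,U_0'(t)\Psi\rangle,\qquad j\in\mathbb Z.$$ **Theorem.** For every $\Psi\in\mathcal D$ there is a constant $C(\Psi)$, depending only on $\Psi$, $n$, $m$ and an upper bound for $\overline\varphi$ (and not on $\Lambda$, $t$, $j$, $d_t$, $\rho_t$ or otherwise on $Y_0$), such that $$E|r_t^j|^4\le C(\Psi)\,\Lambda^4\,\frac{d_t^2}{t^2},\qquad t>1,\ j\in\mathbb Z .$$ Consequently, if $d_t\sim t/\ln t$ and $\rho_t\sim t^{1-\delta}$ as $t\to\infty$ for some $0<\delta<1$, then $\sum_{j\in\mathbb Z}E|r_t^j|^4\to0$ and the Lindeberg condition holds: for every $\varepsilon>0$, $$\sum_{j\in\mathbb Z}E\big(|r_t^j|^2\,\mathbf 1_{\{|r_t^j|>\varepsilon\}}\big)\to0,\qquad t\to\infty .$$ -/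

import Mathlib

open MeasureTheory Filter Topology Set
open scoped ENNReal NNReal Laplacian

noncomputable section

namespace KleinGordon

/-- `ℝⁿ` with its Euclidean norm. -/
abbrev E (n : ℕ) : Type := EuclideanSpace ℝ (Fin n)

/-- Pairs `Y = (Y⁰, Y¹) = (u, v)` of complex functions on `ℝⁿ`; `Y x 0 = u(x)`, `Y x 1 = v(x)`. -/
abbrev State (n : ℕ) : Type := E n → Fin 2 → ℂ

/-- Complex vector fields on `ℝⁿ`, the candidates for `∇u`. -/
abbrev GradField (n : ℕ) : Type := E n → EuclideanSpace ℂ (Fin n)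

variable {n : ℕ}

/-- `Ψ ∈ 𝒟 = C₀^∞(ℝⁿ) ⊕ C₀^∞(ℝⁿ)`. -/
def IsTestPair (Ψ : State n) : Prop := ContDiff ℝ (⊤ : ℕ∞) Ψ ∧ HasCompactSupport Ψ

/-- `⟨Y, Ψ⟩ = ⟨Y⁰, Ψ⁰⟩ + ⟨Y¹, Ψ¹⟩`, the real `L²` scalar product (with `ℂ = ℝ²`). -/
def pairing (Y Ψ : State n) : ℝ :=
  ∫ x, ∑ i, (Y x i * (starRingEnd ℂ) (Ψ x i)).re

/-! ### The phase space `ℋ = H¹_loc ⊕ L²_loc` -/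

/-- `g` is the weak gradient of `u`. -/
def HasWeakGradient (u : E n → ℂ) (g : GradField n) : Prop :=
  ∀ η : E n → ℝ, ContDiff ℝ (⊤ : ℕ∞) η → HasCompactSupport η → ∀ k : Fin n,
    ∫ x, (fderiv ℝ η x (EuclideanSpace.single k 1)) • u x = -∫ x, η x • g x k

/-- The energy density `|v|² + |∇u|² + m²|u|²` at a point, with `y = (u, v)` and `p = ∇u`. -/
def energyDensity (m : ℝ) (y : Fin 2 → ℂ) (p : EuclideanSpace ℂ (Fin n)) : ℝ≥0∞ :=
  ‖y 1‖ₑ ^ 2 + ‖p‖ₑ ^ 2 + ENNReal.ofReal (m ^ 2) * ‖y 0‖ₑ ^ 2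

/-- The squared local energy seminorm `‖Y‖_R²` of `Y = (u, v)`, where `g = ∇u`. -/
def localEnergy (m R : ℝ) (Y : State n) (g : GradField n) : ℝ≥0∞ :=
  ∫⁻ x in Metric.ball 0 R, energyDensity m (Y x) (g x)

/-- `Y = (u, v) ∈ ℋ`, with weak gradient `∇u = g`. -/
structure InPhaseSpace (m : ℝ) (Y : State n) (g : GradField n) : Prop where
  aestronglyMeasurable : AEStronglyMeasurable Y volume
  aestronglyMeasurable_grad : AEStronglyMeasurable g volume
  hasWeakGradient : HasWeakGradient (fun x => Y x 0) g
  localEnergy_lt_top : ∀ R : ℝ, 0 < R → localEnergy m R Y g < ∞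

/-! ### Klein–Gordon dynamics and the adjoint group -/

/-- The formal adjoint `𝒜₀' η = ((Δ - m²) η¹, η⁰)` of the generator `𝒜₀ (u, v) = (v, (Δ - m²) u)`. -/
def adjointGenerator (m : ℝ) (η : State n) : State n := fun x =>
  ![(Δ (fun y => η y 1)) x - (m : ℂ) ^ 2 * η x 1, η x 0]

/-- `Y ∈ C(ℝ, ℋ)` is a generalised solution of `Ẏ = 𝒜₀ Y`, i.e. of `ü = Δu - m²u` with
`Y = (u, u̇)`: the equation holds after pairing with every test pair. -/
def IsSolution (m : ℝ) (Y : ℝ → State n) : Prop :=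
  ∃ g : ℝ → GradField n,
    (∀ t, InPhaseSpace m (Y t) (g t)) ∧
    (∀ R : ℝ, 0 < R → ∀ s : ℝ,
      Tendsto (fun t => localEnergy m R (Y t - Y s) (g t - g s)) (𝓝 s) (𝓝 0)) ∧
    ∀ η : State n, IsTestPair η → ∀ t : ℝ,
      HasDerivAt (fun s => pairing (Y s) η) (pairing (Y t) (adjointGenerator m η)) t

/-- `Φ = U₀'(t) Ψ`: `Φ ∈ 𝒟` and `⟨Y₀, Φ⟩ = ⟨U₀(t) Y₀, Ψ⟩` for all `Y₀ ∈ ℋ`, where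
`U₀(t) : Y(0) ↦ Y(t)` is the solution operator. -/
def IsAdjointEvolution (m t : ℝ) (Ψ Φ : State n) : Prop :=
  IsTestPair Φ ∧ ∀ Y : ℝ → State n, IsSolution m Y → pairing (Y 0) Φ = pairing (Y t) Ψ

open Classical in
/-- `U₀'(t) Ψ`. The defining property has exactly one solution for every `Ψ ∈ 𝒟`, `t ∈ ℝ`. -/
def adjointGroup (m t : ℝ) (Ψ : State n) : State n :=
  if h : ∃ Φ, IsAdjointEvolution m t Ψ Φ then h.choose else 0

/-! ### Random initial data -/

variable {Ω : Type*} [MeasurableSpace Ω]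

/-- `Y₀` is a measurable random function with values in `ℋ`: it is measurable in `(ω, x)` for the
completed product `σ`-algebra, and `Y₀(ω, ·) ∈ ℋ` almost surely. -/
def IsRandomState (m : ℝ) (P : Measure Ω) (Y₀ : Ω → State n) : Prop :=
  AEMeasurable (fun p : Ω × E n => Y₀ p.1 p.2) (P.prod volume) ∧
    ∀ᵐ ω ∂P, ∃ g, InPhaseSpace m (Y₀ ω) g

/-- Zero expectation. -/
def CondS0 (P : Measure Ω) (Y₀ : Ω → State n) : Prop :=
  ∀ i : Fin 2, ∀ᵐ x : E n, ∫ ω, Y₀ ω x i ∂P = 0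

/-- The two coordinates of `z ∈ ℂ = ℝ²`. -/
def realCoord (a : Fin 2) (z : ℂ) : ℝ := if a = 0 then z.re else z.im

/-- The covariance function `Q₀^{ij}(x, y) = E (Y₀^i(x) ⊗ Y₀^j(y))`, tensor product of vectors of
`ℝ² = ℂ`. -/
def covariance (P : Measure Ω) (Y₀ : Ω → State n) (i j : Fin 2) (x y : E n) :
    Matrix (Fin 2) (Fin 2) ℝ :=
  Matrix.of fun a b => ∫ ω, realCoord a (Y₀ ω x i) * realCoord b (Y₀ ω y j) ∂P

/-- Translation-invariant covariance functions. -/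
def CondS1 (P : Measure Ω) (Y₀ : Ω → State n) : Prop :=
  ∃ q : Fin 2 → Fin 2 → E n → Matrix (Fin 2) (Fin 2) ℝ, ∀ i j : Fin 2,
    ∀ᵐ p : E n × E n, covariance P Y₀ i j p.1 p.2 = q i j (p.1 - p.2)

/-- Finite mean energy density: `E (|v₀(x)|² + |∇u₀(x)|² + m²|u₀(x)|²) = e₀ < ∞`. -/
def CondS2 (m : ℝ) (P : Measure Ω) (Y₀ : Ω → State n) : Prop :=
  ∃ g : Ω → GradField n,
    AEMeasurable (fun p : Ω × E n => g p.1 p.2) (P.prod volume) ∧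
    (∀ᵐ ω ∂P, HasWeakGradient (fun x => Y₀ ω x 0) (g ω)) ∧
    ∃ e₀ : ℝ≥0, ∀ᵐ x : E n, ∫⁻ ω, energyDensity m (Y₀ ω x) (g ω x) ∂P = e₀

/-- `σ(𝒜)`: the `σ`-algebra generated by the functionals `⟨Y₀, Ψ⟩`, `Ψ ∈ 𝒟`, `supp Ψ ⊆ 𝒜`. -/
@[reducible] def sigmaAlg (Y₀ : Ω → State n) (𝒜 : Set (E n)) : MeasurableSpace Ω :=
  ⨆ (Ψ : State n) (_ : IsTestPair Ψ ∧ tsupport Ψ ⊆ 𝒜),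
    MeasurableSpace.comap (fun ω => pairing (Y₀ ω) Ψ) (borel ℝ)

/-- The Ibragimov–Linnik mixing coefficient `φ(r)`. (The set is nonempty and contained in
`[0, 1]` when `P` is a probability measure.) -/
def mixingCoeff (P : Measure Ω) (Y₀ : Ω → State n) (r : ℝ) : ℝ :=
  sSup {c : ℝ | ∃ 𝒜 ℬ : Set (E n),
    IsOpen 𝒜 ∧ Bornology.IsBounded 𝒜 ∧ IsOpen ℬ ∧ Bornology.IsBounded ℬ ∧
    (∀ x ∈ 𝒜, ∀ y ∈ ℬ, r ≤ dist x y) ∧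
    ∃ A B : Set Ω, MeasurableSet[sigmaAlg Y₀ 𝒜] A ∧ MeasurableSet[sigmaAlg Y₀ ℬ] B ∧
      0 < P B ∧ c = |P.real (A ∩ B) - P.real A * P.real B| / P.real B}

/-- `φ̄ = ∫₀^∞ r^{n-1} φ^{1/2}(r) dr`. -/
def mixingIntegral (P : Measure Ω) (Y₀ : Ω → State n) : ℝ≥0∞ :=
  ∫⁻ r in Ioi (0 : ℝ), ENNReal.ofReal (r ^ (n - 1) * √(mixingCoeff P Y₀ r))

/-- Strong uniform Ibragimov–Linnik mixing with `φ̄ < ∞`. -/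
def CondS3 (P : Measure Ω) (Y₀ : Ω → State n) : Prop :=
  Tendsto (mixingCoeff P Y₀) atTop (𝓝 0) ∧ mixingIntegral P Y₀ < ∞

/-- `|u₀(x)| + |v₀(x)| ≤ Λ` almost surely. -/
def BoundedBy (P : Measure Ω) (Y₀ : Ω → State n) (Λ : ℝ) : Prop :=
  ∀ᵐ ω ∂P, ∀ᵐ x : E n, ‖Y₀ ω x 0‖ + ‖Y₀ ω x 1‖ ≤ Λ

/-! ### Rooms -/

/-- The room `R^j = {x : a^j ≤ xⁿ ≤ b^j}`, `a^j = j (d + ρ)`, `b^j = a^j + d`, where `xⁿ` is the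
last coordinate of `x`. -/
def room (hn : 1 ≤ n) (d ρ : ℝ) (j : ℤ) : Set (E n) :=
  {x | j * (d + ρ) ≤ x ⟨n - 1, by omega⟩ ∧ x ⟨n - 1, by omega⟩ ≤ j * (d + ρ) + d}

/-- The room variable `r_t^j = ⟨Y₀, χ_r^j Φ(·, t)⟩`, `Φ(·, t) = U₀'(t) Ψ`, for rooms of width `d`
and corridors of width `ρ`. -/
def roomVar (hn : 1 ≤ n) (m : ℝ) (Ψ : State n) (Y₀ : State n) (d ρ t : ℝ) (j : ℤ) : ℝ :=
  pairing Y₀ ((room hn d ρ j).indicator (adjointGroup m t Ψ))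

end KleinGordon

end

open MeasureTheory Filter Topology Set
open scoped ENNReal NNReal Laplacian

noncomputable section

namespace KleinGordon

/-! A room variable is `⟨Y₀, f⟩`, where `f` is the dual solution `Φ = U₀'(t)Ψ` cut off to a room.
Two facts about `Φ` matter: `|Φ| = O(t^{-n/2})` uniformly in space (`IsAdjointEvolution.norm_le`),
and `Φ = 0` outside a ball of radius `t + R` (`IsAdjointEvolution.eq_zero_of_lt_norm`). So `f` has
size `t^{-n/2}` on a set `S` of volume `O(d t^{n-1})`. One fact about `Y₀` matters: the fourth
moment of `⟨Y₀, f⟩` is at most a constant times `(Λ sup|f|)⁴ |S|²`, with `|S|²` and not `|S|⁴`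
(`integral_pairing_fourth_le`). Multiplying, `Λ⁴ t^{-2n} (d t^{n-1})² = Λ⁴ d²/t²`.

The square of the volume comes from the four-point function of a bounded centred mixing field. Four
points with largest mutual distance `D` either contain a point at distance at least `D/3` from the
others, or split into two pairs at distance at least `D/3`. Mixing then bounds the expectation of
the product by a sum over the three pairings of products of values of `φ^{1/2}`
(`IsLocalField.abs_integral_four_le`), and each pair integrates to `|S|` times a constant controlled
by `φ̄`. Since the mixing condition only sees smooth functionals, this is applied to mollified data,
and the mollification is then removed.

The dual solution is never constructed. Its duality relation is tested on the solutions `c(t)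
e^{κ·x}` with complex `κ`, which lie in `ℋ` because only local energies are required to be finite.
This determines the Fourier–Laplace transform of `Φ` in terms of that of `Ψ`. Finite speed follows
by a Paley–Wiener argument from `|Im ω| ≤ |Re κ|` when `ω² = m² - κ·κ`.

The decay `t^{-n/2}` is obtained without stationary phase. The squared modulus of the oscillatory
integral is at most the integral over `u` of the modulus of the autocorrelation, whose phase is
`t(ω(w+u) - ω(w))`. Moving `w` into the complex domain in the direction of `u` makes this phase
damp, by strict convexity of the dispersion relation, and the autocorrelation becomes `O((1 + c
t|u|)^{-(n+1)})`, whose integral is `O(t^{-n})`.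

For the Lindeberg condition, only `O(t/d + 1)` rooms meet the support of `Φ`, so the fourth moments
sum to `O(d/t + (d/t)²)`, and the truncated second moments are controlled by Chebyshev's inequality.
-/

set_option linter.unusedSectionVars false


/-! ### Covariance of bounded variables through their level sets. -/

section Mixing

variable {Ω : Type*} [MeasurableSpace Ω] {P : Measure Ω} [IsProbabilityMeasure P]

/-- The layer-cake formula for a variable with values in `[-a, a]`; the shift by `a` is the length
of the levels below zero. -/
lemma integral_indicator_lt_eq_add {a x : ℝ} (hx : |x| ≤ a) :
    ∫ s in Ioc (-a) a, (if s < x then (1 : ℝ) else 0) = x + a := by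
  obtain ⟨h1, h2⟩ := abs_le.1 hx
  have : (fun s : ℝ => if s < x then (1 : ℝ) else 0) = (Iio x).indicator (fun _ => 1) := by
    ext s; simp [Set.indicator]
  rw [this, setIntegral_indicator measurableSet_Iio]
  have h3 : Ioc (-a) a ∩ Iio x = Ioo (-a) x := by
    ext s; simp only [mem_inter_iff, mem_Ioc, mem_Iio, mem_Ioo]
    constructor
    · rintro ⟨⟨h, _⟩, h'⟩; exact ⟨h, h'⟩
    · rintro ⟨h, h'⟩; exact ⟨⟨h, by linarith⟩, h'⟩
  rw [h3]
  simp [Measure.real]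
  linarith

lemma integral_indicator_one_of_nullMeasurableSet {P : Measure Ω} {s : Set Ω} (hs : NullMeasurableSet s P) :
    ∫ ω, s.indicator (1 : Ω → ℝ) ω ∂P = P.real s := by
  rw [integral_indicator₀ hs]
  simp

/-- A covariance inequality for bounded random variables in terms of their level sets. -/
lemma abs_covariance_le_of_levelSets {X Z : Ω → ℝ} (hX : AEMeasurable X P) (hZ : AEMeasurable Z P)
    {a b c : ℝ} (ha : ∀ᵐ ω ∂P, |X ω| ≤ a) (hb : ∀ᵐ ω ∂P, |Z ω| ≤ b)
    (h : ∀ s u : ℝ, |P.real ({ω | s < X ω} ∩ {ω | u < Z ω})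
      - P.real {ω | s < X ω} * P.real {ω | u < Z ω}| ≤ c) :
    |∫ ω, X ω * Z ω ∂P - (∫ ω, X ω ∂P) * ∫ ω, Z ω ∂P| ≤ 4 * a * b * c := by
  have ha0 : 0 ≤ a := by obtain ⟨ω, hω⟩ := ha.exists; exact (abs_nonneg _).trans hω
  have hb0 : 0 ≤ b := by obtain ⟨ω, hω⟩ := hb.exists; exact (abs_nonneg _).trans hω
  set ν := (volume : Measure ℝ).restrict (Ioc (-a) a) with hν
  set ν' := (volume : Measure ℝ).restrict (Ioc (-b) b) with hν'
  have iX : Integrable X P := Integrable.of_bound hX.aestronglyMeasurable a (by simpa using ha)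
  have iZ : Integrable Z P := Integrable.of_bound hZ.aestronglyMeasurable b (by simpa using hb)
  have iXZ : Integrable (fun ω => X ω * Z ω) P :=
    iX.mul_bdd (c := b) hZ.aestronglyMeasurable (by simpa using hb)
  let f : Ω → ℝ → ℝ := fun ω s => if s < X ω then 1 else 0
  let g : Ω → ℝ → ℝ := fun ω s => if s < Z ω then 1 else 0
  have hfX : ∀ᵐ ω ∂P, ∫ s, f ω s ∂ν = X ω + a := by
    filter_upwards [ha] with ω hω using integral_indicator_lt_eq_add hω
  have hgZ : ∀ᵐ ω ∂P, ∫ s, g ω s ∂ν' = Z ω + b := by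
    filter_upwards [hb] with ω hω using integral_indicator_lt_eq_add hω
  have mX (s : ℝ) : NullMeasurableSet {ω | s < X ω} P :=
    nullMeasurableSet_lt aemeasurable_const hX
  have mZ (s : ℝ) : NullMeasurableSet {ω | s < Z ω} P :=
    nullMeasurableSet_lt aemeasurable_const hZ
  have e1 (s : ℝ) : ∫ ω, f ω s ∂P = P.real {ω | s < X ω} := by
    have : (fun ω => f ω s) = {ω | s < X ω}.indicator 1 := by
      ext ω; simp [f, Set.indicator]
    rw [this, integral_indicator_one_of_nullMeasurableSet (mX s)]
  have e2 (s : ℝ) : ∫ ω, g ω s ∂P = P.real {ω | s < Z ω} := by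
    have : (fun ω => g ω s) = {ω | s < Z ω}.indicator 1 := by
      ext ω; simp [g, Set.indicator]
    rw [this, integral_indicator_one_of_nullMeasurableSet (mZ s)]
  have e3 (s u : ℝ) : ∫ ω, f ω s * g ω u ∂P = P.real ({ω | s < X ω} ∩ {ω | u < Z ω}) := by
    have : (fun ω => f ω s * g ω u) = ({ω | s < X ω} ∩ {ω | u < Z ω}).indicator 1 := by
      ext ω; by_cases h1 : s < X ω <;> by_cases h2 : u < Z ω <;> simp [f, g, h1, h2]
    rw [this, integral_indicator_one_of_nullMeasurableSet ((mX s).inter (mZ u))]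
  have mf : AEStronglyMeasurable (fun p : Ω × ℝ × ℝ => f p.1 p.2.1) (P.prod (ν.prod ν')) := by
    have : (fun p : Ω × ℝ × ℝ => f p.1 p.2.1) = {p | p.2.1 < X p.1}.indicator (fun _ => 1) := by
      ext p; simp [f, Set.indicator]
    rw [this]
    refine aestronglyMeasurable_const.indicator₀ (nullMeasurableSet_lt ?_ ?_)
    · exact (measurable_fst.comp measurable_snd).aemeasurable
    · exact hX.comp_quasiMeasurePreserving Measure.quasiMeasurePreserving_fst
  have mg : AEStronglyMeasurable (fun p : Ω × ℝ × ℝ => g p.1 p.2.2) (P.prod (ν.prod ν')) := by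
    have : (fun p : Ω × ℝ × ℝ => g p.1 p.2.2) = {p | p.2.2 < Z p.1}.indicator (fun _ => 1) := by
      ext p; simp [g, Set.indicator]
    rw [this]
    refine aestronglyMeasurable_const.indicator₀ (nullMeasurableSet_lt ?_ ?_)
    · exact (measurable_snd.comp measurable_snd).aemeasurable
    · exact hZ.comp_quasiMeasurePreserving Measure.quasiMeasurePreserving_fst
  have bf (ω s) : ‖f ω s‖ ≤ 1 := by simp only [f]; split_ifs <;> simp
  have bg (ω s) : ‖g ω s‖ ≤ 1 := by simp only [g]; split_ifs <;> simp
  have ifg : Integrable (fun p : Ω × ℝ × ℝ => f p.1 p.2.1 * g p.1 p.2.2) (P.prod (ν.prod ν')) := by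
    refine Integrable.of_bound (mf.mul mg) 1 (Eventually.of_forall fun p => ?_)
    rw [norm_mul]; exact mul_le_one₀ (bf _ _) (norm_nonneg _) (bg _ _)
  have if1 : Integrable (fun p : Ω × ℝ × ℝ => f p.1 p.2.1) (P.prod (ν.prod ν')) :=
    Integrable.of_bound mf 1 (Eventually.of_forall fun p => bf _ _)
  have ig1 : Integrable (fun p : Ω × ℝ × ℝ => g p.1 p.2.2) (P.prod (ν.prod ν')) :=
    Integrable.of_bound mg 1 (Eventually.of_forall fun p => bg _ _)
  have iP1 : AEStronglyMeasurable (fun p : ℝ × ℝ => P.real {ω | p.1 < X ω}) (ν.prod ν') := by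
    simpa only [e1] using if1.integral_prod_right.aestronglyMeasurable
  have iP2 : AEStronglyMeasurable (fun p : ℝ × ℝ => P.real {ω | p.2 < Z ω}) (ν.prod ν') := by
    simpa only [e2] using ig1.integral_prod_right.aestronglyMeasurable
  have iP12 : Integrable (fun p : ℝ × ℝ => P.real {ω | p.1 < X ω} * P.real {ω | p.2 < Z ω})
      (ν.prod ν') := by
    refine Integrable.of_bound (iP1.mul iP2) 1 (Eventually.of_forall fun p => ?_)
    rw [norm_mul, Real.norm_of_nonneg measureReal_nonneg, Real.norm_of_nonneg measureReal_nonneg]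
    exact mul_le_one₀ measureReal_le_one measureReal_nonneg measureReal_le_one
  have iP3 : Integrable (fun p : ℝ × ℝ => P.real ({ω | p.1 < X ω} ∩ {ω | p.2 < Z ω}))
      (ν.prod ν') := by
    simpa only [e3] using ifg.integral_prod_right
  have mfs (ω : Ω) : Integrable (f ω) ν := by
    refine Integrable.of_bound ?_ 1 (Eventually.of_forall fun p => bf _ _)
    exact (Measurable.ite (measurableSet_lt measurable_id measurable_const) measurable_const
      measurable_const).aestronglyMeasurable
  -- Hoeffding's formula: replacing each shifted variable by the integral of its level indicators
  -- and exchanging integrals turns the mixed moment into an integral of joint probabilities.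
  have t1 : ∫ ω, (X ω + a) * (Z ω + b) ∂P =
      ∫ p, P.real ({ω | p.1 < X ω} ∩ {ω | p.2 < Z ω}) ∂(ν.prod ν') := by
    calc ∫ ω, (X ω + a) * (Z ω + b) ∂P
        = ∫ ω, ∫ p, f ω p.1 * g ω p.2 ∂(ν.prod ν') ∂P := by
          refine integral_congr_ae ?_
          filter_upwards [hfX, hgZ] with ω h1 h2
          rw [← h1, ← h2, integral_prod_mul]
      _ = ∫ p, ∫ ω, f ω p.1 * g ω p.2 ∂P ∂(ν.prod ν') :=
          integral_integral_swap ifg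
      _ = _ := by simp only [e3]
  have mfc : Integrable (fun p : Ω × ℝ => f p.1 p.2) (P.prod ν) := by
    have : (fun p : Ω × ℝ => f p.1 p.2) = {p | p.2 < X p.1}.indicator (fun _ => 1) := by
      ext p; simp [f, Set.indicator]
    refine Integrable.of_bound ?_ 1 (Eventually.of_forall fun p => bf _ _)
    rw [this]
    exact aestronglyMeasurable_const.indicator₀ (nullMeasurableSet_lt measurable_snd.aemeasurable
      (hX.comp_quasiMeasurePreserving Measure.quasiMeasurePreserving_fst))
  have mgc : Integrable (fun p : Ω × ℝ => g p.1 p.2) (P.prod ν') := by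
    have : (fun p : Ω × ℝ => g p.1 p.2) = {p | p.2 < Z p.1}.indicator (fun _ => 1) := by
      ext p; simp [g, Set.indicator]
    refine Integrable.of_bound ?_ 1 (Eventually.of_forall fun p => bg _ _)
    rw [this]
    exact aestronglyMeasurable_const.indicator₀ (nullMeasurableSet_lt measurable_snd.aemeasurable
      (hZ.comp_quasiMeasurePreserving Measure.quasiMeasurePreserving_fst))
  have t2 : (∫ ω, (X ω + a) ∂P) * ∫ ω, (Z ω + b) ∂P =
      ∫ p, P.real {ω | p.1 < X ω} * P.real {ω | p.2 < Z ω} ∂(ν.prod ν') := by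
    rw [integral_prod_mul (fun s => P.real {ω | s < X ω}) (fun s => P.real {ω | s < Z ω})]
    congr 1
    · rw [← integral_congr_ae hfX, integral_integral_swap mfc]
      simp only [e1]
    · rw [← integral_congr_ae hgZ, integral_integral_swap mgc]
      simp only [e2]
  -- Adding constants does not change a covariance, so the shifted variables may be used.
  have t3 : ∫ ω, X ω * Z ω ∂P - (∫ ω, X ω ∂P) * ∫ ω, Z ω ∂P =
      ∫ ω, (X ω + a) * (Z ω + b) ∂P - (∫ ω, (X ω + a) ∂P) * ∫ ω, (Z ω + b) ∂P := by
    have : (fun ω => (X ω + a) * (Z ω + b)) =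
        fun ω => X ω * Z ω + (b * X ω + (a * Z ω + a * b)) := by ext; ring
    rw [this, integral_add iXZ, integral_add, integral_add, integral_add iX, integral_add iZ,
      integral_const_mul, integral_const_mul]
    · simp only [integral_const, probReal_univ, smul_eq_mul, one_mul]; ring
    all_goals fun_prop
  rw [t3, t1, t2, ← integral_sub iP3 iP12, ← Real.norm_eq_abs]
  refine (norm_integral_le_of_norm_le_const (C := c) (Eventually.of_forall fun p => h _ _)).trans ?_
  have : (ν.prod ν').real univ = (2 * a) * (2 * b) := by
    rw [← univ_prod_univ, measureReal_prod_prod]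
    simp [hν, hν', Measure.real]
    rw [ENNReal.toReal_ofReal (by linarith), ENNReal.toReal_ofReal (by linarith)]; ring
  rw [this]; apply le_of_eq; ring

end Mixing

/-! ### Four-point functions of a mixing field. -/

section FourPoints

variable {n : ℕ} {Ω : Type*} [MeasurableSpace Ω] {P : Measure Ω} [IsProbabilityMeasure P]
  {Y₀ : Ω → State n}

/-- Bounds the set defining `mixingCoeff` from above, so that the real `sSup` there is a genuine
supremum. -/
lemma abs_sub_mul_div_le_one (A B : Set Ω) :
    |P.real (A ∩ B) - P.real A * P.real B| / P.real B ≤ 1 := by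
  refine div_le_one_of_le₀ ?_ measureReal_nonneg
  have h1 : P.real (A ∩ B) ≤ P.real B := measureReal_mono inter_subset_right
  have h2 : P.real A * P.real B ≤ P.real B :=
    mul_le_of_le_one_left measureReal_nonneg measureReal_le_one
  have h3 : 0 ≤ P.real A * P.real B := mul_nonneg measureReal_nonneg measureReal_nonneg
  have h4 : 0 ≤ P.real (A ∩ B) := measureReal_nonneg
  exact abs_le.2 ⟨by linarith, by linarith⟩

lemma mixingCoeff_nonneg (r : ℝ) : 0 ≤ mixingCoeff P Y₀ r := by
  refine Real.sSup_nonneg ?_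
  rintro c ⟨𝒜, ℬ, -, -, -, -, -, A, B, -, -, -, rfl⟩
  exact div_nonneg (abs_nonneg _) measureReal_nonneg

lemma mixingCoeff_le_one (r : ℝ) : mixingCoeff P Y₀ r ≤ 1 := by
  refine Real.sSup_le ?_ zero_le_one
  rintro c ⟨𝒜, ℬ, -, -, -, -, -, A, B, -, -, -, rfl⟩
  exact abs_sub_mul_div_le_one A B

/-- The quotient in the definition of `φ` is multiplied by `P(B) ≤ 1`; for a null event `B` both
terms on the left vanish. -/
lemma abs_sub_mul_le_mixingCoeff {𝒜 ℬ : Set (E n)} {r : ℝ} (h𝒜 : IsOpen 𝒜)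
    (h𝒜' : Bornology.IsBounded 𝒜) (hℬ : IsOpen ℬ) (hℬ' : Bornology.IsBounded ℬ)
    (hr : ∀ x ∈ 𝒜, ∀ y ∈ ℬ, r ≤ dist x y) {A B : Set Ω}
    (hA : MeasurableSet[sigmaAlg Y₀ 𝒜] A) (hB : MeasurableSet[sigmaAlg Y₀ ℬ] B) :
    |P.real (A ∩ B) - P.real A * P.real B| ≤ mixingCoeff P Y₀ r := by
  by_cases hPB : P B = 0
  · have h1 : P.real B = 0 := by simp [Measure.real, hPB]
    have h2 : P.real (A ∩ B) = 0 := by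
      simp [Measure.real, measure_mono_null inter_subset_right hPB]
    simpa [h1, h2] using mixingCoeff_nonneg r
  · have h0 : 0 < P.real B := ENNReal.toReal_pos hPB (measure_ne_top _ _)
    have : |P.real (A ∩ B) - P.real A * P.real B| / P.real B ≤ mixingCoeff P Y₀ r := by
      refine le_csSup ⟨1, ?_⟩
        ⟨𝒜, ℬ, h𝒜, h𝒜', hℬ, hℬ', hr, A, B, hA, hB, pos_iff_ne_zero.2 hPB, rfl⟩
      rintro c ⟨_, _, -, -, -, -, -, A, B, -, -, -, rfl⟩
      exact abs_sub_mul_div_le_one A B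
    rw [div_le_iff₀ h0] at this
    exact this.trans (mul_le_of_le_one_right (mixingCoeff_nonneg r) measureReal_le_one)

/-- A larger separation admits fewer pairs of regions. -/
lemma mixingCoeff_antitone : Antitone (mixingCoeff P Y₀) := by
  intro r s hrs
  refine Real.sSup_le ?_ (mixingCoeff_nonneg r)
  rintro c ⟨𝒜, ℬ, h1, h2, h3, h4, h5, A, B, hA, hB, hP, rfl⟩
  refine le_csSup ⟨1, ?_⟩
    ⟨𝒜, ℬ, h1, h2, h3, h4, fun x hx y hy => hrs.trans (h5 x hx y hy), A, B, hA, hB, hP, rfl⟩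
  rintro c ⟨_, _, -, -, -, -, -, A, B, -, -, -, rfl⟩
  exact abs_sub_mul_div_le_one A B

/-- The covariance inequality under uniform mixing. -/
lemma abs_covariance_le_mixingCoeff {𝒜 ℬ : Set (E n)} {r : ℝ} (h𝒜 : IsOpen 𝒜)
    (h𝒜' : Bornology.IsBounded 𝒜) (hℬ : IsOpen ℬ) (hℬ' : Bornology.IsBounded ℬ)
    (hr : ∀ x ∈ 𝒜, ∀ y ∈ ℬ, r ≤ dist x y) {X Z : Ω → ℝ}
    (hX : Measurable[sigmaAlg Y₀ 𝒜] X) (hZ : Measurable[sigmaAlg Y₀ ℬ] Z)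
    (hX' : AEMeasurable X P) (hZ' : AEMeasurable Z P) {a b : ℝ}
    (ha : ∀ᵐ ω ∂P, |X ω| ≤ a) (hb : ∀ᵐ ω ∂P, |Z ω| ≤ b) :
    |∫ ω, X ω * Z ω ∂P - (∫ ω, X ω ∂P) * ∫ ω, Z ω ∂P| ≤ 4 * a * b * mixingCoeff P Y₀ r :=
  abs_covariance_le_of_levelSets hX' hZ' ha hb fun _ _ =>
    abs_sub_mul_le_mixingCoeff h𝒜 h𝒜' hℬ hℬ' hr (hX measurableSet_Ioi) (hZ measurableSet_Ioi)

lemma sigmaAlg_mono {𝒜 ℬ : Set (E n)} (h : 𝒜 ⊆ ℬ) : sigmaAlg Y₀ 𝒜 ≤ sigmaAlg Y₀ ℬ :=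
  iSup_mono fun _ => iSup_mono' fun hΨ => ⟨⟨hΨ.1, hΨ.2.trans h⟩, le_rfl⟩

/-- A bounded centred random field whose value at `x` is determined by the initial data in the
`δ`-ball around `x`. -/
structure IsLocalField (P : Measure Ω) (Y₀ : Ω → State n) (X : E n → Ω → ℝ) (δ a : ℝ) : Prop where
  measurable : ∀ x, Measurable[sigmaAlg Y₀ (Metric.ball x δ)] (X x)
  aemeasurable : ∀ x, AEMeasurable (X x) P
  bound : ∀ x, ∀ᵐ ω ∂P, |X x ω| ≤ a
  mean_zero : ∀ x, ∫ ω, X x ω ∂P = 0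

/-- The square root of the mixing coefficient at the distance relevant for a pair of points. -/
def pairWeight (P : Measure Ω) (Y₀ : Ω → State n) (δ : ℝ) (x y : E n) : ℝ :=
  -- A third of the distance is the gap that the clustering of four points guarantees; `2 * δ` is
  -- lost because values at two points depend on the data in two `δ`-balls.
  √(mixingCoeff P Y₀ (dist x y / 3 - 2 * δ))

variable {X : E n → Ω → ℝ} {δ a : ℝ}

lemma pairWeight_comm (x y : E n) : pairWeight P Y₀ δ x y = pairWeight P Y₀ δ y x := by
  simp [pairWeight, dist_comm]

lemma pairWeight_nonneg (x y : E n) : 0 ≤ pairWeight P Y₀ δ x y := Real.sqrt_nonneg _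

/-- Writing `φ = √φ · √φ` lets a single mixing coefficient pay for both pairs of a pairing. This is
why the integral `φ̄` involves `φ^{1/2}`. -/
lemma mixingCoeff_le_pairWeight_mul {r : ℝ} {x y z w : E n} (h1 : dist x y / 3 ≤ r)
    (h2 : dist z w / 3 ≤ r) :
    mixingCoeff P Y₀ (r - 2 * δ) ≤ pairWeight P Y₀ δ x y * pairWeight P Y₀ δ z w := by
  rw [← Real.mul_self_sqrt (mixingCoeff_nonneg (P := P) (Y₀ := Y₀) (r - 2 * δ))]
  refine mul_le_mul ?_ ?_ (Real.sqrt_nonneg _) (Real.sqrt_nonneg _)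
  · exact Real.sqrt_le_sqrt (mixingCoeff_antitone (by linarith))
  · exact Real.sqrt_le_sqrt (mixingCoeff_antitone (by linarith))

lemma le_dist_of_mem_ball {x y p q : E n} {r : ℝ} (hp : p ∈ Metric.ball x δ)
    (hq : q ∈ Metric.ball y δ) (h : r ≤ dist x y) : r - 2 * δ ≤ dist p q := by
  rw [Metric.mem_ball] at hp hq
  have h1 := dist_triangle x p y
  have h2 := dist_triangle p q y
  rw [dist_comm] at hp
  linarith

namespace IsLocalField

lemma nonneg (hX : IsLocalField P Y₀ X δ a) : 0 ≤ a := by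
  obtain ⟨ω, hω⟩ := (hX.bound 0).exists
  exact (abs_nonneg _).trans hω

lemma abs_mul_le {f g : Ω → ℝ} {b c : ℝ} (hb : 0 ≤ b) (hf : ∀ᵐ ω ∂P, |f ω| ≤ b)
    (hg : ∀ᵐ ω ∂P, |g ω| ≤ c) : ∀ᵐ ω ∂P, |f ω * g ω| ≤ b * c := by
  filter_upwards [hf, hg] with ω h1 h2
  rw [abs_mul]; exact mul_le_mul h1 h2 (abs_nonneg _) hb

lemma abs_integral_two_le (hX : IsLocalField P Y₀ X δ a) (x y : E n) :
    |∫ ω, X x ω * X y ω ∂P| ≤ 4 * a ^ 2 * pairWeight P Y₀ δ x y := by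
  have h := abs_covariance_le_mixingCoeff (P := P) (Y₀ := Y₀) (r := dist x y - 2 * δ)
    (𝒜 := Metric.ball x δ) (ℬ := Metric.ball y δ)
    Metric.isOpen_ball Metric.isBounded_ball Metric.isOpen_ball Metric.isBounded_ball
    (fun p hp q hq => le_dist_of_mem_ball hp hq le_rfl)
    (hX.measurable x) (hX.measurable y) (hX.aemeasurable x) (hX.aemeasurable y) (hX.bound x)
    (hX.bound y)
  rw [hX.mean_zero, zero_mul, sub_zero] at h
  refine h.trans ?_
  -- Monotonicity replaces the distance by its third, and `φ ≤ √φ` because `φ ≤ 1`.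
  have h2 : mixingCoeff P Y₀ (dist x y - 2 * δ) ≤ pairWeight P Y₀ δ x y := by
    refine (mixingCoeff_antitone (show dist x y / 3 - 2 * δ ≤ _ by
      linarith [dist_nonneg (x := x) (y := y)])).trans ?_
    exact (Real.sqrt_sq (mixingCoeff_nonneg _)).symm.le.trans (Real.sqrt_le_sqrt
      (pow_le_of_le_one (mixingCoeff_nonneg _) (mixingCoeff_le_one _) two_ne_zero))
  have := mul_le_mul_of_nonneg_left h2 (show 0 ≤ 4 * a ^ 2 by positivity)
  calc _ = 4 * a ^ 2 * mixingCoeff P Y₀ (dist x y - 2 * δ) := by ring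
    _ ≤ _ := this

/-- The value at the isolated point is centred, so the expectation is its covariance with the
product of the other three values. -/
lemma abs_integral_four_le_of_isolated (hX : IsLocalField P Y₀ X δ a) {r : ℝ} {x y z w : E n}
    (h1 : r ≤ dist x y) (h2 : r ≤ dist x z) (h3 : r ≤ dist x w) :
    |∫ ω, X x ω * X y ω * X z ω * X w ω ∂P| ≤ 4 * a ^ 4 * mixingCoeff P Y₀ (r - 2 * δ) := by
  have ha := hX.nonneg
  let ℬ : Set (E n) := Metric.ball y δ ∪ Metric.ball z δ ∪ Metric.ball w δ
  have my : Measurable[sigmaAlg Y₀ ℬ] (X y) := (hX.measurable y).mono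
    (sigmaAlg_mono fun p hp => Or.inl (Or.inl hp)) le_rfl
  have mz : Measurable[sigmaAlg Y₀ ℬ] (X z) := (hX.measurable z).mono
    (sigmaAlg_mono fun p hp => Or.inl (Or.inr hp)) le_rfl
  have mw : Measurable[sigmaAlg Y₀ ℬ] (X w) := (hX.measurable w).mono
    (sigmaAlg_mono fun p hp => Or.inr hp) le_rfl
  have h := abs_covariance_le_mixingCoeff (P := P) (Y₀ := Y₀) (r := r - 2 * δ)
    (𝒜 := Metric.ball x δ) (ℬ := ℬ)
    (X := X x) (Z := fun ω => X y ω * X z ω * X w ω)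
    Metric.isOpen_ball Metric.isBounded_ball
    ((Metric.isOpen_ball.union Metric.isOpen_ball).union Metric.isOpen_ball)
    ((Metric.isBounded_ball.union Metric.isBounded_ball).union Metric.isBounded_ball)
    (by
      rintro p hp q ((hq | hq) | hq)
      · exact le_dist_of_mem_ball hp hq h1
      · exact le_dist_of_mem_ball hp hq h2
      · exact le_dist_of_mem_ball hp hq h3)
    (hX.measurable x) ((my.mul mz).mul mw) (hX.aemeasurable x)
    (((hX.aemeasurable y).mul (hX.aemeasurable z)).mul (hX.aemeasurable w)) (hX.bound x)
    (abs_mul_le (mul_nonneg ha ha) (abs_mul_le ha (hX.bound y) (hX.bound z)) (hX.bound w))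
  rw [hX.mean_zero, zero_mul, sub_zero] at h
  have e : (fun ω => X x ω * (X y ω * X z ω * X w ω)) =
    fun ω => X x ω * X y ω * X z ω * X w ω := by ext; ring
  rw [e] at h
  exact h.trans (le_of_eq (by ring))

/-- A product of two values is not centred: besides the covariance of the two products there remains
the product of two two-point functions, which gives the second term. -/
lemma abs_integral_four_le_of_pairs (hX : IsLocalField P Y₀ X δ a) {r : ℝ} {x y z w : E n}
    (h1 : r ≤ dist x z) (h2 : r ≤ dist x w) (h3 : r ≤ dist y z) (h4 : r ≤ dist y w) :
    |∫ ω, X x ω * X y ω * X z ω * X w ω ∂P| ≤ 4 * a ^ 4 * mixingCoeff P Y₀ (r - 2 * δ)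
      + 16 * a ^ 4 * (pairWeight P Y₀ δ x y * pairWeight P Y₀ δ z w) := by
  have ha := hX.nonneg
  let 𝒜 : Set (E n) := Metric.ball x δ ∪ Metric.ball y δ
  let ℬ : Set (E n) := Metric.ball z δ ∪ Metric.ball w δ
  have mx : Measurable[sigmaAlg Y₀ 𝒜] (X x) := (hX.measurable x).mono
    (sigmaAlg_mono fun p hp => Or.inl hp) le_rfl
  have my : Measurable[sigmaAlg Y₀ 𝒜] (X y) := (hX.measurable y).mono
    (sigmaAlg_mono fun p hp => Or.inr hp) le_rfl
  have mz : Measurable[sigmaAlg Y₀ ℬ] (X z) := (hX.measurable z).mono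
    (sigmaAlg_mono fun p hp => Or.inl hp) le_rfl
  have mw : Measurable[sigmaAlg Y₀ ℬ] (X w) := (hX.measurable w).mono
    (sigmaAlg_mono fun p hp => Or.inr hp) le_rfl
  have h := abs_covariance_le_mixingCoeff (P := P) (Y₀ := Y₀) (r := r - 2 * δ)
    (𝒜 := 𝒜) (ℬ := ℬ)
    (X := fun ω => X x ω * X y ω) (Z := fun ω => X z ω * X w ω)
    (Metric.isOpen_ball.union Metric.isOpen_ball)
    (Metric.isBounded_ball.union Metric.isBounded_ball)
    (Metric.isOpen_ball.union Metric.isOpen_ball)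
    (Metric.isBounded_ball.union Metric.isBounded_ball)
    (by
      rintro p (hp | hp) q (hq | hq)
      · exact le_dist_of_mem_ball hp hq h1
      · exact le_dist_of_mem_ball hp hq h2
      · exact le_dist_of_mem_ball hp hq h3
      · exact le_dist_of_mem_ball hp hq h4)
    (mx.mul my) (mz.mul mw) ((hX.aemeasurable x).mul (hX.aemeasurable y))
    ((hX.aemeasurable z).mul (hX.aemeasurable w))
    (abs_mul_le ha (hX.bound x) (hX.bound y)) (abs_mul_le ha (hX.bound z) (hX.bound w))
  have e : (fun ω => X x ω * X y ω * (X z ω * X w ω)) =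
    fun ω => X x ω * X y ω * X z ω * X w ω := by ext; ring
  rw [e] at h
  have h5 : |(∫ ω, X x ω * X y ω ∂P) * ∫ ω, X z ω * X w ω ∂P| ≤
      (4 * a ^ 2 * pairWeight P Y₀ δ x y) * (4 * a ^ 2 * pairWeight P Y₀ δ z w) := by
    rw [abs_mul]
    exact mul_le_mul (hX.abs_integral_two_le x y) (hX.abs_integral_two_le z w) (abs_nonneg _)
      ((abs_nonneg _).trans (hX.abs_integral_two_le x y))
  have h6 := abs_sub_abs_le_abs_sub (∫ ω, X x ω * X y ω * X z ω * X w ω ∂P)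
    ((∫ ω, X x ω * X y ω ∂P) * ∫ ω, X z ω * X w ω ∂P)
  have h7 : 4 * (a * a) * (a * a) * mixingCoeff P Y₀ (r - 2 * δ) =
    4 * a ^ 4 * mixingCoeff P Y₀ (r - 2 * δ) := by ring
  have h8 : (4 * a ^ 2 * pairWeight P Y₀ δ x y) * (4 * a ^ 2 * pairWeight P Y₀ δ z w) =
    16 * a ^ 4 * (pairWeight P Y₀ δ x y * pairWeight P Y₀ δ z w) := by ring
  linarith

/-- The sum over the three pairings of four points of the products of pair weights. -/
def _root_.KleinGordon.pairingSum (P : Measure Ω) (Y₀ : Ω → State n) (δ : ℝ) (x y z w : E n) : ℝ :=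
  pairWeight P Y₀ δ x y * pairWeight P Y₀ δ z w + pairWeight P Y₀ δ x z * pairWeight P Y₀ δ y w
    + pairWeight P Y₀ δ x w * pairWeight P Y₀ δ y z

/-- With `x`, `y` at the largest distance `3r`, either one of them is `r`-separated from the three
other points, or each has one of `z`, `w` within `r`. These neighbours are distinct, and the two
close pairs are at mutual distance at least `r`. All six distances are at most `3r`, so `φ(r - 2δ)`
is below the weight of every pairing; the constant is `20 = 4 + 16`. -/
lemma abs_integral_four_le_of_dist_max (hX : IsLocalField P Y₀ X δ a) {x y z w : E n}
    (h1 : dist x z ≤ dist x y) (h2 : dist x w ≤ dist x y) (h3 : dist y z ≤ dist x y)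
    (h4 : dist y w ≤ dist x y) (h5 : dist z w ≤ dist x y) :
    |∫ ω, X x ω * X y ω * X z ω * X w ω ∂P| ≤ 20 * a ^ 4 * pairingSum P Y₀ δ x y z w := by
  set r := dist x y / 3 with hr
  have hd := dist_nonneg (x := x) (y := y)
  have a4 : 0 ≤ a ^ 4 := by have := hX.nonneg; positivity
  have w1 : 0 ≤ pairWeight P Y₀ δ x y * pairWeight P Y₀ δ z w :=
    mul_nonneg (pairWeight_nonneg _ _) (pairWeight_nonneg _ _)
  have w2 : 0 ≤ pairWeight P Y₀ δ x z * pairWeight P Y₀ δ y w :=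
    mul_nonneg (pairWeight_nonneg _ _) (pairWeight_nonneg _ _)
  have w3 : 0 ≤ pairWeight P Y₀ δ x w * pairWeight P Y₀ δ y z :=
    mul_nonneg (pairWeight_nonneg _ _) (pairWeight_nonneg _ _)
  have m1 : mixingCoeff P Y₀ (r - 2 * δ) ≤ pairWeight P Y₀ δ x y * pairWeight P Y₀ δ z w :=
    mixingCoeff_le_pairWeight_mul (by linarith) (by linarith)
  have m2 : mixingCoeff P Y₀ (r - 2 * δ) ≤ pairWeight P Y₀ δ x z * pairWeight P Y₀ δ y w :=
    mixingCoeff_le_pairWeight_mul (by linarith) (by linarith)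
  have m3 : mixingCoeff P Y₀ (r - 2 * δ) ≤ pairWeight P Y₀ δ x w * pairWeight P Y₀ δ y z :=
    mixingCoeff_le_pairWeight_mul (by linarith) (by linarith)
  unfold pairingSum
  by_cases c1 : r ≤ dist x z ∧ r ≤ dist x w
  · have := hX.abs_integral_four_le_of_isolated (r := r) (x := x) (y := y) (by linarith) c1.1 c1.2
    nlinarith [mul_nonneg a4 w1, mul_nonneg a4 w2, mul_nonneg a4 w3,
      mul_le_mul_of_nonneg_left m1 a4]
  by_cases c2 : r ≤ dist y z ∧ r ≤ dist y w
  · have := hX.abs_integral_four_le_of_isolated (r := r) (x := y) (y := x)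
      (by rw [dist_comm]; linarith) c2.1 c2.2
    have e : (fun ω => X y ω * X x ω * X z ω * X w ω) =
      fun ω => X x ω * X y ω * X z ω * X w ω := by ext; ring
    rw [e] at this
    nlinarith [mul_nonneg a4 w1, mul_nonneg a4 w2, mul_nonneg a4 w3,
      mul_le_mul_of_nonneg_left m1 a4]
  have t1 := dist_triangle x z y
  have t2 := dist_triangle x w y
  have t3 := dist_triangle4 x z w y
  have t4 := dist_triangle4 x w z y
  rw [dist_comm z y] at t1 t4
  rw [dist_comm w y] at t2 t3
  rw [dist_comm w z] at t4
  -- Neither `x` nor `y` is isolated now. The close pairs are `{x, z}`, `{y, w}` or `{x, w}`, `{y,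
  -- z}`; the triangle inequality bounds the four cross distances from below.
  by_cases c3 : dist x z < r
  · have c4 : dist y w < r := by
      by_contra hc
      exact c2 ⟨by linarith, by linarith⟩
    have := hX.abs_integral_four_le_of_pairs (r := r) (x := x) (y := z) (z := y) (w := w)
      (by linarith) (by linarith) (by rw [dist_comm]; linarith) (by linarith)
    have e : (fun ω => X x ω * X z ω * X y ω * X w ω) =
      fun ω => X x ω * X y ω * X z ω * X w ω := by ext; ring
    rw [e] at this
    nlinarith [mul_nonneg a4 w1, mul_nonneg a4 w2, mul_nonneg a4 w3,
      mul_le_mul_of_nonneg_left m2 a4]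
  · have c5 : dist x w < r := by
      by_contra hc
      exact c1 ⟨by linarith, by linarith⟩
    have c4 : dist y z < r := by
      by_contra hc
      exact c2 ⟨by linarith, by linarith⟩
    have := hX.abs_integral_four_le_of_pairs (r := r) (x := x) (y := w) (z := y) (w := z)
      (by linarith) (by linarith) (by rw [dist_comm]; linarith) (by rw [dist_comm]; linarith)
    have e : (fun ω => X x ω * X w ω * X y ω * X z ω) =
      fun ω => X x ω * X y ω * X z ω * X w ω := by ext; ring
    rw [e] at this
    nlinarith [mul_nonneg a4 w1, mul_nonneg a4 w2, mul_nonneg a4 w3,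
      mul_le_mul_of_nonneg_left m3 a4]

/-- The four-point function of a local field is bounded by the sum over pairings. -/
lemma abs_integral_four_le (hX : IsLocalField P Y₀ X δ a) (x y z w : E n) :
    |∫ ω, X x ω * X y ω * X z ω * X w ω ∂P| ≤ 20 * a ^ 4 * pairingSum P Y₀ δ x y z w := by
  -- Both sides are symmetric in the four points, so they may be relabelled to put the largest
  -- distance between the first two.
  have key : ∀ {x' y' z' w' : E n}, dist x' z' ≤ dist x' y' → dist x' w' ≤ dist x' y' →
      dist y' z' ≤ dist x' y' → dist y' w' ≤ dist x' y' → dist z' w' ≤ dist x' y' →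
      (fun ω => X x' ω * X y' ω * X z' ω * X w' ω) =
        (fun ω => X x ω * X y ω * X z ω * X w ω) →
      pairingSum P Y₀ δ x' y' z' w' = pairingSum P Y₀ δ x y z w →
      |∫ ω, X x ω * X y ω * X z ω * X w ω ∂P| ≤ 20 * a ^ 4 * pairingSum P Y₀ δ x y z w := by
    intro x' y' z' w' h1 h2 h3 h4 h5 h6 h7
    rw [← h6, ← h7]
    exact hX.abs_integral_four_le_of_dist_max h1 h2 h3 h4 h5
  have c1 := pairWeight_comm (P := P) (Y₀ := Y₀) (δ := δ) x y
  have c2 := pairWeight_comm (P := P) (Y₀ := Y₀) (δ := δ) x z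
  have c3 := pairWeight_comm (P := P) (Y₀ := Y₀) (δ := δ) x w
  have c4 := pairWeight_comm (P := P) (Y₀ := Y₀) (δ := δ) y z
  have c5 := pairWeight_comm (P := P) (Y₀ := Y₀) (δ := δ) y w
  have c6 := pairWeight_comm (P := P) (Y₀ := Y₀) (δ := δ) z w
  obtain ⟨D, hD⟩ : ∃ D, D = max (dist x y) (max (dist x z) (max (dist x w)
    (max (dist y z) (max (dist y w) (dist z w))))) := ⟨_, rfl⟩
  have b1 : dist x y ≤ D := by simp [hD]
  have b2 : dist x z ≤ D := by simp [hD]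
  have b3 : dist x w ≤ D := by simp [hD]
  have b4 : dist y z ≤ D := by simp [hD]
  have b5 : dist y w ≤ D := by simp [hD]
  have b6 : dist z w ≤ D := by simp [hD]
  have hcases : D = dist x y ∨ D = dist x z ∨ D = dist x w ∨ D = dist y z ∨ D = dist y w ∨
      D = dist z w := by
    rw [hD]
    rcases max_choice (dist x y) (max (dist x z) (max (dist x w)
      (max (dist y z) (max (dist y w) (dist z w))))) with h | h <;> rw [h]
    · simp
    rcases max_choice (dist x z) (max (dist x w)
      (max (dist y z) (max (dist y w) (dist z w)))) with h | h <;> rw [h]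
    · simp
    rcases max_choice (dist x w) (max (dist y z) (max (dist y w) (dist z w))) with h | h <;> rw [h]
    · simp
    rcases max_choice (dist y z) (max (dist y w) (dist z w)) with h | h <;> rw [h]
    · simp
    rcases max_choice (dist y w) (dist z w) with h | h <;> rw [h] <;> simp
  have s1 := dist_comm x y
  have s2 := dist_comm x z
  have s3 := dist_comm x w
  have s4 := dist_comm y z
  have s5 := dist_comm y w
  have s6 := dist_comm z w
  rcases hcases with h | h | h | h | h | h
  · exact key (x' := x) (y' := y) (z' := z) (w' := w) (by linarith) (by linarith) (by linarith)
      (by linarith) (by linarith) rfl rfl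
  · exact key (x' := x) (y' := z) (z' := y) (w' := w) (by linarith) (by linarith) (by linarith)
      (by linarith) (by linarith) (by ext; ring) (by simp only [pairingSum, c4]; ring)
  · exact key (x' := x) (y' := w) (z' := y) (w' := z) (by linarith) (by linarith) (by linarith)
      (by linarith) (by linarith) (by ext; ring) (by simp only [pairingSum, c5, c6]; ring)
  · exact key (x' := y) (y' := z) (z' := x) (w' := w) (by linarith) (by linarith) (by linarith)
      (by linarith) (by linarith) (by ext; ring) (by simp only [pairingSum, c1, c2]; ring)
  · exact key (x' := y) (y' := w) (z' := x) (w' := z) (by linarith) (by linarith) (by linarith)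
      (by linarith) (by linarith) (by ext; ring) (by simp only [pairingSum, c1, c3, c6]; ring)
  · exact key (x' := z) (y' := w) (z' := x) (w' := y) (by linarith) (by linarith) (by linarith)
      (by linarith) (by linarith) (by ext; ring) (by simp only [pairingSum, c2, c3, c4, c5]; ring)

end IsLocalField

end FourPoints

/-! ### Fourth moments of integrated local fields. -/

section FourthMoment

lemma quasiMeasurePreserving_prodMap {α β γ δ : Type*} [MeasurableSpace α] [MeasurableSpace β]
    [MeasurableSpace γ] [MeasurableSpace δ] {μ : Measure α} {ν : Measure β} {μ' : Measure γ}
    {ν' : Measure δ} [SFinite μ] [SFinite μ'] [SFinite ν'] [SFinite ν] {f : α → β} {g : γ → δ}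
    (hf : Measure.QuasiMeasurePreserving f μ ν) (hg : Measure.QuasiMeasurePreserving g μ' ν') :
    Measure.QuasiMeasurePreserving (Prod.map f g) (μ.prod μ') (ν.prod ν') :=
  ⟨hf.measurable.prodMap hg.measurable,
    (Measure.map_prod_map μ μ' hf.measurable hg.measurable).symm.absolutelyContinuous.trans
      (hf.absolutelyContinuous.prod hg.absolutelyContinuous)⟩

variable {n : ℕ} {Ω : Type*} [MeasurableSpace Ω] {P : Measure Ω} [IsProbabilityMeasure P]
  {Y₀ : Ω → State n}

/-- A bound for the integral of the pair weights in terms of a bound `K` for `φ̄`. -/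
def pairBound (n : ℕ) (K : ℝ) : ℝ :=
  -- The unit ball accounts for nearby points, where the weight is at most one. The other term is `∫
  -- √φ(|x|/6) dx` in polar coordinates, the dilation by `6` giving `6 ^ n`.
  volume.real (Metric.closedBall (0 : E n) 1) +
    6 ^ n * (n * (volume.real (Metric.ball (0 : E n) 1) * K))

lemma pairBound_nonneg (n : ℕ) {K : ℝ} (hK : 0 ≤ K) : 0 ≤ pairBound n K := by
  unfold pairBound; positivity

lemma measurable_sqrt_mixingCoeff : Measurable fun r => √(mixingCoeff P Y₀ r) :=
  (mixingCoeff_antitone.measurable).sqrt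

lemma lintegral_sqrt_mixingCoeff_norm_le (hn : 1 ≤ n) {K : ℝ≥0} (hK : mixingIntegral P Y₀ ≤ K) :
    ∫⁻ x : E n, ENNReal.ofReal √(mixingCoeff P Y₀ (‖x‖ / 6)) ≤
      ENNReal.ofReal (6 ^ n * (n * (volume.real (Metric.ball (0 : E n) 1) * K))) := by
  have : Nonempty (Fin n) := ⟨⟨0, hn⟩⟩
  let f : ℝ → ℝ := fun r => √(mixingCoeff P Y₀ r)
  have hdim : Module.finrank ℝ (E n) = n := by simp
  have hm : Measurable fun r : ℝ => r ^ (n - 1) * f r :=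
    (measurable_id.pow_const _).mul measurable_sqrt_mixingCoeff
  have hpos : ∀ᵐ r ∂(volume.restrict (Ioi (0 : ℝ))), 0 ≤ r ^ (n - 1) * f r := by
    filter_upwards [ae_restrict_mem measurableSet_Ioi] with r hr
    exact mul_nonneg (pow_nonneg (le_of_lt hr) _) (Real.sqrt_nonneg _)
  have hint : IntegrableOn (fun r : ℝ => r ^ (n - 1) * f r) (Ioi 0) := by
    refine ⟨hm.aestronglyMeasurable, ?_⟩
    rw [hasFiniteIntegral_iff_ofReal hpos]
    exact hK.trans_lt ENNReal.coe_lt_top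
  have hval : ∫ r in Ioi (0 : ℝ), r ^ (n - 1) * f r ≤ K := by
    rw [integral_eq_lintegral_of_nonneg_ae hpos hm.aestronglyMeasurable]
    exact ENNReal.toReal_le_of_le_ofReal K.2 (by rw [ENNReal.ofReal_coe_nnreal]; exact hK)
  have i1 : Integrable (fun x : E n => f ‖x‖) := by
    rw [integrable_fun_norm_addHaar volume, hdim]
    exact hint
  have e1 : (fun x : E n => f (‖x‖ / 6)) = fun x => (fun y : E n => f ‖y‖) ((6 : ℝ)⁻¹ • x) := by
    ext x; simp only [norm_smul, norm_inv, Real.norm_ofNat]; congr 1; ring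
  have i2 : Integrable (fun x : E n => f (‖x‖ / 6)) := by
    rw [e1]
    exact (integrable_comp_smul_iff volume (fun y : E n => f ‖y‖) (by norm_num)).2 i1
  rw [← ofReal_integral_eq_lintegral_ofReal i2 (Eventually.of_forall fun x => Real.sqrt_nonneg _)]
  refine ENNReal.ofReal_le_ofReal ?_
  rw [e1, Measure.integral_comp_inv_smul volume (fun y : E n => f ‖y‖), integral_fun_norm_addHaar volume, hdim]
  simp only [smul_eq_mul, nsmul_eq_mul]
  rw [abs_of_nonneg (by positivity)]
  gcongr

lemma measurable_pairWeight (δ : ℝ) :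
    Measurable fun p : E n × E n => ENNReal.ofReal (pairWeight P Y₀ δ p.1 p.2) := by
  refine ENNReal.measurable_ofReal.comp (measurable_sqrt_mixingCoeff.comp ?_)
  fun_prop

lemma lintegral_pairWeight_le (hn : 1 ≤ n) {K : ℝ≥0} (hK : mixingIntegral P Y₀ ≤ K) {δ : ℝ}
    (hδ : δ ≤ 1 / 12) (x : E n) :
    ∫⁻ y, ENNReal.ofReal (pairWeight P Y₀ δ x y) ≤ ENNReal.ofReal (pairBound n K) := by
  let H : E n → ℝ≥0∞ := fun y => (Metric.closedBall (0 : E n) 1).indicator 1 y +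
    ENNReal.ofReal √(mixingCoeff P Y₀ (‖y‖ / 6))
  have h1 (y : E n) : ENNReal.ofReal (pairWeight P Y₀ δ x y) ≤ H (y - x) := by
    have hd : dist x y = ‖y - x‖ := by rw [dist_comm, dist_eq_norm]
    simp only [pairWeight, H, hd]
    -- For distances `s > 1` and `δ ≤ 1/12` one has `s/3 - 2δ ≥ s/6`.
    by_cases hy : ‖y - x‖ ≤ 1
    · refine le_add_right ?_
      rw [indicator_of_mem (by simpa using hy), Pi.one_apply, ← ENNReal.ofReal_one]
      exact ENNReal.ofReal_le_ofReal (Real.sqrt_le_one.2 (mixingCoeff_le_one _))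
    · refine le_add_left (ENNReal.ofReal_le_ofReal (Real.sqrt_le_sqrt (mixingCoeff_antitone ?_)))
      push Not at hy
      linarith
  calc ∫⁻ y, ENNReal.ofReal (pairWeight P Y₀ δ x y) ≤ ∫⁻ y, H (y - x) := lintegral_mono h1
    _ = ∫⁻ y, H y := lintegral_sub_right_eq_self H x
    _ = volume (Metric.closedBall (0 : E n) 1) +
        ∫⁻ y : E n, ENNReal.ofReal √(mixingCoeff P Y₀ (‖y‖ / 6)) := by
      rw [lintegral_add_left (measurable_one.indicator measurableSet_closedBall),
        lintegral_indicator_one measurableSet_closedBall]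
    _ ≤ _ := by
      unfold pairBound
      rw [ENNReal.ofReal_add (by positivity) (by positivity)]
      refine add_le_add (le_of_eq ?_) (lintegral_sqrt_mixingCoeff_norm_le hn hK)
      rw [ofReal_measureReal measure_closedBall_lt_top.ne]

variable {X : E n → Ω → ℝ} {δ a : ℝ}

/-- In each of the two pairs of a pairing, one point is kept in `S` and contributes `volume S`,
while the other is integrated over the whole space and contributes at most `I`. Dropping two of the
four constraints thus yields the second power of the volume. -/
lemma lintegral_pairing_products_le_of_kernel {α : Type*} [MeasureSpace α]
    [SFinite (volume : Measure α)] {W : α → α → ℝ≥0∞} (hW : Measurable (Function.uncurry W))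
    {I : ℝ≥0∞} (hWi : ∀ x, ∫⁻ y, W x y ≤ I) {S : Set α} (hS : MeasurableSet S) :
    ∫⁻ p : (α × α) × (α × α), ((S ×ˢ S) ×ˢ (S ×ˢ S)).indicator
      (fun p => W p.1.1 p.1.2 * W p.2.1 p.2.2 + W p.1.1 p.2.1 * W p.1.2 p.2.2
        + W p.1.1 p.2.2 * W p.1.2 p.2.1) p ≤ 3 * (volume S * I) ^ 2 := by
  let σ : α → ℝ≥0∞ := S.indicator 1
  have hσ : Measurable σ := measurable_one.indicator hS
  have hσi : ∫⁻ x, σ x = volume S := lintegral_indicator_one hS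
  have mW {f g : (α × α) × (α × α) → α} (hf : Measurable f) (hg : Measurable g) :
      Measurable fun p => W (f p) (g p) := hW.comp (hf.prodMk hg)
  have hle : ∀ p : (α × α) × (α × α), ((S ×ˢ S) ×ˢ (S ×ˢ S)).indicator
      (fun p => W p.1.1 p.1.2 * W p.2.1 p.2.2 + W p.1.1 p.2.1 * W p.1.2 p.2.2
        + W p.1.1 p.2.2 * W p.1.2 p.2.1) p ≤
      (σ p.1.1 * W p.1.1 p.1.2) * (σ p.2.1 * W p.2.1 p.2.2) +
      (σ p.1.1 * σ p.1.2) * (W p.1.1 p.2.1 * W p.1.2 p.2.2) +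
      (σ p.1.1 * σ p.1.2) * (W p.1.1 p.2.2 * W p.1.2 p.2.1) := by
    intro p
    by_cases hp : p ∈ (S ×ˢ S) ×ˢ (S ×ˢ S)
    · rw [indicator_of_mem hp]
      obtain ⟨⟨h1, h2⟩, h3, h4⟩ := hp
      simp only [σ, indicator_of_mem h1, indicator_of_mem h2, indicator_of_mem h3, Pi.one_apply,
        one_mul, le_refl]
    · rw [indicator_of_notMem hp]; exact bot_le
  have mWx (x) : Measurable (W x) := hW.comp measurable_prodMk_left
  have mσW : Measurable fun q : α × α => σ q.1 * W q.1 q.2 := (hσ.comp measurable_fst).mul hW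
  have mσσ : Measurable fun q : α × α => σ q.1 * σ q.2 :=
    (hσ.comp measurable_fst).mul (hσ.comp measurable_snd)
  have m1 : Measurable fun p : (α × α) × (α × α) =>
      (σ p.1.1 * W p.1.1 p.1.2) * (σ p.2.1 * W p.2.1 p.2.2) :=
    (mσW.comp measurable_fst).mul (mσW.comp measurable_snd)
  have m2 : Measurable fun p : (α × α) × (α × α) =>
      (σ p.1.1 * σ p.1.2) * (W p.1.1 p.2.1 * W p.1.2 p.2.2) :=
    (mσσ.comp measurable_fst).mul ((mW (by fun_prop) (by fun_prop)).mul
      (mW (by fun_prop) (by fun_prop)))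
  have m3 : Measurable fun p : (α × α) × (α × α) =>
      (σ p.1.1 * σ p.1.2) * (W p.1.1 p.2.2 * W p.1.2 p.2.1) :=
    (mσσ.comp measurable_fst).mul ((mW (by fun_prop) (by fun_prop)).mul
      (mW (by fun_prop) (by fun_prop)))
  have hWσ : ∫⁻ q : α × α, σ q.1 * W q.1 q.2 ≤ volume S * I := by
    rw [Measure.volume_eq_prod, lintegral_prod _ mσW.aemeasurable]
    calc ∫⁻ x, ∫⁻ y, σ x * W x y ≤ ∫⁻ x, σ x * I := by
          refine lintegral_mono fun x => ?_
          rw [lintegral_const_mul _ (mWx x)]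
          exact mul_le_mul_right (hWi x) _
      _ = volume S * I := by rw [lintegral_mul_const _ hσ, hσi]
  have hσσ : ∫⁻ q : α × α, σ q.1 * σ q.2 = volume S * volume S := by
    rw [Measure.volume_eq_prod, lintegral_prod_mul hσ.aemeasurable hσ.aemeasurable, hσi]
  have hWW (x y : α) : ∫⁻ q : α × α, W x q.1 * W y q.2 ≤ I * I := by
    rw [Measure.volume_eq_prod, lintegral_prod_mul (mWx x).aemeasurable (mWx y).aemeasurable]
    exact mul_le_mul' (hWi x) (hWi y)
  have b1 : ∫⁻ p : (α × α) × (α × α),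
      (σ p.1.1 * W p.1.1 p.1.2) * (σ p.2.1 * W p.2.1 p.2.2) ≤ (volume S * I) ^ 2 := by
    rw [Measure.volume_eq_prod (α × α) (α × α),
      lintegral_prod_mul (f := fun q : α × α => σ q.1 * W q.1 q.2)
        (g := fun q : α × α => σ q.1 * W q.1 q.2) mσW.aemeasurable mσW.aemeasurable, sq]
    exact mul_le_mul' hWσ hWσ
  have b2 : ∫⁻ p : (α × α) × (α × α),
      (σ p.1.1 * σ p.1.2) * (W p.1.1 p.2.1 * W p.1.2 p.2.2) ≤ (volume S * I) ^ 2 := by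
    rw [Measure.volume_eq_prod (α × α) (α × α), lintegral_prod _ m2.aemeasurable]
    calc _ ≤ ∫⁻ q : α × α, (σ q.1 * σ q.2) * (I * I) := by
          refine lintegral_mono fun q => ?_
          simp only
          rw [lintegral_const_mul]
          · exact mul_le_mul_right (hWW _ _) _
          · exact ((mWx q.1).comp measurable_fst).mul ((mWx q.2).comp measurable_snd)
      _ = _ := by rw [lintegral_mul_const _ mσσ, hσσ]; ring
  have b3 : ∫⁻ p : (α × α) × (α × α),
      (σ p.1.1 * σ p.1.2) * (W p.1.1 p.2.2 * W p.1.2 p.2.1) ≤ (volume S * I) ^ 2 := by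
    rw [Measure.volume_eq_prod (α × α) (α × α), lintegral_prod _ m3.aemeasurable]
    calc _ ≤ ∫⁻ q : α × α, (σ q.1 * σ q.2) * (I * I) := by
          refine lintegral_mono fun q => ?_
          simp only
          rw [lintegral_const_mul]
          · refine mul_le_mul_right (le_trans (le_of_eq ?_) (hWW q.2 q.1)) _
            congr 1; ext r; rw [mul_comm]
          · exact ((mWx q.1).comp measurable_snd).mul ((mWx q.2).comp measurable_fst)
      _ = _ := by rw [lintegral_mul_const _ mσσ, hσσ]; ring
  calc _ ≤ _ := lintegral_mono hle
    _ ≤ (volume S * I) ^ 2 + (volume S * I) ^ 2 + (volume S * I) ^ 2 := by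
      rw [lintegral_add_right _ m3, lintegral_add_left m1]
      exact add_le_add (add_le_add b1 b2) b3
    _ = _ := by ring

lemma lintegral_pairingSum_le (hn : 1 ≤ n) {K : ℝ≥0} (hK : mixingIntegral P Y₀ ≤ K)
    (hδ : δ ≤ 1 / 12) {S : Set (E n)} (hS : MeasurableSet S) :
    ∫⁻ p : (E n × E n) × (E n × E n), ((S ×ˢ S) ×ˢ (S ×ˢ S)).indicator
      (fun p => ENNReal.ofReal (pairingSum P Y₀ δ p.1.1 p.1.2 p.2.1 p.2.2)) p ≤
      3 * (volume S * ENNReal.ofReal (pairBound n K)) ^ 2 := by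
  have := lintegral_pairing_products_le_of_kernel
    (measurable_pairWeight (P := P) (Y₀ := Y₀) δ) (lintegral_pairWeight_le hn hK hδ) hS
  refine le_trans (le_of_eq ?_) this
  congr 1; ext p; congr 1; ext p
  have h := fun x y => pairWeight_nonneg (P := P) (Y₀ := Y₀) (δ := δ) x y
  rw [pairingSum, ENNReal.ofReal_add (add_nonneg (mul_nonneg (h _ _) (h _ _))
    (mul_nonneg (h _ _) (h _ _))) (mul_nonneg (h _ _) (h _ _)),
    ENNReal.ofReal_add (mul_nonneg (h _ _) (h _ _)) (mul_nonneg (h _ _) (h _ _))]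
  simp only [ENNReal.ofReal_mul (h _ _)]

/-- The fourth moment of the integral of a local field over a set of finite volume. -/
lemma IsLocalField.integral_fourth_le (hX : IsLocalField P Y₀ X δ a) (hn : 1 ≤ n) {K : ℝ≥0}
    (hK : mixingIntegral P Y₀ ≤ K) (hδ : δ ≤ 1 / 12) {S : Set (E n)} (hS : MeasurableSet S)
    (hSv : volume S < ∞) (hXS : ∀ x ∉ S, ∀ ω, X x ω = 0)
    (hXm : AEStronglyMeasurable (fun p : Ω × E n => X p.2 p.1) (P.prod volume))
    (hXb : ∀ᵐ ω ∂P, ∀ x, |X x ω| ≤ a) :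
    ∫ ω, (∫ x, X x ω) ^ 4 ∂P ≤ 60 * a ^ 4 * (volume.real S * pairBound n K) ^ 2 := by
  have ha := hX.nonneg
  let Q : Ω → (E n × E n) × (E n × E n) → ℝ := fun ω p =>
    X p.1.1 ω * X p.1.2 ω * (X p.2.1 ω * X p.2.2 ω)
  let T : Set ((E n × E n) × (E n × E n)) := (S ×ˢ S) ×ˢ (S ×ˢ S)
  have hT : MeasurableSet T := (hS.prod hS).prod (hS.prod hS)
  have hTv : volume T = (volume S) ^ 4 := by
    simp only [T, Measure.volume_eq_prod, Measure.prod_prod]; ring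
  have hQT (ω) (p) (hp : p ∉ T) : Q ω p = 0 := by
    simp only [T, mem_prod, not_and_or] at hp
    rcases hp with (h | h) | (h | h) <;> simp [Q, hXS _ h ω]
  -- The fourth power becomes an integral over four points, so that the expectation can be taken
  -- under it.
  have e1 (ω : Ω) : (∫ x, X x ω) ^ 4 = ∫ p, Q ω p := by
    have h2 : ∫ q : E n × E n, X q.1 ω * X q.2 ω = (∫ x, X x ω) * ∫ x, X x ω :=
      integral_prod_mul (fun x => X x ω) (fun x => X x ω)
    have h3 : ∫ p, Q ω p = (∫ q : E n × E n, X q.1 ω * X q.2 ω) *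
        ∫ q : E n × E n, X q.1 ω * X q.2 ω :=
      integral_prod_mul (fun q : E n × E n => X q.1 ω * X q.2 ω)
        (fun q : E n × E n => X q.1 ω * X q.2 ω)
    rw [h3, h2]; ring
  have qm (f : (E n × E n) × (E n × E n) → E n) (hf : Measure.QuasiMeasurePreserving f) :
      AEStronglyMeasurable (fun p : Ω × ((E n × E n) × (E n × E n)) => X (f p.2) p.1)
        (P.prod volume) :=
    hXm.comp_quasiMeasurePreserving
      (f := fun p : Ω × ((E n × E n) × (E n × E n)) => (p.1, f p.2))
      (quasiMeasurePreserving_prodMap (Measure.QuasiMeasurePreserving.id P) hf)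
  have q1 : Measure.QuasiMeasurePreserving
      (fun p : (E n × E n) × (E n × E n) => p.1.1) :=
    Measure.quasiMeasurePreserving_fst.comp Measure.quasiMeasurePreserving_fst
  have q2 : Measure.QuasiMeasurePreserving
      (fun p : (E n × E n) × (E n × E n) => p.1.2) :=
    Measure.quasiMeasurePreserving_snd.comp Measure.quasiMeasurePreserving_fst
  have q3 : Measure.QuasiMeasurePreserving
      (fun p : (E n × E n) × (E n × E n) => p.2.1) :=
    Measure.quasiMeasurePreserving_fst.comp Measure.quasiMeasurePreserving_snd
  have q4 : Measure.QuasiMeasurePreserving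
      (fun p : (E n × E n) × (E n × E n) => p.2.2) :=
    Measure.quasiMeasurePreserving_snd.comp Measure.quasiMeasurePreserving_snd
  have mQ : AEStronglyMeasurable (Function.uncurry Q) (P.prod volume) :=
    ((qm _ q1).mul (qm _ q2)).mul ((qm _ q3).mul (qm _ q4))
  have bQ : ∀ᵐ p ∂(P.prod (volume : Measure ((E n × E n) × (E n × E n)))),
      ‖Function.uncurry Q p‖ ≤ (univ ×ˢ T).indicator (fun _ => a ^ 4) p := by
    have h := Measure.quasiMeasurePreserving_fst (μ := P)
      (ν := (volume : Measure ((E n × E n) × (E n × E n)))) |>.ae hXb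
    filter_upwards [h] with p hp
    by_cases hpT : p.2 ∈ T
    · rw [indicator_of_mem (by simpa using hpT)]
      simp only [Function.uncurry, Q, norm_mul, Real.norm_eq_abs]
      calc _ ≤ a * a * (a * a) := by
            gcongr <;> exact hp _
        _ = a ^ 4 := by ring
    · rw [indicator_of_notMem (by simpa using hpT)]
      simp [Function.uncurry, hQT _ _ hpT]
  have iQ : Integrable (Function.uncurry Q) (P.prod volume) := by
    refine Integrable.mono' ?_ mQ bQ
    rw [integrable_indicator_iff (MeasurableSet.univ.prod hT)]
    refine integrableOn_const ?_
    rw [Measure.prod_prod, hTv]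
    exact ENNReal.mul_ne_top (measure_ne_top _ _) (ENNReal.pow_ne_top hSv.ne)
  simp only [e1]
  rw [integral_integral_swap iQ]
  have key (p : (E n × E n) × (E n × E n)) : ‖∫ ω, Q ω p ∂P‖ₑ ≤ ENNReal.ofReal (20 * a ^ 4) *
      T.indicator (fun p => ENNReal.ofReal (pairingSum P Y₀ δ p.1.1 p.1.2 p.2.1 p.2.2)) p := by
    by_cases hp : p ∈ T
    · rw [indicator_of_mem hp, ← ENNReal.ofReal_mul (by positivity), ← ofReal_norm,
        Real.norm_eq_abs]
      refine ENNReal.ofReal_le_ofReal ?_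
      have := hX.abs_integral_four_le p.1.1 p.1.2 p.2.1 p.2.2
      simpa only [Q, mul_assoc] using this
    · simp [hQT _ _ hp]
  have h1 : ‖∫ p, ∫ ω, Q ω p ∂P‖ₑ ≤
      ENNReal.ofReal (60 * a ^ 4 * (volume.real S * pairBound n K) ^ 2) := by
    calc _ ≤ ∫⁻ p, ‖∫ ω, Q ω p ∂P‖ₑ := enorm_integral_le_lintegral_enorm _
      _ ≤ ∫⁻ p, ENNReal.ofReal (20 * a ^ 4) * T.indicator
          (fun p => ENNReal.ofReal (pairingSum P Y₀ δ p.1.1 p.1.2 p.2.1 p.2.2)) p :=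
        lintegral_mono key
      _ = ENNReal.ofReal (20 * a ^ 4) * ∫⁻ p, T.indicator
          (fun p => ENNReal.ofReal (pairingSum P Y₀ δ p.1.1 p.1.2 p.2.1 p.2.2)) p :=
        lintegral_const_mul' _ _ ENNReal.ofReal_ne_top
      _ ≤ ENNReal.ofReal (20 * a ^ 4) *
          (3 * (volume S * ENNReal.ofReal (pairBound n K)) ^ 2) :=
        mul_le_mul_right (lintegral_pairingSum_le hn hK hδ hS) _
      _ = _ := by
        have hPB : 0 ≤ volume.real S * pairBound n (K : ℝ) :=
          mul_nonneg measureReal_nonneg (pairBound_nonneg n K.coe_nonneg)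
        rw [← ofReal_measureReal hSv.ne, ← ENNReal.ofReal_mul measureReal_nonneg,
          ← ENNReal.ofReal_pow hPB,
          ← ENNReal.ofReal_ofNat 3, ← ENNReal.ofReal_mul (by norm_num),
          ← ENNReal.ofReal_mul (by positivity)]
        congr 1; ring
  rw [← ofReal_norm, ENNReal.ofReal_le_ofReal_iff (by positivity)] at h1
  exact (le_abs_self _).trans h1

end FourthMoment

/-! ### Mollified initial data as local fields. -/

section Mollification

variable {n : ℕ} {Ω : Type*} [MeasurableSpace Ω] {P : Measure Ω} [IsProbabilityMeasure P]
  {Y₀ : Ω → State n} {Λ : ℝ}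

/-- The real scalar product `∑ Re (yᵢ c̄ᵢ)` on `ℂ²`, as a linear form in `c`. -/
def dotCLM (y : Fin 2 → ℂ) : (Fin 2 → ℂ) →L[ℝ] ℝ :=
  ∑ i, Complex.reCLM ∘L (ContinuousLinearMap.mul ℝ ℂ (y i)) ∘L
    (Complex.conjCLE : ℂ →L[ℝ] ℂ) ∘L ContinuousLinearMap.proj i

lemma dotCLM_apply (y c : Fin 2 → ℂ) :
    dotCLM y c = ∑ i, (y i * (starRingEnd ℂ) (c i)).re := by
  simp [dotCLM]

attribute [irreducible] dotCLM

lemma pairing_eq (Y f : State n) : pairing Y f = ∫ x, dotCLM (Y x) (f x) := by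
  simp only [pairing, dotCLM_apply]

lemma abs_dotCLM_le (y c : Fin 2 → ℂ) : |dotCLM y c| ≤ (‖y 0‖ + ‖y 1‖) * ‖c‖ := by
  rw [dotCLM_apply, Fin.sum_univ_two, add_mul]
  refine (abs_add_le _ _).trans (add_le_add ?_ ?_)
  · refine (Complex.abs_re_le_norm _).trans ?_
    rw [norm_mul, RCLike.norm_conj]
    exact mul_le_mul_of_nonneg_left (norm_le_pi_norm c 0) (norm_nonneg _)
  · refine (Complex.abs_re_le_norm _).trans ?_
    rw [norm_mul, RCLike.norm_conj]
    exact mul_le_mul_of_nonneg_left (norm_le_pi_norm c 1) (norm_nonneg _)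

lemma continuous_dotCLM : Continuous fun p : (Fin 2 → ℂ) × (Fin 2 → ℂ) => dotCLM p.1 p.2 := by
  simp only [dotCLM_apply]
  fun_prop

lemma dotCLM_comm (y c : Fin 2 → ℂ) : dotCLM y c = dotCLM c y := by
  simp only [dotCLM_apply, Complex.mul_re, Complex.conj_re, Complex.conj_im]
  congr 1; ext i; ring

lemma BoundedBy.nonneg (h : BoundedBy P Y₀ Λ) : 0 ≤ Λ := by
  obtain ⟨ω, hω⟩ := h.exists
  obtain ⟨x, hx⟩ := hω.exists
  exact (add_nonneg (norm_nonneg _) (norm_nonneg _)).trans hx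

/-- Passing from "almost surely, for almost all `x`" to almost everywhere on the product needs a
measurable set, hence the detour through a measurable representative. -/
lemma BoundedBy.ae_prod (h : BoundedBy P Y₀ Λ)
    (hY : AEMeasurable (fun p : Ω × E n => Y₀ p.1 p.2) (P.prod volume)) :
    ∀ᵐ p : Ω × E n ∂(P.prod volume), ‖Y₀ p.1 p.2 0‖ + ‖Y₀ p.1 p.2 1‖ ≤ Λ := by
  have hm := hY.measurable_mk
  have he := hY.ae_eq_mk
  have h1 : ∀ᵐ p : Ω × E n ∂(P.prod volume), ‖hY.mk _ p 0‖ + ‖hY.mk _ p 1‖ ≤ Λ := by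
    have hs : MeasurableSet {p : Ω × E n | ‖hY.mk _ p 0‖ + ‖hY.mk _ p 1‖ ≤ Λ} :=
      measurableSet_le (((measurable_pi_apply 0).comp hm).norm.add
        ((measurable_pi_apply 1).comp hm).norm) measurable_const
    refine (Measure.ae_prod_mem_iff_ae_ae_mem hs).2 ?_
    filter_upwards [h, Measure.ae_ae_of_ae_prod he] with ω h2 h3
    filter_upwards [h2, h3] with x h4 h5
    rw [← h5]; exact h4
  filter_upwards [h1, he] with p h2 h3
  rw [h3]; exact h2

lemma aestronglyMeasurable_dotCLM_comp {α : Type*} [MeasurableSpace α] {μ : Measure α}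
    {f g : α → Fin 2 → ℂ} (hf : AEStronglyMeasurable f μ) (hg : AEStronglyMeasurable g μ) :
    AEStronglyMeasurable (fun p => dotCLM (f p) (g p)) μ := by
  have h := continuous_dotCLM.comp_aestronglyMeasurable (hf.prodMk hg)
  exact h

lemma aestronglyMeasurable_dotCLM
    (hY : AEMeasurable (fun p : Ω × E n => Y₀ p.1 p.2) (P.prod volume)) {f : State n}
    (hf : Measurable f) :
    AEStronglyMeasurable (fun p : Ω × E n => dotCLM (Y₀ p.1 p.2) (f p.2)) (P.prod volume) := by
  have h1 : AEStronglyMeasurable f volume := hf.aestronglyMeasurable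
  have h2 : AEStronglyMeasurable (fun p : Ω × E n => f p.2) (P.prod volume) := h1.comp_snd
  exact aestronglyMeasurable_dotCLM_comp hY.aestronglyMeasurable h2

lemma aemeasurable_pairing
    (hY : AEMeasurable (fun p : Ω × E n => Y₀ p.1 p.2) (P.prod volume)) {f : State n}
    (hf : Measurable f) : AEMeasurable (fun ω => pairing (Y₀ ω) f) P := by
  simp only [pairing_eq]
  exact (aestronglyMeasurable_dotCLM hY hf).integral_prod_right'.aemeasurable

lemma ae_aestronglyMeasurable
    (hY : AEMeasurable (fun p : Ω × E n => Y₀ p.1 p.2) (P.prod volume)) :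
    ∀ᵐ ω ∂P, AEStronglyMeasurable (Y₀ ω) volume :=
  hY.aestronglyMeasurable.prodMk_left

lemma measurable_pairing_sigmaAlg {Ψ : State n} (hΨ : IsTestPair Ψ) {𝒜 : Set (E n)}
    (h : tsupport Ψ ⊆ 𝒜) : Measurable[sigmaAlg Y₀ 𝒜] fun ω => pairing (Y₀ ω) Ψ := by
  rw [measurable_iff_comap_le, BorelSpace.measurable_eq (α := ℝ)]
  exact le_iSup₂_of_le Ψ ⟨hΨ, h⟩ le_rfl

/-- The test pair `y ↦ ρ(y - x) c` obtained from a normalised bump function. -/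
def bumpPair (φ : ContDiffBump (0 : E n)) (x : E n) (c : Fin 2 → ℂ) : State n :=
  fun y => φ.normed volume (y - x) • c

variable (φ : ContDiffBump (0 : E n))

lemma bumpPair_support (x : E n) (c : Fin 2 → ℂ) :
    tsupport (bumpPair φ x c) ⊆ Metric.closedBall x φ.rOut := by
  refine closure_minimal ?_ Metric.isClosed_closedBall
  intro y hy
  by_contra hc
  apply hy
  have : φ.normed volume (y - x) = 0 := by
    rw [← Function.notMem_support, φ.support_normed_eq]
    simp only [Metric.mem_closedBall, Metric.mem_ball, dist_eq_norm, sub_zero] at hc ⊢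
    linarith
  simp [bumpPair, this]

lemma isTestPair_bumpPair (x : E n) (c : Fin 2 → ℂ) : IsTestPair (bumpPair φ x c) := by
  constructor
  · exact (φ.contDiff_normed.comp (contDiff_id.sub contDiff_const)).smul contDiff_const
  · exact HasCompactSupport.of_support_subset_isCompact (isCompact_closedBall x φ.rOut)
      ((subset_tsupport _).trans (bumpPair_support φ x c))

lemma integral_normed_sub (x : E n) : ∫ y, φ.normed volume (y - x) = 1 := by
  rw [integral_sub_right_eq_self (fun y => φ.normed volume y)]
  exact φ.integral_normed

lemma integrable_normed_sub (x : E n) : Integrable fun y => φ.normed volume (y - x) :=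
  (φ.integrable_normed (μ := volume)).comp_sub_right x

/-- One null set of points serves all `c` at once, because the vector-valued mean itself vanishes
there. This is needed since `c` will depend on the point. -/
lemma integral_dotCLM_eq_zero
    (hY : AEMeasurable (fun p : Ω × E n => Y₀ p.1 p.2) (P.prod volume))
    (h0 : CondS0 P Y₀) (hb : BoundedBy P Y₀ Λ) :
    ∀ᵐ x : E n, ∀ c, ∫ ω, dotCLM (Y₀ ω x) c ∂P = 0 := by
  have h1 : ∀ᵐ x : E n, AEStronglyMeasurable (fun ω => Y₀ ω x) P :=
    (hY.aestronglyMeasurable.prod_swap).prodMk_left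
  have h2 : ∀ᵐ x : E n, ∀ᵐ ω ∂P, ‖Y₀ ω x 0‖ + ‖Y₀ ω x 1‖ ≤ Λ := by
    refine Measure.ae_ae_of_ae_prod (μ := volume) (ν := P)
      (p := fun q : E n × Ω => ‖Y₀ q.2 q.1 0‖ + ‖Y₀ q.2 q.1 1‖ ≤ Λ) ?_
    exact Measure.measurePreserving_swap.quasiMeasurePreserving.ae (hb.ae_prod hY)
  filter_upwards [h1, h2, ae_all_iff.2 h0] with x h3 h4 h5 c
  have hi : Integrable (fun ω => Y₀ ω x) P := by
    refine Integrable.of_bound h3 Λ ?_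
    filter_upwards [h4] with ω h6
    refine (pi_norm_le_iff_of_nonneg hb.nonneg).2 fun i => ?_
    have := norm_nonneg (Y₀ ω x 0)
    have := norm_nonneg (Y₀ ω x 1)
    fin_cases i
    · simp only [Fin.zero_eta]; linarith
    · simp only [Fin.mk_one]; linarith
  simp only [dotCLM_comm _ c]
  rw [ContinuousLinearMap.integral_comp_comm _ hi]
  have : ∫ ω, Y₀ ω x ∂P = 0 := by
    ext i
    rw [eval_integral fun i => hi.eval i]
    simpa using h5 i
  rw [this, map_zero]

/-- The mollified random field `x ↦ ⟨Y₀, ρ(· - x) f(x)⟩`. -/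
def mollified (Y₀ : Ω → State n) (φ : ContDiffBump (0 : E n)) (f : State n) (x : E n) (ω : Ω) : ℝ :=
  pairing (Y₀ ω) (bumpPair φ x (f x))

lemma abs_mollified_le {ω : Ω} (hω : ∀ᵐ x : E n, ‖Y₀ ω x 0‖ + ‖Y₀ ω x 1‖ ≤ Λ) (f : State n)
    (x : E n) : |mollified Y₀ φ f x ω| ≤ Λ * ‖f x‖ := by
  rw [mollified, pairing_eq, ← Real.norm_eq_abs]
  refine (norm_integral_le_of_norm_le (g := fun y => Λ * ‖f x‖ * φ.normed volume (y - x))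
    ((integrable_normed_sub φ x).const_mul _) ?_).trans (le_of_eq ?_)
  · filter_upwards [hω] with y hy
    refine (abs_dotCLM_le _ _).trans ?_
    rw [bumpPair, norm_smul, Real.norm_of_nonneg (φ.nonneg_normed _)]
    calc _ ≤ Λ * (φ.normed volume (y - x) * ‖f x‖) := by
          gcongr
          exact mul_nonneg (φ.nonneg_normed _) (norm_nonneg _)
      _ = _ := by ring
  · rw [integral_const_mul, integral_normed_sub, mul_one]

/-- Point values of `Y₀` are defined only almost everywhere and are not variables of `sigmaAlg`,
which is generated by smooth pairings; their local averages are. The bump lives in a closed ball of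
radius `rOut`, which fits in the open ball of twice that radius. -/
lemma isLocalField_mollified
    (hY : AEMeasurable (fun p : Ω × E n => Y₀ p.1 p.2) (P.prod volume))
    (h0 : CondS0 P Y₀) (hb : BoundedBy P Y₀ Λ) {f : State n} {M : ℝ} (hM : ∀ x, ‖f x‖ ≤ M) :
    IsLocalField P Y₀ (mollified Y₀ φ f) (2 * φ.rOut) (Λ * M) where
  measurable x := measurable_pairing_sigmaAlg (isTestPair_bumpPair φ x (f x))
    ((bumpPair_support φ x (f x)).trans
      (Metric.closedBall_subset_ball (by linarith [φ.rOut_pos])))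
  aemeasurable x := aemeasurable_pairing hY (isTestPair_bumpPair φ x (f x)).1.continuous.measurable
  bound x := by
    filter_upwards [hb] with ω hω
    exact (abs_mollified_le φ hω f x).trans (mul_le_mul_of_nonneg_left (hM x) hb.nonneg)
  mean_zero x := by
    have hm : Measurable (bumpPair φ x (f x)) :=
      (isTestPair_bumpPair φ x (f x)).1.continuous.measurable
    have hint : Integrable (fun p : Ω × E n => dotCLM (Y₀ p.1 p.2) (bumpPair φ x (f x) p.2))
        (P.prod volume) := by
      refine Integrable.mono' (g := fun p : Ω × E n =>
          1 * (Λ * ‖f x‖ * φ.normed volume (p.2 - x)))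
        (Integrable.mul_prod (integrable_const _) ((integrable_normed_sub φ x).const_mul _))
        (aestronglyMeasurable_dotCLM hY hm) ?_
      filter_upwards [hb.ae_prod hY] with p hp
      refine (abs_dotCLM_le _ _).trans ?_
      rw [bumpPair, norm_smul, Real.norm_of_nonneg (φ.nonneg_normed _)]
      calc _ ≤ Λ * (φ.normed volume (p.2 - x) * ‖f x‖) := by
            gcongr
            exact mul_nonneg (φ.nonneg_normed _) (norm_nonneg _)
        _ = _ := by ring
    simp only [mollified, pairing_eq]
    -- After the exchange, the points where the mean does not vanish form a null set for the outer
    -- integral.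
    rw [integral_integral_swap hint]
    refine integral_eq_zero_of_ae ?_
    filter_upwards [integral_dotCLM_eq_zero hY h0 hb] with y hy
    exact hy _

end Mollification

/-! ### Removing the mollification. -/

section PairingFourthMoment

open scoped Convolution

variable {n : ℕ} {Ω : Type*} [MeasurableSpace Ω] {P : Measure Ω} [IsProbabilityMeasure P]
  {Y₀ : Ω → State n} {Λ : ℝ} (φ : ContDiffBump (0 : E n))

lemma convolution_normed_eq (f : State n) (y : E n) :
    (φ.normed volume ⋆[ContinuousLinearMap.lsmul ℝ ℝ, volume] f) y =
      ∫ x, φ.normed volume (y - x) • f x := by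
  rw [convolution_eq_swap]
  simp

lemma integral_normed_sub' (y : E n) : ∫ x, φ.normed volume (y - x) = 1 := by
  rw [integral_sub_left_eq_self (fun y => φ.normed volume y)]
  exact φ.integral_normed

lemma integrable_normed_smul {f : State n} (hfi : Integrable f) (y : E n) :
    Integrable fun x => φ.normed volume (y - x) • f x := by
  obtain ⟨C, hC⟩ := φ.hasCompactSupport_normed.exists_bound_of_continuous
    (φ.continuous_normed (μ := volume))
  exact hfi.bdd_smul C ((φ.continuous_normed (μ := volume)).comp
    (continuous_const.sub continuous_id)).aestronglyMeasurable (Eventually.of_forall fun x => hC _)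

/-- Fubini moves the averaging from the data to the test function: integrating the mollified field
is pairing `Y₀` with a convolution of `f`. -/
lemma integral_mollified_eq {ω : Ω} (hm : AEStronglyMeasurable (Y₀ ω) volume)
    (hω : ∀ᵐ x : E n, ‖Y₀ ω x 0‖ + ‖Y₀ ω x 1‖ ≤ Λ) {f : State n}
    (hfi : Integrable f) :
    ∫ x, mollified Y₀ φ f x ω = ∫ y, dotCLM (Y₀ ω y)
      ((φ.normed volume ⋆[ContinuousLinearMap.lsmul ℝ ℝ, volume] f) y) := by
  have hint : Integrable (fun p : E n × E n => dotCLM (Y₀ ω p.1)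
      (φ.normed volume (p.1 - p.2) • f p.2)) (volume.prod volume) := by
    have h1 : Integrable (fun p : E n × E n => ‖f p.2‖ * φ.normed volume (p.1 - p.2))
        (volume.prod volume) :=
      hfi.norm.convolution_integrand (ContinuousLinearMap.mul ℝ ℝ) (φ.integrable_normed)
    refine Integrable.mono' (h1.const_mul Λ) ?_ ?_
    · refine aestronglyMeasurable_dotCLM_comp (hm.comp_fst (ν := (volume : Measure (E n)))) ?_
      have h2 : AEStronglyMeasurable (fun p : E n × E n => φ.normed volume (p.1 - p.2))
          (volume.prod volume) :=
        (φ.continuous_normed.comp (continuous_fst.sub continuous_snd)).aestronglyMeasurable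
      exact h2.smul hfi.aestronglyMeasurable.comp_snd
    · filter_upwards [(Measure.quasiMeasurePreserving_fst (μ := (volume : Measure (E n)))
        (ν := (volume : Measure (E n)))).ae hω] with p hp
      refine (abs_dotCLM_le _ _).trans ?_
      rw [norm_smul, Real.norm_of_nonneg (φ.nonneg_normed _)]
      calc _ ≤ Λ * (φ.normed volume (p.1 - p.2) * ‖f p.2‖) := by
            gcongr
            exact mul_nonneg (φ.nonneg_normed _) (norm_nonneg _)
        _ = _ := by ring
  simp only [mollified, pairing_eq, bumpPair]
  rw [integral_integral_swap (f := fun x y => dotCLM (Y₀ ω y) (φ.normed volume (y - x) • f x))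
    hint.swap]
  congr 1; ext y
  rw [ContinuousLinearMap.integral_comp_comm _ (integrable_normed_smul φ hfi y),
    convolution_normed_eq]

lemma norm_convolution_normed_le {f : State n} {M : ℝ} (hM : ∀ x, ‖f x‖ ≤ M) (y : E n) :
    ‖(φ.normed volume ⋆[ContinuousLinearMap.lsmul ℝ ℝ, volume] f) y‖ ≤ M := by
  rw [convolution_normed_eq]
  have hi : Integrable fun x => φ.normed volume (y - x) :=
    (φ.integrable_normed (μ := volume)).comp_sub_left y
  refine (norm_integral_le_of_norm_le (hi.mul_const M) (Eventually.of_forall fun x => ?_)).trans ?_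
  · rw [norm_smul, Real.norm_of_nonneg (φ.nonneg_normed _)]
    exact mul_le_mul_of_nonneg_left (hM x) (φ.nonneg_normed _)
  · rw [integral_mul_const, integral_normed_sub', one_mul]

lemma convolution_normed_eq_zero {f : State n} {R : ℝ} (hR : ∀ x, R < ‖x‖ → f x = 0)
    (hφ : φ.rOut ≤ 1) {y : E n} (hy : R + 1 < ‖y‖) :
    (φ.normed volume ⋆[ContinuousLinearMap.lsmul ℝ ℝ, volume] f) y = 0 := by
  rw [convolution_normed_eq]
  refine integral_eq_zero_of_ae (Eventually.of_forall fun x => ?_)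
  by_cases hx : R < ‖x‖
  · simp [hR x hx]
  · have : φ.normed volume (y - x) = 0 := by
      rw [← Function.notMem_support, φ.support_normed_eq]
      simp only [Metric.mem_ball, dist_eq_norm, sub_zero]
      have := norm_sub_norm_le y x
      linarith
    simp [this]

/-- A sequence of bump functions shrinking to the origin. -/
def shrinkingBump (n k : ℕ) : ContDiffBump (0 : E n) where
  -- The outer radius is at most `1/24`, so the locality radius `2 * rOut` is at most `1/12`, as the
  -- weight estimate requires. The fixed ratio `rOut = 2 * rIn` is needed for almost everywhere
  -- convergence of the convolutions.
  rIn := 1 / (48 * (k + 1))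
  rOut := 1 / (24 * (k + 1))
  rIn_pos := by positivity
  rIn_lt_rOut := by
    apply one_div_lt_one_div_of_lt <;> nlinarith [show (0 : ℝ) ≤ k by positivity]

lemma shrinkingBump_rOut_le (n k : ℕ) : (shrinkingBump n k).rOut ≤ 1 / 24 := by
  simp only [shrinkingBump]
  apply one_div_le_one_div_of_le (by norm_num)
  nlinarith [show (0 : ℝ) ≤ k by positivity]

lemma tendsto_shrinkingBump_rOut (n : ℕ) :
    Tendsto (fun k => (shrinkingBump n k).rOut) atTop (𝓝 0) := by
  have : (fun k : ℕ => (shrinkingBump n k).rOut) = fun k : ℕ => (1 / 24) * (1 / ((k : ℝ) + 1)) := by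
    ext k; simp only [shrinkingBump]; field_simp
  rw [this]
  simpa using tendsto_one_div_add_atTop_nhds_zero_nat.const_mul (1 / 24 : ℝ)

lemma aestronglyMeasurable_mollified
    (hY : AEMeasurable (fun p : Ω × E n => Y₀ p.1 p.2) (P.prod volume)) {f : State n}
    (hf : Measurable f) :
    AEStronglyMeasurable (fun p : Ω × E n => mollified Y₀ φ f p.2 p.1) (P.prod volume) := by
  simp only [mollified, pairing_eq, bumpPair]
  have h1 : AEStronglyMeasurable (fun q : (Ω × E n) × E n => Y₀ q.1.1 q.2)
      ((P.prod volume).prod volume) :=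
    hY.aestronglyMeasurable.comp_quasiMeasurePreserving
      (quasiMeasurePreserving_prodMap (Measure.quasiMeasurePreserving_fst (μ := P)
        (ν := (volume : Measure (E n)))) (Measure.QuasiMeasurePreserving.id volume))
  have h2 : AEStronglyMeasurable (fun q : (Ω × E n) × E n => f q.1.2)
      ((P.prod volume).prod volume) :=
    (hf.comp (measurable_snd.comp measurable_fst)).aestronglyMeasurable
  have h3 : AEStronglyMeasurable (fun q : (Ω × E n) × E n => φ.normed volume (q.2 - q.1.2))
      ((P.prod volume).prod volume) :=
    (φ.continuous_normed.measurable.comp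
      (measurable_snd.sub (measurable_snd.comp measurable_fst))).aestronglyMeasurable
  exact (aestronglyMeasurable_dotCLM_comp h1 (h3.smul h2)).integral_prod_right'

/-- The fourth moment of `⟨Y₀, f⟩` for a bounded function `f` of bounded support. -/
theorem integral_pairing_fourth_le (hn : 1 ≤ n) {K : ℝ≥0} (hK : mixingIntegral P Y₀ ≤ K)
    (hY : AEMeasurable (fun p : Ω × E n => Y₀ p.1 p.2) (P.prod volume))
    (h0 : CondS0 P Y₀) (hb : BoundedBy P Y₀ Λ) {f : State n} (hf : Measurable f) {M : ℝ}
    (hM : ∀ x, ‖f x‖ ≤ M) {S : Set (E n)} (hS : MeasurableSet S) (hSb : Bornology.IsBounded S)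
    (hfS : ∀ x ∉ S, f x = 0) :
    Integrable (fun ω => |pairing (Y₀ ω) f| ^ 4) P ∧
    ∫ ω, |pairing (Y₀ ω) f| ^ 4 ∂P ≤
      60 * (Λ * M) ^ 4 * (volume.real S * pairBound n K) ^ 2 := by
  have hSv : volume S < ∞ := hSb.measure_lt_top
  obtain ⟨R, hR⟩ := hSb.subset_closedBall 0
  have hR' : ∀ x, R < ‖x‖ → f x = 0 := fun x hx => hfS x fun hxS => by
    have := hR hxS
    simp only [Metric.mem_closedBall, dist_zero_right] at this
    linarith
  have hM0 : 0 ≤ M := (norm_nonneg _).trans (hM 0)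
  have hfi : Integrable f := by
    refine Integrable.mono' (g := S.indicator fun _ => M) ?_ hf.aestronglyMeasurable
      (Eventually.of_forall fun x => ?_)
    · rw [integrable_indicator_iff hS]; exact integrableOn_const hSv.ne
    · by_cases hx : x ∈ S
      · simpa [hx] using hM x
      · simp [hx, hfS x hx]
  let φ : ℕ → ContDiffBump (0 : E n) := shrinkingBump n
  have hφ (k) : (φ k).rOut ≤ 1 / 24 := shrinkingBump_rOut_le n k
  let r : ℕ → Ω → ℝ := fun k ω => ∫ x, mollified Y₀ (φ k) f x ω
  have hlf (k) := isLocalField_mollified (φ k) hY h0 hb hM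
  have hzero (k) : ∀ x ∉ S, ∀ ω, mollified Y₀ (φ k) f x ω = 0 := by
    intro x hx ω
    simp [mollified, pairing_eq, bumpPair, hfS x hx]
  have hfour (k) : ∫ ω, (r k ω) ^ 4 ∂P ≤ 60 * (Λ * M) ^ 4 * (volume.real S * pairBound n K) ^ 2 := by
    refine (hlf k).integral_fourth_le hn hK (by linarith [hφ k]) hS hSv (hzero k)
      (aestronglyMeasurable_mollified (φ k) hY hf) ?_
    filter_upwards [hb] with ω hω x
    exact (abs_mollified_le (φ k) hω f x).trans (mul_le_mul_of_nonneg_left (hM x) hb.nonneg)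
  have hrb (k) : ∀ᵐ ω ∂P, |r k ω| ≤ Λ * M * volume.real S := by
    filter_upwards [hb] with ω hω
    simp only [r]
    rw [← setIntegral_eq_integral_of_forall_compl_eq_zero (fun x hx => hzero k x hx ω),
      ← Real.norm_eq_abs]
    refine norm_setIntegral_le_of_norm_le_const (C := Λ * M) hSv fun x _ => ?_
    exact (abs_mollified_le (φ k) hω f x).trans (mul_le_mul_of_nonneg_left (hM x) hb.nonneg)
  have hrm (k) : AEStronglyMeasurable (r k) P :=
    (aestronglyMeasurable_mollified (φ k) hY hf).integral_prod_right'
  -- The function `f` will carry the indicator of a room and is discontinuous, so the convergence is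
  -- that of Lebesgue differentiation.
  have hconv := ContDiffBump.ae_convolution_tendsto_right_of_locallyIntegrable (φ := φ)
    (l := atTop) (K := 2) (tendsto_shrinkingBump_rOut n)
    (Eventually.of_forall fun k => by
      simp only [φ, shrinkingBump]; apply le_of_eq; field_simp; norm_num) hfi.locallyIntegrable
  have hlim : ∀ᵐ ω ∂P, Tendsto (fun k => r k ω) atTop (𝓝 (pairing (Y₀ ω) f)) := by
    filter_upwards [hb, ae_aestronglyMeasurable hY] with ω hω hm
    simp only [r, pairing_eq]
    simp only [integral_mollified_eq (φ _) hm hω hfi]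
    refine tendsto_integral_of_dominated_convergence
      ((Metric.closedBall (0 : E n) (R + 1)).indicator fun _ => Λ * M) ?_ ?_ ?_ ?_
    · intro k
      refine aestronglyMeasurable_dotCLM_comp hm ?_
      exact (((φ k).hasCompactSupport_normed.contDiff_convolution_left _
        (φ k).contDiff_normed hfi.locallyIntegrable).continuous (n := 0)).aestronglyMeasurable
    · rw [integrable_indicator_iff measurableSet_closedBall]
      exact integrableOn_const measure_closedBall_lt_top.ne
    · intro k
      filter_upwards [hω] with y hy
      by_cases hyR : y ∈ Metric.closedBall (0 : E n) (R + 1)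
      · rw [indicator_of_mem hyR]
        exact (abs_dotCLM_le _ _).trans (mul_le_mul hy (norm_convolution_normed_le _ hM _)
          (norm_nonneg _) hb.nonneg)
      · rw [indicator_of_notMem hyR]
        rw [convolution_normed_eq_zero (φ k) hR' (by linarith [hφ k])
          (by simpa using hyR)]
        simp
    · filter_upwards [hconv] with y hy
      exact ((dotCLM (Y₀ ω y)).continuous.tendsto _).comp hy
  have hpb : ∀ᵐ ω ∂P, |pairing (Y₀ ω) f| ≤ Λ * M * volume.real S := by
    filter_upwards [hlim, ae_all_iff.2 hrb] with ω h1 h2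
    exact le_of_tendsto h1.abs (Eventually.of_forall h2)
  have e4 : (fun ω => |pairing (Y₀ ω) f| ^ 4) = fun ω => (pairing (Y₀ ω) f) ^ 4 := by
    ext ω; exact Even.pow_abs (by decide) _
  constructor
  · refine Integrable.of_bound (C := (Λ * M * volume.real S) ^ 4)
      ((aemeasurable_pairing hY hf).norm.pow_const 4).aestronglyMeasurable ?_
    filter_upwards [hpb] with ω hω
    simp only [norm_pow, Real.norm_eq_abs, abs_abs]
    exact pow_le_pow_left₀ (abs_nonneg _) hω 4
  · rw [e4]
    -- The moment bound does not depend on the mollification scale and passes to the limit by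
    -- dominated convergence.
    have ht : Tendsto (fun k => ∫ ω, (r k ω) ^ 4 ∂P) atTop
        (𝓝 (∫ ω, (pairing (Y₀ ω) f) ^ 4 ∂P)) := by
      refine tendsto_integral_of_dominated_convergence (fun _ => (Λ * M * volume.real S) ^ 4)
        (fun k => (hrm k).pow 4) (integrable_const _) ?_ ?_
      · intro k
        filter_upwards [hrb k] with ω hω
        rw [norm_pow]
        exact pow_le_pow_left₀ (norm_nonneg _) hω 4
      · filter_upwards [hlim] with ω hω using hω.pow 4
    exact le_of_tendsto ht (Eventually.of_forall hfour)

end PairingFourthMoment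

/-! ### Exponential solutions and the duality relation. -/

section PlaneWaves

variable {n : ℕ}

/-- The exponential `x ↦ exp (κ · x)` with complex wave vector `κ`. -/
def wave (κ : Fin n → ℂ) (x : E n) : ℂ := Complex.exp (∑ k, κ k * (x k : ℂ))

lemma contDiff_wave (κ : Fin n → ℂ) : ContDiff ℝ (⊤ : ℕ∞) (wave κ) := by
  unfold wave
  refine Complex.contDiff_exp.comp ?_
  refine ContDiff.sum fun k _ => contDiff_const.mul ?_
  exact Complex.ofRealCLM.contDiff.comp (EuclideanSpace.proj (𝕜 := ℝ) k).contDiff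

lemma continuous_wave (κ : Fin n → ℂ) : Continuous (wave κ) := (contDiff_wave κ).continuous

lemma fderiv_wave (κ : Fin n → ℂ) (x : E n) (k : Fin n) :
    fderiv ℝ (wave κ) x (EuclideanSpace.single k 1) = κ k * wave κ x := by
  have h1 : HasFDerivAt (fun x : E n => ∑ k, κ k * (x k : ℂ))
      (∑ k, (κ k) • (Complex.ofRealCLM ∘L (EuclideanSpace.proj (𝕜 := ℝ) k : E n →L[ℝ] ℝ))) x := by
    refine HasFDerivAt.fun_sum fun k _ => ?_
    exact ((Complex.ofRealCLM ∘L (EuclideanSpace.proj (𝕜 := ℝ) k : E n →L[ℝ] ℝ)).hasFDerivAt).const_mul (κ k)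
  have h2 : HasFDerivAt (wave κ) _ x := h1.cexp
  rw [h2.fderiv]
  have h3 : ∑ j, κ j * (((if j = k then 1 else 0 : ℝ)) : ℂ) = κ k := by
    rw [Finset.sum_eq_single k]
    · simp
    · intro b _ hb; simp [hb]
    · simp
  simp [wave, h3, mul_comm]

/-- `∫ exp(κ · x) φ(x) dx`. -/
def laplaceTransform (φ : E n → ℂ) (κ : Fin n → ℂ) : ℂ := ∫ x, wave κ x * φ x

lemma integrable_wave_mul {φ : E n → ℂ} (hφ : Continuous φ) (hc : HasCompactSupport φ)
    (κ : Fin n → ℂ) : Integrable fun x => wave κ x * φ x :=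
  ((continuous_wave κ).mul hφ).integrable_of_hasCompactSupport hc.mul_left

lemma laplaceTransform_fderiv {φ : E n → ℂ} (hφ : ContDiff ℝ 1 φ) (hc : HasCompactSupport φ)
    (κ : Fin n → ℂ) (k : Fin n) :
    laplaceTransform (fun x => fderiv ℝ φ x (EuclideanSpace.single k 1)) κ =
      -κ k * laplaceTransform φ κ := by
  have hw := contDiff_wave κ
  have hd : Continuous fun x => fderiv ℝ φ x (EuclideanSpace.single k 1) :=
    (hφ.continuous_fderiv one_ne_zero).clm_apply continuous_const
  unfold laplaceTransform
  rw [integral_mul_fderiv_eq_neg_fderiv_mul_of_integrable (𝕜 := ℂ)]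
  · simp only [fderiv_wave, mul_assoc, integral_const_mul]; ring
  · simp only [fderiv_wave, mul_assoc]
    exact (integrable_wave_mul hφ.continuous hc κ).const_mul _
  · exact integrable_wave_mul hd (hc.fderiv_apply (𝕜 := ℝ) _) κ
  · exact integrable_wave_mul hφ.continuous hc κ
  · exact fun x _ => (hw.differentiable (by simp)).differentiableAt
  · exact fun x _ => (hφ.differentiable (by simp)).differentiableAt

lemma laplacian_eq_sum {φ : E n → ℂ} (hφ : ContDiff ℝ (⊤ : ℕ∞) φ) (x : E n) :
    (Δ φ) x = ∑ k, fderiv ℝ (fun y => fderiv ℝ φ y (EuclideanSpace.single k 1)) x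
      (EuclideanSpace.single k 1) := by
  rw [InnerProductSpace.laplacian_eq_iteratedFDeriv_orthonormalBasis φ
    (EuclideanSpace.basisFun (Fin n) ℝ)]
  refine Finset.sum_congr rfl fun k _ => ?_
  rw [iteratedFDeriv_two_apply]
  have hd : DifferentiableAt ℝ (fderiv ℝ φ) x :=
    ((hφ.fderiv_right (m := 1) (by norm_cast)).differentiable (by simp)).differentiableAt
  rw [fderiv_clm_apply hd (differentiableAt_const _)]
  simp

lemma laplaceTransform_laplacian {φ : E n → ℂ} (hφ : ContDiff ℝ (⊤ : ℕ∞) φ)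
    (hc : HasCompactSupport φ) (κ : Fin n → ℂ) :
    laplaceTransform (Δ φ) κ = (∑ k, κ k ^ 2) * laplaceTransform φ κ := by
  have hs (k : Fin n) : ContDiff ℝ (⊤ : ℕ∞) fun y => fderiv ℝ φ y (EuclideanSpace.single k 1) :=
    (hφ.fderiv_right (m := (⊤ : ℕ∞)) (by norm_cast)).clm_apply contDiff_const
  have hcs (k : Fin n) : HasCompactSupport fun y => fderiv ℝ φ y (EuclideanSpace.single k 1) :=
    hc.fderiv_apply (𝕜 := ℝ) _
  have hs2 (k : Fin n) : Continuous fun y => fderiv ℝ (fun y => fderiv ℝ φ y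
      (EuclideanSpace.single k 1)) y (EuclideanSpace.single k 1) :=
    ((hs k).continuous_fderiv (by simp)).clm_apply continuous_const
  have hcs2 (k : Fin n) : HasCompactSupport fun y => fderiv ℝ (fun y => fderiv ℝ φ y
      (EuclideanSpace.single k 1)) y (EuclideanSpace.single k 1) :=
    (hcs k).fderiv_apply (𝕜 := ℝ) _
  have h1 : laplaceTransform (Δ φ) κ = ∑ k, laplaceTransform (fun y => fderiv ℝ (fun y => fderiv ℝ φ y
      (EuclideanSpace.single k 1)) y (EuclideanSpace.single k 1)) κ := by
    unfold laplaceTransform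
    rw [← integral_finsetSum _ fun k _ => integrable_wave_mul (hs2 k) (hcs2 k) κ]
    congr 1; ext x
    rw [laplacian_eq_sum hφ, Finset.mul_sum]
  rw [h1, Finset.sum_mul]
  refine Finset.sum_congr rfl fun k _ => ?_
  rw [laplaceTransform_fderiv ((hs k).of_le (by norm_cast)) (hcs k),
    laplaceTransform_fderiv (hφ.of_le (by norm_cast)) hc]
  ring

/-- The plane wave state `(a e^{κ·x}, b e^{κ·x})`. -/
def waveState (κ : Fin n → ℂ) (a b : ℂ) : State n := fun x => ![a * wave κ x, b * wave κ x]

/-- The gradient of `a e^{κ·x}`. -/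
def waveGrad (κ : Fin n → ℂ) (a : ℂ) : GradField n := fun x => (a * wave κ x) • WithLp.toLp 2 κ

/-- The transform `∫ exp(κ · x) conj φ(x) dx`. -/
def conjTransform (κ : Fin n → ℂ) (φ : E n → ℂ) : ℂ :=
  laplaceTransform (fun x => (starRingEnd ℂ) (φ x)) κ

/-- Moves the conjugation from the function to the wave vector, so that the rules for
`laplaceTransform` apply. -/
lemma conjTransform_eq (κ : Fin n → ℂ) (φ : E n → ℂ) :
    conjTransform κ φ =
      (starRingEnd ℂ) (laplaceTransform φ (fun k => (starRingEnd ℂ) (κ k))) := by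
  unfold conjTransform laplaceTransform
  rw [← integral_conj]
  congr 1; ext x
  simp only [wave, map_mul, ← Complex.exp_conj, map_sum, Complex.conj_conj, Complex.conj_ofReal]

lemma waveGrad_localEnergy (m R : ℝ) (κ : Fin n → ℂ) (a b : ℂ) :
    localEnergy m R (waveState κ a b) (waveGrad κ a) =
      (∫⁻ x in Metric.ball (0 : E n) R, ‖wave κ x‖ₑ ^ 2) *
        (‖b‖ₑ ^ 2 + (‖a‖ₑ * ‖WithLp.toLp 2 κ‖ₑ) ^ 2 + ENNReal.ofReal (m ^ 2) * ‖a‖ₑ ^ 2) := by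
  unfold localEnergy
  rw [← lintegral_mul_const _ ((continuous_wave κ).measurable.enorm.pow_const 2)]
  congr 1; ext x
  simp only [energyDensity, waveState, waveGrad, Matrix.cons_val_one, Matrix.cons_val_zero,
    enorm_smul, enorm_mul]
  ring

lemma lintegral_wave_lt_top (κ : Fin n → ℂ) (R : ℝ) :
    ∫⁻ x in Metric.ball (0 : E n) R, ‖wave κ x‖ₑ ^ 2 < ∞ := by
  obtain ⟨C, hC⟩ := (isCompact_closedBall (0 : E n) R).exists_bound_of_continuousOn
    (continuous_wave κ).continuousOn
  refine setLIntegral_lt_top_of_le_nnreal (measure_ball_lt_top).ne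
    ⟨(Real.toNNReal C) ^ 2, fun x hx => ?_⟩
  rw [ENNReal.coe_pow]
  gcongr
  rw [← ofReal_norm]
  exact ENNReal.ofReal_le_ofReal (hC x (Metric.ball_subset_closedBall hx))

/-- Even exponentially growing waves are admissible, because the seminorms of `ℋ` are local. -/
lemma inPhaseSpace_waveState (m : ℝ) (κ : Fin n → ℂ) (a b : ℂ) :
    InPhaseSpace m (waveState κ a b) (waveGrad κ a) where
  aestronglyMeasurable := by
    refine Continuous.aestronglyMeasurable (continuous_pi fun i => ?_)
    have := continuous_wave κ
    fin_cases i <;> simp only [waveState] <;> simp <;> fun_prop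
  aestronglyMeasurable_grad := by
    have := continuous_wave κ
    refine Continuous.aestronglyMeasurable ?_
    unfold waveGrad; fun_prop
  hasWeakGradient := by
    intro η hη hc k
    have hw := contDiff_wave κ
    have hwd : Differentiable ℝ (fun x => a * wave κ x) :=
      (hw.differentiable (by simp)).const_mul a
    have hd (x : E n) : fderiv ℝ (fun x => a * wave κ x) x (EuclideanSpace.single k 1) =
        waveGrad κ a x k := by
      rw [fderiv_const_mul (hw.differentiable (by simp)).differentiableAt]
      simp [fderiv_wave, waveGrad]; ring
    have hcw : Continuous fun x => a * wave κ x := continuous_const.mul hw.continuous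
    have hcg : Continuous fun x => waveGrad κ a x k := by
      simp only [waveGrad, PiLp.smul_apply, smul_eq_mul]
      exact hcw.mul continuous_const
    have hdη : Continuous fun x => fderiv ℝ η x (EuclideanSpace.single k 1) :=
      (hη.continuous_fderiv (by simp)).clm_apply continuous_const
    have key := integral_smul_fderiv_eq_neg_fderiv_smul_of_integrable (μ := volume) (𝕜 := ℝ)
      (f := η) (g := fun x => a * wave κ x) (v := EuclideanSpace.single k 1)
      ((hdη.smul hcw).integrable_of_hasCompactSupport (hc.fderiv_apply (𝕜 := ℝ) _).smul_right)
      (by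
        simp only [hd]
        exact (hη.continuous.smul hcg).integrable_of_hasCompactSupport hc.smul_right)
      ((hη.continuous.smul hcw).integrable_of_hasCompactSupport hc.smul_right)
      (fun x _ => (hη.differentiable (by simp)).differentiableAt)
      (fun x _ => hwd.differentiableAt)
    simp only [hd] at key
    simp only [waveState, Matrix.cons_val_zero]
    rw [key, neg_neg]
  localEnergy_lt_top R _ := by
    rw [waveGrad_localEnergy]
    refine ENNReal.mul_lt_top (lintegral_wave_lt_top κ R) ?_
    refine ENNReal.add_lt_top.2 ⟨ENNReal.add_lt_top.2 ⟨?_, ?_⟩, ?_⟩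
    · exact ENNReal.pow_lt_top enorm_lt_top
    · exact ENNReal.pow_lt_top (ENNReal.mul_lt_top enorm_lt_top enorm_lt_top)
    · exact ENNReal.mul_lt_top ENNReal.ofReal_lt_top (ENNReal.pow_lt_top enorm_lt_top)

lemma IsTestPair.component {η : State n} (h : IsTestPair η) (i : Fin 2) :
    ContDiff ℝ (⊤ : ℕ∞) (fun x => η x i) ∧ HasCompactSupport (fun x => η x i) :=
  ⟨contDiff_pi.1 h.1 i, h.2.comp_left (g := fun v : Fin 2 → ℂ => v i) rfl⟩

lemma pairing_waveState (κ : Fin n → ℂ) (a b : ℂ) {η : State n} (hη : ∀ i, Continuous fun x => η x i)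
    (hη' : ∀ i, HasCompactSupport fun x => η x i) :
    pairing (waveState κ a b) η =
      (a * conjTransform κ (fun x => η x 0) + b * conjTransform κ (fun x => η x 1)).re := by
  have hi (i : Fin 2) : Integrable fun x => wave κ x * (starRingEnd ℂ) (η x i) :=
    integrable_wave_mul (Complex.continuous_conj.comp (hη i))
      ((hη' i).comp_left (g := starRingEnd ℂ) (map_zero _)) κ
  unfold pairing conjTransform laplaceTransform
  rw [← integral_const_mul, ← integral_const_mul, ← integral_add ((hi 0).const_mul _)
    ((hi 1).const_mul _)]
  have := (Complex.reCLM.integral_comp_comm (((hi 0).const_mul a).add ((hi 1).const_mul b)))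
  simp only [Complex.reCLM_apply, Pi.add_apply] at this
  rw [← this]
  congr 1; ext x
  simp only [Fin.sum_univ_two, waveState, Matrix.cons_val_zero, Matrix.cons_val_one, mul_assoc,
    Complex.add_re]

/-- Plane waves whose amplitude solves `c'' = -(m² - κ·κ) c` are solutions. -/
lemma isSolution_waveState (m : ℝ) (κ : Fin n → ℂ) {c c' : ℝ → ℂ}
    (hc : ∀ s, HasDerivAt c (c' s) s)
    (hc' : ∀ s, HasDerivAt c' (-((m : ℂ) ^ 2 - ∑ k, κ k ^ 2) * c s) s) :
    IsSolution m fun s => waveState κ (c s) (c' s) := by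
  refine ⟨fun s => waveGrad κ (c s), fun s => inPhaseSpace_waveState m κ _ _, ?_, ?_⟩
  · intro R _ s
    have e (t : ℝ) : localEnergy m R (waveState κ (c t) (c' t) - waveState κ (c s) (c' s))
        (waveGrad κ (c t) - waveGrad κ (c s)) =
        localEnergy m R (waveState κ (c t - c s) (c' t - c' s)) (waveGrad κ (c t - c s)) := by
      congr 1
      · ext x i
        fin_cases i <;> simp [waveState, sub_mul]
      · ext x i
        simp [waveGrad, sub_mul]
    simp only [e, waveGrad_localEnergy]
    have h1 : Tendsto (fun t => ‖c t - c s‖ₑ) (𝓝 s) (𝓝 0) := by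
      have : Tendsto (fun t => c t - c s) (𝓝 s) (𝓝 0) := by
        simpa using ((hc s).continuousAt.tendsto.sub_const (c s))
      simpa using this.enorm
    have h2 : Tendsto (fun t => ‖c' t - c' s‖ₑ) (𝓝 s) (𝓝 0) := by
      have : Tendsto (fun t => c' t - c' s) (𝓝 s) (𝓝 0) := by
        simpa using ((hc' s).continuousAt.tendsto.sub_const (c' s))
      simpa using this.enorm
    have h3 : Tendsto (fun t => ‖c' t - c' s‖ₑ ^ 2 + (‖c t - c s‖ₑ * ‖WithLp.toLp 2 κ‖ₑ) ^ 2 +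
        ENNReal.ofReal (m ^ 2) * ‖c t - c s‖ₑ ^ 2) (𝓝 s) (𝓝 0) := by
      have a1 := ENNReal.Tendsto.pow (n := 2) h2
      have a2 := ENNReal.Tendsto.pow (n := 2) (ENNReal.Tendsto.mul_const
        (b := ‖WithLp.toLp 2 κ‖ₑ) h1 (Or.inr enorm_ne_top))
      have a3 := ENNReal.Tendsto.const_mul (a := ENNReal.ofReal (m ^ 2))
        (ENNReal.Tendsto.pow (n := 2) h1)
        (Or.inr ENNReal.ofReal_ne_top)
      simpa using (a1.add a2).add a3
    simpa using ENNReal.Tendsto.const_mul (a := ∫⁻ x in Metric.ball (0 : E n) R, ‖wave κ x‖ₑ ^ 2)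
      h3 (Or.inr (lintegral_wave_lt_top κ R).ne)
  · intro η hη t
    have hη0 := hη.component 0
    have hη1 := hη.component 1
    have hcont (i) : Continuous fun x => η x i := (hη.component i).1.continuous
    have hcs (i) := (hη.component i).2
    have hΔ : Continuous (Δ fun y => η y 1) := by
      have : (Δ fun y => η y 1) = fun x => ∑ k, fderiv ℝ (fun y => fderiv ℝ (fun y => η y 1) y
          (EuclideanSpace.single k 1)) x (EuclideanSpace.single k 1) := by
        ext x; exact laplacian_eq_sum hη1.1 x
      rw [this]
      refine continuous_finsetSum _ fun k _ => ?_
      have hs : ContDiff ℝ (⊤ : ℕ∞) fun y => fderiv ℝ (fun y => η y 1) y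
          (EuclideanSpace.single k 1) :=
        (hη1.1.fderiv_right (m := (⊤ : ℕ∞)) (by norm_cast)).clm_apply contDiff_const
      exact (hs.continuous_fderiv (by simp)).clm_apply continuous_const
    have hΔc : HasCompactSupport (Δ fun y => η y 1) := by
      refine hη1.2.mono' ?_
      intro x hx
      by_contra hx'
      apply hx
      have h0 : (fun y => η y 1) =ᶠ[𝓝 x] fun _ => 0 := notMem_tsupport_iff_eventuallyEq.1 hx'
      have := InnerProductSpace.laplacian_congr_nhds h0
      rw [this.eq_of_nhds]
      simp
    rw [pairing_waveState κ (c t) (c' t) (η := adjointGenerator m η)]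
    · simp only [pairing_waveState κ _ _ hcont hcs]
      have e1 : conjTransform κ (fun x => adjointGenerator m η x 1) =
          conjTransform κ fun x => η x 0 := by
        simp [adjointGenerator]
      -- The Laplacian acts on the transform as multiplication by `κ·κ`, so the wave equation
      -- reduces to the ordinary differential equation of the amplitude.
      have e0 : conjTransform κ (fun x => adjointGenerator m η x 0) =
          ((∑ k, κ k ^ 2) - (m : ℂ) ^ 2) * conjTransform κ fun x => η x 1 := by
        simp only [adjointGenerator, Matrix.cons_val_zero, conjTransform_eq]
        have : laplaceTransform (fun x => (Δ fun y => η y 1) x - (m : ℂ) ^ 2 * η x 1)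
            (fun k => (starRingEnd ℂ) (κ k)) =
            laplaceTransform (Δ fun y => η y 1) (fun k => (starRingEnd ℂ) (κ k)) -
            (m : ℂ) ^ 2 * laplaceTransform (fun x => η x 1) (fun k => (starRingEnd ℂ) (κ k)) := by
          unfold laplaceTransform
          rw [← integral_const_mul, ← integral_sub (integrable_wave_mul hΔ hΔc _)
            ((integrable_wave_mul (hcont 1) (hcs 1) _).const_mul _)]
          congr 1; ext x; ring
        rw [this, laplaceTransform_laplacian hη1.1 hη1.2]
        simp only [map_sub, map_mul, map_sum, map_pow, Complex.conj_conj, Complex.conj_ofReal]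
        ring
      rw [e0, e1]
      have hd := ((hc t).mul_const (conjTransform κ fun x => η x 0)).add
        ((hc' t).mul_const (conjTransform κ fun x => η x 1))
      have hd' := (Complex.reCLM.hasFDerivAt (x := c t * (conjTransform κ fun x => η x 0) +
        c' t * (conjTransform κ fun x => η x 1))).comp_hasDerivAt t hd
      simp only [Complex.reCLM_apply] at hd'
      have e2 : c t * (((∑ k, κ k ^ 2) - (m : ℂ) ^ 2) * conjTransform κ fun x => η x 1) +
          c' t * (conjTransform κ fun x => η x 0) =
          c' t * (conjTransform κ fun x => η x 0) +
          -((m : ℂ) ^ 2 - ∑ k, κ k ^ 2) * c t * conjTransform κ fun x => η x 1 := by ring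
      rw [e2]
      exact hd'
    · intro i
      fin_cases i
      · simp only [adjointGenerator, Fin.zero_eta, Matrix.cons_val_zero]
        exact hΔ.sub (continuous_const.mul (hcont 1))
      · simpa [adjointGenerator] using hcont 0
    · intro i
      fin_cases i
      · simp only [adjointGenerator, Fin.zero_eta, Matrix.cons_val_zero]
        exact hΔc.sub (hcs 1).mul_left
      · simpa [adjointGenerator] using hcs 0

/-- The transform of the adjoint evolution, tested on a plane wave with amplitude `c`. -/
lemma IsAdjointEvolution.conjTransform_eq {m t : ℝ} {Ψ Φ : State n} (hΨ : IsTestPair Ψ)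
    (h : IsAdjointEvolution m t Ψ Φ) (κ : Fin n → ℂ) {c c' : ℝ → ℂ}
    (hc : ∀ s, HasDerivAt c (c' s) s)
    (hc' : ∀ s, HasDerivAt c' (-((m : ℂ) ^ 2 - ∑ k, κ k ^ 2) * c s) s) :
    c 0 * conjTransform κ (fun x => Φ x 0) + c' 0 * conjTransform κ (fun x => Φ x 1) =
      c t * conjTransform κ (fun x => Ψ x 0) + c' t * conjTransform κ (fun x => Ψ x 1) := by
  -- The pairing only yields real parts. Multiplying the amplitude by `1` and by `I` recovers the
  -- complex identity.
  have key (z : ℂ) : (z * (c 0 * conjTransform κ (fun x => Φ x 0) +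
      c' 0 * conjTransform κ (fun x => Φ x 1))).re =
      (z * (c t * conjTransform κ (fun x => Ψ x 0) +
        c' t * conjTransform κ (fun x => Ψ x 1))).re := by
    have hs := isSolution_waveState m κ (c := fun s => z * c s) (c' := fun s => z * c' s)
      (fun s => (hc s).const_mul z) (fun s => by
        have := (hc' s).const_mul z
        rwa [mul_left_comm] at this)
    have := h.2 _ hs
    rw [pairing_waveState κ _ _ (fun i => (h.1.component i).1.continuous)
      (fun i => (h.1.component i).2), pairing_waveState κ _ _
      (fun i => (hΨ.component i).1.continuous) (fun i => (hΨ.component i).2)] at this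
    simpa only [mul_add, mul_assoc] using this
  apply Complex.ext
  · simpa using key 1
  · have := key Complex.I
    simp only [Complex.I_mul_re] at this
    linarith

end PlaneWaves

/-! ### Decay and inversion of the Fourier–Laplace transform. -/

section Decay

variable {n : ℕ}

/-- The complex vector with real part `η` and imaginary part `ξ`. -/
def cvec (η ξ : E n) : Fin n → ℂ := fun k => (η k : ℂ) + (ξ k : ℂ) * Complex.I

lemma sum_cvec_mul (η ξ x : E n) :
    ∑ k, cvec η ξ k * (x k : ℂ) = (inner ℝ η x : ℂ) + (inner ℝ ξ x : ℂ) * Complex.I := by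
  have h (a b : E n) : (inner ℝ a b : ℝ) = ∑ k, a k * b k := by
    simp [PiLp.inner_apply, mul_comm]
  rw [h, h]
  push_cast
  rw [Finset.sum_mul, ← Finset.sum_add_distrib]
  refine Finset.sum_congr rfl fun k _ => ?_
  simp only [cvec]; ring

lemma wave_cvec (η ξ x : E n) :
    wave (cvec η ξ) x = Complex.exp ((inner ℝ η x : ℂ) + (inner ℝ ξ x : ℂ) * Complex.I) := by
  rw [wave, sum_cvec_mul]

lemma norm_wave_cvec (η ξ x : E n) : ‖wave (cvec η ξ) x‖ = Real.exp (inner ℝ η x) := by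
  rw [wave_cvec, Complex.norm_exp]
  simp

lemma norm_laplaceTransform_le {φ : E n → ℂ} (hφ : Continuous φ) {R : ℝ}
    (hs : tsupport φ ⊆ Metric.closedBall 0 R) (η ξ : E n) :
    ‖laplaceTransform φ (cvec η ξ)‖ ≤ (∫ x, ‖φ x‖) * Real.exp (R * ‖η‖) := by
  have hc : HasCompactSupport φ :=
    (isCompact_closedBall (0 : E n) R).of_isClosed_subset (isClosed_tsupport φ) hs
  rw [← integral_mul_const]
  refine norm_integral_le_of_norm_le ((hφ.integrable_of_hasCompactSupport hc).norm.mul_const _)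
    (Eventually.of_forall fun x => ?_)
  rw [norm_mul, norm_wave_cvec, mul_comm]
  by_cases hx : φ x = 0
  · simp [hx]
  · have hx' : ‖x‖ ≤ R := by simpa using hs (subset_tsupport φ hx)
    gcongr
    calc inner ℝ η x ≤ ‖η‖ * ‖x‖ := real_inner_le_norm η x
      _ ≤ R * ‖η‖ := by rw [mul_comm]; gcongr

/-- Each integration by parts gains one factor `κ_k`, and differentiation does not enlarge the
support, so the exponential rate `R` is kept. -/
lemma norm_pow_mul_laplaceTransform_le {φ : E n → ℂ} (hφ : ContDiff ℝ (⊤ : ℕ∞) φ) {R : ℝ}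
    (hs : tsupport φ ⊆ Metric.closedBall 0 R) (k : Fin n) (N : ℕ) :
    ∃ C, 0 ≤ C ∧ ∀ η ξ : E n,
      ‖cvec η ξ k‖ ^ N * ‖laplaceTransform φ (cvec η ξ)‖ ≤ C * Real.exp (R * ‖η‖) := by
  induction N generalizing φ with
  | zero =>
    refine ⟨∫ x, ‖φ x‖, integral_nonneg fun _ => norm_nonneg _, fun η ξ => ?_⟩
    simpa using norm_laplaceTransform_le hφ.continuous hs η ξ
  | succ N ih =>
    have hc : HasCompactSupport φ :=
      (isCompact_closedBall (0 : E n) R).of_isClosed_subset (isClosed_tsupport φ) hs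
    obtain ⟨C, hC, h⟩ := ih (φ := fun x => fderiv ℝ φ x (EuclideanSpace.single k 1))
      ((hφ.fderiv_right (m := (⊤ : ℕ∞)) (by norm_cast)).clm_apply contDiff_const)
      ((tsupport_fderiv_apply_subset ℝ _).trans hs)
    refine ⟨C, hC, fun η ξ => ?_⟩
    have := h η ξ
    rw [laplaceTransform_fderiv (hφ.of_le (by norm_cast)) hc, norm_mul, norm_neg] at this
    rwa [pow_succ, mul_assoc]

/-- The largest coordinate controls the norm. The index depends on `ξ`, which is why the constants
are later summed over all coordinates. -/
lemma one_add_norm_pow_le (hn : 1 ≤ n) (N : ℕ) (ξ : E n) :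
    ∃ k : Fin n, (1 + ‖ξ‖) ^ N ≤ ((n : ℝ) + 1) ^ N * (1 + |ξ k| ^ N) := by
  have : Nonempty (Fin n) := ⟨⟨0, hn⟩⟩
  obtain ⟨k, hk⟩ := Finite.exists_max fun j => |ξ j|
  refine ⟨k, ?_⟩
  have hn' : (1 : ℝ) ≤ n := by exact_mod_cast hn
  have h1 : ‖ξ‖ ≤ n * |ξ k| := by
    rw [EuclideanSpace.norm_eq]
    refine Real.sqrt_le_iff.2 ⟨by positivity, ?_⟩
    calc ∑ i, ‖ξ i‖ ^ 2 ≤ ∑ _i : Fin n, |ξ k| ^ 2 :=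
          Finset.sum_le_sum fun i _ => pow_le_pow_left₀ (norm_nonneg _) (hk i) 2
      _ = n * |ξ k| ^ 2 := by simp
      _ ≤ _ := by rw [mul_pow]; gcongr; nlinarith
  have h2 : 1 + ‖ξ‖ ≤ (n + 1) * max 1 |ξ k| := by
    have a := le_max_left 1 |ξ k|
    have b := le_max_right 1 |ξ k|
    nlinarith
  calc (1 + ‖ξ‖) ^ N ≤ ((n + 1) * max 1 |ξ k|) ^ N := by gcongr
    _ = ((n : ℝ) + 1) ^ N * (max 1 |ξ k|) ^ N := mul_pow _ _ _
    _ ≤ _ := by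
      gcongr
      rcases max_choice 1 |ξ k| with h | h <;> rw [h]
      · simp
      · linarith

/-- Rapid decay of the transform of a test function, with exponential control in the real part of
the wave vector. -/
lemma laplaceTransform_decay (hn : 1 ≤ n) {φ : E n → ℂ} (hφ : ContDiff ℝ (⊤ : ℕ∞) φ) {R : ℝ}
    (hs : tsupport φ ⊆ Metric.closedBall 0 R) (N : ℕ) :
    ∃ C, 0 ≤ C ∧ ∀ η ξ : E n,
      (1 + ‖ξ‖) ^ N * ‖laplaceTransform φ (cvec η ξ)‖ ≤ C * Real.exp (R * ‖η‖) := by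
  choose C hC h using fun k => norm_pow_mul_laplaceTransform_le hφ hs k N
  have hI : 0 ≤ ∫ x, ‖φ x‖ := integral_nonneg fun _ => norm_nonneg _
  refine ⟨((n : ℝ) + 1) ^ N * ((∫ x, ‖φ x‖) + ∑ k, C k), ?_, fun η ξ => ?_⟩
  · have := Finset.sum_nonneg fun k (_ : k ∈ Finset.univ) => hC k
    positivity
  obtain ⟨k, hk⟩ := one_add_norm_pow_le hn N ξ
  have h1 := norm_laplaceTransform_le hφ.continuous hs η ξ
  have h2 : |ξ k| ^ N * ‖laplaceTransform φ (cvec η ξ)‖ ≤ C k * Real.exp (R * ‖η‖) := by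
    refine le_trans ?_ (h k η ξ)
    gcongr
    have := Complex.abs_im_le_norm (cvec η ξ k)
    simpa [cvec] using this
  have h3 : C k ≤ ∑ k, C k := Finset.single_le_sum (fun k _ => hC k) (Finset.mem_univ k)
  calc _ ≤ ((n : ℝ) + 1) ^ N * (1 + |ξ k| ^ N) * ‖laplaceTransform φ (cvec η ξ)‖ := by gcongr
    _ = ((n : ℝ) + 1) ^ N * (‖laplaceTransform φ (cvec η ξ)‖ +
        |ξ k| ^ N * ‖laplaceTransform φ (cvec η ξ)‖) := by ring
    _ ≤ ((n : ℝ) + 1) ^ N * ((∫ x, ‖φ x‖) * Real.exp (R * ‖η‖) +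
        (∑ k, C k) * Real.exp (R * ‖η‖)) := by
      have := mul_le_mul_of_nonneg_right h3 (Real.exp_pos (R * ‖η‖)).le
      exact mul_le_mul_of_nonneg_left (add_le_add h1 (h2.trans this)) (by positivity)
    _ = _ := by ring

open scoped FourierTransform

lemma fourier_wave_mul (φ : E n → ℂ) (η w : E n) :
    𝓕 (fun x => wave (cvec η 0) x * φ x) w =
      laplaceTransform φ (cvec η (-(2 * Real.pi) • w)) := by
  rw [Real.fourier_eq]
  unfold laplaceTransform
  congr 1; ext x
  rw [wave_cvec, wave_cvec, Circle.smul_def]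
  simp only [smul_eq_mul]
  rw [← mul_assoc, Real.fourierChar_apply, ← Complex.exp_add]
  congr 2
  simp only [inner_zero_left, inner_smul_left, real_inner_comm]
  push_cast
  simp
  ring

lemma continuous_laplaceTransform {φ : E n → ℂ} (hφ : Continuous φ)
    (hc : HasCompactSupport φ) :
    Continuous fun p : E n × E n => laplaceTransform φ (cvec p.1 p.2) := by
  have h : ∀ p : E n × E n, laplaceTransform φ (cvec p.1 p.2) =
      ∫ x in tsupport φ, Complex.exp ((inner ℝ p.1 x : ℂ) + (inner ℝ p.2 x : ℂ) * Complex.I) *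
        φ x := by
    intro p
    unfold laplaceTransform
    rw [setIntegral_eq_integral_of_forall_compl_eq_zero]
    · simp only [wave_cvec]
    · intro x hx
      rw [image_eq_zero_of_notMem_tsupport hx, mul_zero]
  simp only [h]
  refine continuous_parametric_integral_of_continuous ?_ hc
  simp only [Function.uncurry_def]
  have : Continuous fun q : (E n × E n) × E n => φ q.2 := hφ.comp continuous_snd
  fun_prop

/-- The weight `(1 + ‖x‖)^{-N}`. -/
def decayWeight (N : ℕ) (x : E n) : ℝ := ((1 + ‖x‖) ^ N)⁻¹

lemma decayWeight_nonneg (N : ℕ) (x : E n) : 0 ≤ decayWeight N x := by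
  unfold decayWeight; positivity

lemma integrable_decayWeight : Integrable (decayWeight (n := n) (n + 1)) := by
  have := integrable_one_add_norm (E := E n) (μ := volume) (r := (n : ℝ) + 1) (by simp)
  refine this.congr (Eventually.of_forall fun x => ?_)
  simp only [decayWeight]
  rw [Real.rpow_neg (by positivity)]
  norm_cast

lemma exists_support_radius {φ : E n → ℂ} (hc : HasCompactSupport φ) :
    ∃ R, tsupport φ ⊆ Metric.closedBall 0 R := by
  exact (hc.isCompact.isBounded).subset_closedBall 0

lemma norm_le_two_pi_smul (w : E n) : ‖w‖ ≤ ‖-(2 * Real.pi) • w‖ := by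
  rw [norm_smul, norm_neg, Real.norm_of_nonneg (by positivity)]
  have := Real.pi_gt_three
  nlinarith [norm_nonneg w]

lemma le_mul_decayWeight {N : ℕ} {a C : ℝ} (ha : 0 ≤ a) {w : E n}
    (h : (1 + ‖-(2 * Real.pi) • w‖) ^ N * a ≤ C) : a ≤ C * decayWeight N w := by
  rw [decayWeight, ← div_eq_mul_inv, le_div_iff₀ (by positivity), mul_comm]
  refine le_trans ?_ h
  gcongr
  exact norm_le_two_pi_smul w

lemma integrable_laplaceTransform (hn : 1 ≤ n) {φ : E n → ℂ} (hφ : ContDiff ℝ (⊤ : ℕ∞) φ)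
    (hc : HasCompactSupport φ) (η : E n) :
    Integrable fun w : E n => laplaceTransform φ (cvec η (-(2 * Real.pi) • w)) := by
  obtain ⟨R, hs⟩ := exists_support_radius hc
  obtain ⟨C, hC, h⟩ := laplaceTransform_decay hn hφ hs (n + 1)
  refine Integrable.mono' (integrable_decayWeight.const_mul (C * Real.exp (R * ‖η‖))) ?_
    (Eventually.of_forall fun w => le_mul_decayWeight (norm_nonneg _) (h η _))
  have h1 : Continuous fun w : E n => (η, -(2 * Real.pi) • w) := by fun_prop
  have h2 := (continuous_laplaceTransform hφ.continuous hc).comp h1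
  exact h2.aestronglyMeasurable

/-- Fourier inversion for `e^{η·x} φ(x)`. -/
lemma wave_mul_eq_integral (hn : 1 ≤ n) {φ : E n → ℂ} (hφ : ContDiff ℝ (⊤ : ℕ∞) φ)
    (hc : HasCompactSupport φ) (η x : E n) :
    wave (cvec η 0) x * φ x = ∫ w, Complex.exp (2 * Real.pi * (inner ℝ w x : ℝ) * Complex.I) *
      laplaceTransform φ (cvec η (-(2 * Real.pi) • w)) := by
  have hcont : Continuous fun x => wave (cvec η 0) x * φ x :=
    (continuous_wave _).mul hφ.continuous
  have hF : 𝓕 (fun x => wave (cvec η 0) x * φ x) =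
      fun w => laplaceTransform φ (cvec η (-(2 * Real.pi) • w)) := by
    ext w; exact fourier_wave_mul φ η w
  have h := hcont.fourierInv_fourier_eq (integrable_wave_mul hφ.continuous hc _)
    (by rw [hF]; exact integrable_laplaceTransform hn hφ hc η)
  rw [hF] at h
  have h' := congrFun h x
  rw [Real.fourierInv_eq'] at h'
  simp only [smul_eq_mul] at h'
  rw [← h']
  congr 1; ext w
  congr 2
  push_cast
  ring

/-- Half of Paley–Wiener: an integrable bound for the transform with real part `η` of the wave
vector fixed is a pointwise bound for `e^{η·x} φ(x)`. A suitable `η` then localises the support. -/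
lemma exp_inner_mul_norm_le (hn : 1 ≤ n) {φ : E n → ℂ} (hφ : ContDiff ℝ (⊤ : ℕ∞) φ)
    (hc : HasCompactSupport φ) {η : E n} {A : ℝ}
    (h : ∀ w : E n, ‖laplaceTransform φ (cvec η (-(2 * Real.pi) • w))‖ ≤
      A * decayWeight (n + 1) w) (x : E n) :
    Real.exp (inner ℝ η x) * ‖φ x‖ ≤ A * ∫ w : E n, decayWeight (n + 1) w := by
  rw [← norm_wave_cvec η 0 x, ← norm_mul, wave_mul_eq_integral hn hφ hc, ← integral_const_mul]
  refine norm_integral_le_of_norm_le (integrable_decayWeight.const_mul A)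
    (Eventually.of_forall fun w => ?_)
  rw [norm_mul]
  have : ‖Complex.exp (2 * Real.pi * (inner ℝ w x : ℝ) * Complex.I)‖ = 1 := by
    have := Complex.norm_exp_ofReal_mul_I (2 * Real.pi * (inner ℝ w x : ℝ))
    push_cast at this
    exact this
  rw [this, one_mul]
  exact h w

end Decay

/-! ### Finite speed of propagation. -/

section Support

variable {n : ℕ}

lemma sum_cvec_sq (η ξ : E n) :
    ∑ k, cvec η ξ k ^ 2 = ((‖η‖ ^ 2 - ‖ξ‖ ^ 2 : ℝ) : ℂ) + 2 * (inner ℝ η ξ : ℝ) * Complex.I := by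
  have h (a b : E n) : (inner ℝ a b : ℝ) = ∑ k, a k * b k := by
    simp [PiLp.inner_apply, mul_comm]
  rw [← real_inner_self_eq_norm_sq, ← real_inner_self_eq_norm_sq, h, h, h]
  push_cast
  rw [Finset.mul_sum, Finset.sum_mul, ← Finset.sum_sub_distrib, ← Finset.sum_add_distrib]
  refine Finset.sum_congr rfl fun k _ => ?_
  simp only [cvec]
  linear_combination (ξ k : ℂ) ^ 2 * Complex.I_sq

/-- This is the statement that the speed is one. With `ω = a + ib`, comparing parts gives `a² - b² =
m² - |η|² + |ξ|²` and `ab = -η·ξ`. If `|b| > |η|`, then `a² > |ξ|²`, so `(ab)² > |η|²|ξ|²`, against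
Cauchy–Schwarz. -/
lemma abs_im_frequency_le {m : ℝ} {η ξ : E n} {ω : ℂ}
    (hω : ω ^ 2 = (m : ℂ) ^ 2 - ∑ k, cvec η ξ k ^ 2) : |ω.im| ≤ ‖η‖ := by
  rw [sum_cvec_sq] at hω
  have hre := congrArg Complex.re hω
  have him := congrArg Complex.im hω
  simp [sq] at hre him
  have hin := abs_real_inner_le_norm η ξ
  refine abs_le_of_sq_le_sq ?_ (norm_nonneg _)
  by_contra hc
  push Not at hc
  have h1 : ‖ξ‖ ^ 2 ≤ ω.re ^ 2 := by nlinarith [sq_nonneg m]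
  have h2 : (ω.re * ω.im) ^ 2 ≤ ‖η‖ ^ 2 * ‖ξ‖ ^ 2 := by
    have : ω.re * ω.im = -inner ℝ η ξ := by linarith
    rw [this, ← mul_pow, neg_sq]
    exact sq_le_sq' (by linarith [(abs_le.1 hin).1]) (abs_le.1 hin).2
  have h3 : ‖ξ‖ ^ 2 < ω.re ^ 2 := by nlinarith [sq_nonneg m]
  have h4 : 0 ≤ ‖η‖ ^ 2 := by positivity
  have h5 : 0 ≤ ‖ξ‖ ^ 2 := by positivity
  have : ‖η‖ ^ 2 * ‖ξ‖ ^ 2 < ω.re ^ 2 * ω.im ^ 2 := by nlinarith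
  nlinarith

lemma norm_frequency_le {m : ℝ} (hm : 0 ≤ m) {η ξ : E n} {ω : ℂ}
    (hω : ω ^ 2 = (m : ℂ) ^ 2 - ∑ k, cvec η ξ k ^ 2) : ‖ω‖ ≤ m + ‖η‖ + ‖ξ‖ := by
  refine le_of_sq_le_sq ?_ (by positivity)
  rw [← norm_pow, hω, sum_cvec_sq]
  have h1 : ‖(m : ℂ) ^ 2‖ = m ^ 2 := by simp
  have h2 : ‖((‖η‖ ^ 2 - ‖ξ‖ ^ 2 : ℝ) : ℂ)‖ ≤ ‖η‖ ^ 2 + ‖ξ‖ ^ 2 := by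
    rw [Complex.norm_real, Real.norm_eq_abs]
    exact abs_le.2 ⟨by nlinarith [sq_nonneg ‖η‖], by nlinarith [sq_nonneg ‖ξ‖]⟩
  have h3 : ‖2 * ((inner ℝ η ξ : ℝ) : ℂ) * Complex.I‖ ≤ 2 * (‖η‖ * ‖ξ‖) := by
    simp only [norm_mul, Complex.norm_I, mul_one, Complex.norm_ofNat, Complex.norm_real]
    have := abs_real_inner_le_norm η ξ
    rw [Real.norm_eq_abs]; linarith
  calc _ ≤ ‖(m : ℂ) ^ 2‖ + (‖((‖η‖ ^ 2 - ‖ξ‖ ^ 2 : ℝ) : ℂ)‖ +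
        ‖2 * ((inner ℝ η ξ : ℝ) : ℂ) * Complex.I‖) :=
        (norm_sub_le _ _).trans (add_le_add_right (norm_add_le _ _) _)
    _ ≤ m ^ 2 + (‖η‖ ^ 2 + ‖ξ‖ ^ 2 + 2 * (‖η‖ * ‖ξ‖)) := by rw [h1]; gcongr
    _ ≤ _ := by nlinarith [norm_nonneg η, norm_nonneg ξ, mul_nonneg hm (norm_nonneg η),
        mul_nonneg hm (norm_nonneg ξ)]

lemma norm_cos_le_exp (z : ℂ) : ‖Complex.cos z‖ ≤ Real.exp |z.im| := by
  have h1 : ‖Complex.exp (z * Complex.I)‖ ≤ Real.exp |z.im| := by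
    rw [Complex.norm_exp]; simp [neg_le_abs]
  have h2 : ‖Complex.exp (-z * Complex.I)‖ ≤ Real.exp |z.im| := by
    rw [Complex.norm_exp]; simp [le_abs_self]
  rw [Complex.cos, norm_div, Complex.norm_ofNat]
  have := norm_add_le (Complex.exp (z * Complex.I)) (Complex.exp (-z * Complex.I))
  linarith

lemma norm_sin_le_exp (z : ℂ) : ‖Complex.sin z‖ ≤ Real.exp |z.im| := by
  have h1 : ‖Complex.exp (z * Complex.I)‖ ≤ Real.exp |z.im| := by
    rw [Complex.norm_exp]; simp [neg_le_abs]
  have h2 : ‖Complex.exp (-z * Complex.I)‖ ≤ Real.exp |z.im| := by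
    rw [Complex.norm_exp]; simp [le_abs_self]
  rw [Complex.sin, norm_div, Complex.norm_ofNat, norm_mul, Complex.norm_I, mul_one]
  have := norm_sub_le (Complex.exp (-z * Complex.I)) (Complex.exp (z * Complex.I))
  linarith

lemma hasDerivAt_cos_mul (ω : ℂ) (s : ℝ) :
    HasDerivAt (fun s : ℝ => Complex.cos (ω * s)) (-ω * Complex.sin (ω * s)) s := by
  have h : HasDerivAt (fun s : ℝ => ω * (s : ℂ)) ω s := by
    simpa using (Complex.ofRealCLM.hasDerivAt (x := s)).const_mul ω
  have := (Complex.hasDerivAt_cos (ω * s)).scomp s h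
  rwa [smul_eq_mul, mul_neg, ← neg_mul] at this

lemma hasDerivAt_sin_mul (ω : ℂ) (s : ℝ) :
    HasDerivAt (fun s : ℝ => Complex.sin (ω * s)) (ω * Complex.cos (ω * s)) s := by
  have h : HasDerivAt (fun s : ℝ => ω * (s : ℂ)) ω s := by
    simpa using (Complex.ofRealCLM.hasDerivAt (x := s)).const_mul ω
  exact (Complex.hasDerivAt_sin (ω * s)).scomp s h

/-- The solution of `c'' = -ω² c`, `c(0) = 0`, `c'(0) = 1`, that is `sin(ωs)/ω`. -/
lemma exists_sine_solution (ω : ℂ) : ∃ c : ℝ → ℂ,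
    (∀ s : ℝ, HasDerivAt c (Complex.cos (ω * s)) s) ∧
    (∀ s : ℝ, HasDerivAt (fun s : ℝ => Complex.cos (ω * s)) (-ω ^ 2 * c s) s) ∧ c 0 = 0 ∧
    (∀ s : ℝ, ω * c s = Complex.sin (ω * s)) ∧
    ∀ s : ℝ, 0 ≤ s → ‖c s‖ ≤ s * Real.exp (s * |ω.im|) := by
  obtain ⟨c, h1, h2, h3⟩ : ∃ c : ℝ → ℂ, (∀ s : ℝ, HasDerivAt c (Complex.cos (ω * s)) s) ∧ c 0 = 0 ∧
      ∀ s : ℝ, ω * c s = Complex.sin (ω * s) := by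
    -- At zero frequency `sin(ωs)/ω` is replaced by its limit `s`.
    by_cases hω : ω = 0
    · refine ⟨fun s => s, fun s => ?_, by simp, by simp [hω]⟩
      simpa [hω] using (hasDerivAt_id s).ofReal_comp
    · refine ⟨fun s => Complex.sin (ω * s) / ω, fun s => ?_, by simp, fun s => by field_simp⟩
      have := (hasDerivAt_sin_mul ω s).div_const ω
      rwa [mul_div_cancel_left₀ _ hω] at this
  refine ⟨c, h1, fun s => ?_, h2, h3, fun s hs => ?_⟩
  · have := hasDerivAt_cos_mul ω s
    rw [← h3] at this
    convert this using 1; ring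
  -- The mean value inequality with derivative `cos(ωs)` gives a bound that stays uniform as `ω →
  -- 0`.
  · have := (convex_Icc (0 : ℝ) s).norm_image_sub_le_of_norm_hasDerivWithin_le
      (f := c) (f' := fun s => Complex.cos (ω * s)) (C := Real.exp (s * |ω.im|))
      (fun u _ => (h1 u).hasDerivWithinAt) (fun u hu => by
        refine (norm_cos_le_exp _).trans (Real.exp_le_exp.2 ?_)
        simp only [Complex.mul_im, Complex.ofReal_re, Complex.ofReal_im, mul_zero, zero_add]
        rw [abs_mul, abs_of_nonneg hu.1, mul_comm]
        exact mul_le_mul_of_nonneg_right hu.2 (abs_nonneg _))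
      (left_mem_Icc.2 hs) (right_mem_Icc.2 hs)
    rw [h2, sub_zero, sub_zero, Real.norm_of_nonneg hs, mul_comm] at this
    exact this

/-- The transforms of the components of `U₀'(t)Ψ`. -/
lemma IsAdjointEvolution.transforms {m t : ℝ} {Ψ Φ : State n} (hΨ : IsTestPair Ψ)
    (h : IsAdjointEvolution m t Ψ Φ) {κ : Fin n → ℂ} {ω : ℂ}
    (hω : ω ^ 2 = (m : ℂ) ^ 2 - ∑ k, κ k ^ 2) :
    conjTransform κ (fun x => Φ x 0) = Complex.cos (ω * t) * conjTransform κ (fun x => Ψ x 0) -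
      ω * Complex.sin (ω * t) * conjTransform κ (fun x => Ψ x 1) ∧
    ∃ S : ℂ, ω * S = Complex.sin (ω * t) ∧ (0 ≤ t → ‖S‖ ≤ t * Real.exp (t * |ω.im|)) ∧
      conjTransform κ (fun x => Φ x 1) = S * conjTransform κ (fun x => Ψ x 0) +
        Complex.cos (ω * t) * conjTransform κ (fun x => Ψ x 1) := by
  -- The amplitudes with initial data `(1, 0)` and `(0, 1)` isolate the two components.
  constructor
  · have := h.conjTransform_eq hΨ κ (c := fun s => Complex.cos (ω * s))
      (c' := fun s => -ω * Complex.sin (ω * s)) (hasDerivAt_cos_mul ω) (fun s => by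
        rw [← hω, show -ω ^ 2 * Complex.cos (ω * s) = -ω * (ω * Complex.cos (ω * s)) by ring]
        exact (hasDerivAt_sin_mul ω s).const_mul (-ω))
    simp only [Complex.ofReal_zero, mul_zero, Complex.cos_zero, Complex.sin_zero, one_mul,
      zero_mul, add_zero] at this
    rw [this]; ring
  · obtain ⟨c, h1, h2, h3, h4, h5⟩ := exists_sine_solution ω
    refine ⟨c t, h4 t, h5 t, ?_⟩
    have := h.conjTransform_eq hΨ κ (c := c) (c' := fun s => Complex.cos (ω * s)) h1 (fun s => by
        rw [← hω]; exact h2 s)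
    simpa [h3] using this

lemma isTest_conj {φ : E n → ℂ} (h : ContDiff ℝ (⊤ : ℕ∞) φ ∧ HasCompactSupport φ) :
    ContDiff ℝ (⊤ : ℕ∞) (fun x => (starRingEnd ℂ) (φ x)) ∧
      HasCompactSupport (fun x => (starRingEnd ℂ) (φ x)) :=
  ⟨Complex.conjCLE.contDiff.comp h.1, h.2.comp_left (g := starRingEnd ℂ) (map_zero _)⟩

lemma tsupport_conj_component_subset {Ψ : State n} {R : ℝ}
    (hs : tsupport Ψ ⊆ Metric.closedBall 0 R) (i : Fin 2) :
    tsupport (fun x => (starRingEnd ℂ) (Ψ x i)) ⊆ Metric.closedBall 0 R := by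
  refine (closure_mono ?_).trans hs
  intro x hx hx'
  apply hx
  simp [hx']

/-- The propagator costs at most one power of `1 + ‖ξ‖`, from the factor `ω`, so decay of order `n +
2` of the transform of `Ψ` leaves the integrable order `n + 1`. The evolution adds `t` to the
exponential rate. Any square root `ω` will do. -/
lemma norm_transform_le_of_isAdjointEvolution (hn : 1 ≤ n) {m t R : ℝ} (hm : 0 ≤ m) (ht : 0 ≤ t)
    {Ψ Φ : State n} (hΨ : IsTestPair Ψ) (hs : tsupport Ψ ⊆ Metric.closedBall 0 R)
    (h : IsAdjointEvolution m t Ψ Φ) :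
    ∃ C, 0 ≤ C ∧ ∀ (i : Fin 2) (η ξ : E n),
      (1 + ‖ξ‖) ^ (n + 1) * ‖conjTransform (cvec η ξ) (fun x => Φ x i)‖ ≤
        C * (1 + t + m + ‖η‖) * Real.exp ((t + R) * ‖η‖) := by
  obtain ⟨C0, hC0, d0⟩ := laplaceTransform_decay hn (isTest_conj (hΨ.component 0)).1
    (tsupport_conj_component_subset hs 0) (n + 2)
  obtain ⟨C1, hC1, d1⟩ := laplaceTransform_decay hn (isTest_conj (hΨ.component 1)).1
    (tsupport_conj_component_subset hs 1) (n + 2)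
  refine ⟨C0 + C1, by positivity, fun i η ξ => ?_⟩
  obtain ⟨ω, hω⟩ := IsAlgClosed.exists_pow_nat_eq ((m : ℂ) ^ 2 - ∑ k, cvec η ξ k ^ 2)
    (n := 2) (by norm_num)
  obtain ⟨e0, S, -, hS, e1⟩ := h.transforms hΨ hω
  have hi := abs_im_frequency_le hω
  have hω' := norm_frequency_le hm hω
  set A := ‖conjTransform (cvec η ξ) (fun x => Ψ x 0)‖ with hA
  set B := ‖conjTransform (cvec η ξ) (fun x => Ψ x 1)‖ with hB
  have d0' : (1 + ‖ξ‖) ^ (n + 2) * A ≤ C0 * Real.exp (R * ‖η‖) := d0 η ξ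
  have d1' : (1 + ‖ξ‖) ^ (n + 2) * B ≤ C1 * Real.exp (R * ‖η‖) := d1 η ξ
  have hA0 : 0 ≤ A := norm_nonneg _
  have hB0 : 0 ≤ B := norm_nonneg _
  set G := Real.exp (t * ‖η‖) with hG
  have hG0 : 0 ≤ G := (Real.exp_pos _).le
  have him : (ω * t).im = ω.im * t := by simp
  have hcos : ‖Complex.cos (ω * t)‖ ≤ G := by
    refine (norm_cos_le_exp _).trans (Real.exp_le_exp.2 ?_)
    rw [him, abs_mul, abs_of_nonneg ht, mul_comm]
    gcongr
  have hsin : ‖Complex.sin (ω * t)‖ ≤ G := by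
    refine (norm_sin_le_exp _).trans (Real.exp_le_exp.2 ?_)
    rw [him, abs_mul, abs_of_nonneg ht, mul_comm]
    gcongr
  have hS' : ‖S‖ ≤ t * G := (hS ht).trans (by rw [hG]; gcongr)
  -- A common majorant of the multipliers `1`, `t` and `‖ω‖`.
  set Q := (1 + t + m + ‖η‖) * (1 + ‖ξ‖) with hQ
  have hη := norm_nonneg η
  have hξ := norm_nonneg ξ
  have hQ1 : 1 ≤ Q := by nlinarith [mul_nonneg ht hξ, mul_nonneg hm hξ, mul_nonneg hη hξ]
  have hQt : t ≤ Q := by nlinarith [mul_nonneg ht hξ, mul_nonneg hm hξ, mul_nonneg hη hξ]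
  have hQω : ‖ω‖ ≤ Q := by nlinarith [mul_nonneg ht hξ, mul_nonneg hm hξ, mul_nonneg hη hξ]
  have key : ‖conjTransform (cvec η ξ) (fun x => Φ x i)‖ ≤ Q * G * (A + B) := by
    fin_cases i
    · simp only [Fin.zero_eta]
      rw [e0]
      refine (norm_sub_le _ _).trans ?_
      rw [norm_mul, norm_mul, norm_mul]
      calc _ ≤ 1 * G * A + Q * G * B := by rw [one_mul]; gcongr
        _ ≤ Q * G * A + Q * G * B := by gcongr
        _ = _ := by ring
    · simp only [Fin.mk_one]
      rw [e1]
      refine (norm_add_le _ _).trans ?_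
      rw [norm_mul, norm_mul]
      calc _ ≤ t * G * A + 1 * G * B := by rw [one_mul]; gcongr
        _ ≤ Q * G * A + Q * G * B := by gcongr
        _ = _ := by ring
  calc _ ≤ (1 + ‖ξ‖) ^ (n + 1) * (Q * G * (A + B)) := by gcongr
    _ = (1 + t + m + ‖η‖) * G * ((1 + ‖ξ‖) ^ (n + 2) * A + (1 + ‖ξ‖) ^ (n + 2) * B) := by
      rw [hQ]; ring
    _ ≤ (1 + t + m + ‖η‖) * G * (C0 * Real.exp (R * ‖η‖) + C1 * Real.exp (R * ‖η‖)) := by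
      gcongr
    _ = _ := by rw [add_mul t R, Real.exp_add]; ring

/-- Finite speed of propagation. -/
theorem IsAdjointEvolution.eq_zero_of_lt_norm (hn : 1 ≤ n) {m t R : ℝ} (hm : 0 ≤ m) (ht : 0 ≤ t)
    {Ψ Φ : State n} (hΨ : IsTestPair Ψ) (hR : 0 ≤ R) (hs : tsupport Ψ ⊆ Metric.closedBall 0 R)
    (h : IsAdjointEvolution m t Ψ Φ) {x : E n} (hx : t + R < ‖x‖) : Φ x = 0 := by
  obtain ⟨C, hC, hb⟩ := norm_transform_le_of_isAdjointEvolution hn hm ht hΨ hs h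
  set J := ∫ w : E n, decayWeight (n + 1) w
  have hx0 : 0 < ‖x‖ := by linarith
  set δ := ‖x‖ - (t + R) with hδ
  have hδ0 : 0 < δ := by linarith
  ext i
  have key : ∀ l : ℝ, 0 ≤ l → ‖Φ x i‖ ≤ C * J * ((1 + t + m) * Real.exp (-δ * l) +
      l * Real.exp (-δ * l)) := by
    intro l hl
    -- With `η` of length `l` along `x`, the left side grows like `e^{l|x|}` and the right side like
    -- `l e^{l(t+R)}`; letting `l → ∞` forces `Φ x = 0`.
    set η : E n := (l / ‖x‖) • x with hη
    have hηn : ‖η‖ = l := by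
      rw [hη, norm_smul, norm_div, norm_norm, Real.norm_of_nonneg hl]
      field_simp
    have hηx : inner ℝ η x = l * ‖x‖ := by
      rw [hη, inner_smul_left, real_inner_self_eq_norm_sq]
      simp; field_simp
    have hi := isTest_conj (h.1.component i)
    have := exp_inner_mul_norm_le hn hi.1 hi.2 (η := η)
      (A := C * (1 + t + m + ‖η‖) * Real.exp ((t + R) * ‖η‖))
      (fun w => le_mul_decayWeight (norm_nonneg _) (hb i η _)) x
    rw [hηx, hηn, RCLike.norm_conj] at this
    have e : Real.exp ((t + R) * l) = Real.exp (l * ‖x‖) * Real.exp (-δ * l) := by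
      rw [← Real.exp_add]; congr 1; rw [hδ]; ring
    rw [e] at this
    have hpos := Real.exp_pos (l * ‖x‖)
    refine le_of_mul_le_mul_left (this.trans (le_of_eq ?_)) hpos
    ring
  have hlim : Tendsto (fun l : ℝ => C * J * ((1 + t + m) * Real.exp (-δ * l) +
      l * Real.exp (-δ * l))) atTop (𝓝 0) := by
    have a0 := tendsto_rpow_mul_exp_neg_mul_atTop_nhds_zero 0 δ hδ0
    have a1 := tendsto_rpow_mul_exp_neg_mul_atTop_nhds_zero 1 δ hδ0
    simp only [Real.rpow_zero, one_mul, Real.rpow_one] at a0 a1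
    simpa using ((a0.const_mul (1 + t + m)).add a1).const_mul (C * J)
  have h0 : ‖Φ x i‖ ≤ 0 := ge_of_tendsto hlim
    ((eventually_ge_atTop 0).mono fun l hl => key l hl)
  simpa using h0

end Support

/-! ### The dispersion relation in a complex tube. -/

section Frequency

variable {n : ℕ} {m : ℝ}

/-- The square of the complexified dispersion relation. -/
def freqSq (m : ℝ) (w η : E n) : ℂ :=
  ((m ^ 2 + 4 * Real.pi ^ 2 * (‖w‖ ^ 2 - ‖η‖ ^ 2) : ℝ) : ℂ) +
    ((8 * Real.pi ^ 2 * inner ℝ w η : ℝ) : ℂ) * Complex.I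

/-- The complexified dispersion relation at the complex frequency `w + i η`. -/
def freq (m : ℝ) (w η : E n) : ℂ := Complex.sqrt (freqSq m w η)

lemma freqSq_re (w η : E n) :
    (freqSq m w η).re = m ^ 2 + 4 * Real.pi ^ 2 * (‖w‖ ^ 2 - ‖η‖ ^ 2) := by
  simp [freqSq, -Complex.ofReal_add, -Complex.ofReal_mul, -Complex.ofReal_pow, -Complex.ofReal_sub]

lemma freqSq_im (w η : E n) : (freqSq m w η).im = 8 * Real.pi ^ 2 * inner ℝ w η := by
  simp [freqSq, -Complex.ofReal_add, -Complex.ofReal_mul, -Complex.ofReal_pow, -Complex.ofReal_sub]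

lemma freq_sq (w η : E n) : freq m w η ^ 2 = freqSq m w η :=
  Complex.cpow_ofNat_inv_pow _ 2

/-- In this tube `4π²|η|² < m²/4`, so the mass keeps the square of the frequency in the right
half-plane, where the principal root is holomorphic and nonzero. -/
lemma freqSq_re_ge {w η : E n} (hη : 4 * Real.pi * ‖η‖ < m) :
    3 / 4 * m ^ 2 + 4 * Real.pi ^ 2 * ‖w‖ ^ 2 ≤ (freqSq m w η).re := by
  have h0 : 0 ≤ 4 * Real.pi * ‖η‖ := by positivity
  rw [freqSq_re]
  nlinarith

lemma freqSq_mem_slitPlane {w η : E n} (hη : 4 * Real.pi * ‖η‖ < m) :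
    freqSq m w η ∈ Complex.slitPlane := by
  have h0 : 0 ≤ 4 * Real.pi * ‖η‖ := by positivity
  have hm : 0 < m := h0.trans_lt hη
  refine Or.inl (lt_of_lt_of_le ?_ (freqSq_re_ge hη))
  positivity

lemma freq_re_pos {w η : E n} (hη : 4 * Real.pi * ‖η‖ < m) : 0 < (freq m w η).re := by
  have h0 : 0 ≤ 4 * Real.pi * ‖η‖ := by positivity
  have hm : 0 < m := h0.trans_lt hη
  have h1 := freqSq_re_ge (w := w) hη
  rw [freq, Complex.sqrt, Complex.cpow_inv_two_re]
  have : 0 < (freqSq m w η).re := lt_of_lt_of_le (by positivity) h1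
  positivity

lemma freq_ne_zero {w η : E n} (hη : 4 * Real.pi * ‖η‖ < m) : freq m w η ≠ 0 := by
  intro h
  have := freq_re_pos (w := w) hη
  simp [h] at this

lemma norm_freq_sq (w η : E n) : ‖freq m w η‖ ^ 2 = ‖freqSq m w η‖ := by
  rw [← norm_pow, freq_sq]

lemma norm_freq_ge {w η : E n} (hη : 4 * Real.pi * ‖η‖ < m) : m / 2 ≤ ‖freq m w η‖ := by
  have h0 : 0 ≤ 4 * Real.pi * ‖η‖ := by positivity
  have hm : 0 < m := h0.trans_lt hη
  have h1 := (freqSq_re_ge (w := w) hη).trans (Complex.re_le_norm _)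
  rw [← norm_freq_sq] at h1
  have h2 : 0 ≤ 4 * Real.pi ^ 2 * ‖w‖ ^ 2 := by positivity
  refine abs_le_of_sq_le_sq' (by nlinarith) (norm_nonneg _) |>.2

lemma norm_freq_le (w : E n) {η : E n} (hη : 4 * Real.pi * ‖η‖ < m) :
    ‖freq m w η‖ ≤ (2 * m + 2 * Real.pi) * (1 + ‖w‖) := by
  have h0 : 0 ≤ 4 * Real.pi * ‖η‖ := by positivity
  have hm : 0 < m := h0.trans_lt hη
  have hpi := Real.pi_pos
  have hw := norm_nonneg w
  have hin : |inner ℝ w η| ≤ ‖w‖ * ‖η‖ := abs_real_inner_le_norm w η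
  have h1 : ‖freq m w η‖ ^ 2 ≤ (m + 2 * Real.pi * (‖w‖ + ‖η‖)) ^ 2 := by
    rw [norm_freq_sq]
    refine (Complex.norm_le_abs_re_add_abs_im _).trans ?_
    rw [freqSq_re, freqSq_im, abs_mul, abs_of_nonneg (by positivity : 0 ≤ 8 * Real.pi ^ 2)]
    have h2 : |m ^ 2 + 4 * Real.pi ^ 2 * (‖w‖ ^ 2 - ‖η‖ ^ 2)| ≤
        m ^ 2 + 4 * Real.pi ^ 2 * (‖w‖ ^ 2 + ‖η‖ ^ 2) := by
      rw [abs_le]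
      constructor <;> nlinarith [sq_nonneg m, mul_nonneg (sq_nonneg Real.pi) (sq_nonneg ‖w‖),
        mul_nonneg (sq_nonneg Real.pi) (sq_nonneg ‖η‖)]
    have h3 : 8 * Real.pi ^ 2 * |inner ℝ w η| ≤ 8 * Real.pi ^ 2 * (‖w‖ * ‖η‖) := by gcongr
    have h4 : 0 ≤ m * (Real.pi * (‖w‖ + ‖η‖)) := by positivity
    nlinarith
  have h2 := abs_le_of_sq_le_sq' h1 (by positivity) |>.2
  nlinarith [mul_nonneg hm.le hw]

lemma freq_zero_right (w : E n) :
    freq m w 0 = (Real.sqrt (m ^ 2 + 4 * Real.pi ^ 2 * ‖w‖ ^ 2) : ℂ) := by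
  have h : freqSq m w 0 = ((m ^ 2 + 4 * Real.pi ^ 2 * ‖w‖ ^ 2 : ℝ) : ℂ) := by
    simp [freqSq]
  rw [freq, h, Complex.sqrt_of_nonneg (by rw [Complex.zero_le_real]; positivity),
    Complex.ofReal_re]

lemma continuousOn_freq :
    ContinuousOn (fun p : E n × E n => freq m p.1 p.2) {p | 4 * Real.pi * ‖p.2‖ < m} := by
  have hc : Continuous fun p : E n × E n => freqSq m p.1 p.2 := by
    unfold freqSq
    fun_prop
  intro p hp
  refine ContinuousAt.continuousWithinAt ?_
  exact (Complex.differentiableAt_sqrt (freqSq_mem_slitPlane hp)).continuousAt.comp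
    (f := fun p : E n × E n => freqSq m p.1 p.2) hc.continuousAt

lemma freqSq_line (w : E n) {e : E n} (he : ‖e‖ = 1) (z : ℂ) :
    freqSq m (w + z.re • e) (z.im • e) =
      (m : ℂ) ^ 2 + 4 * Real.pi ^ 2 * ((‖w‖ : ℂ) ^ 2 + 2 * z * (inner ℝ w e : ℝ) + z ^ 2) := by
  have h1 : ‖w + z.re • e‖ ^ 2 = ‖w‖ ^ 2 + 2 * z.re * inner ℝ w e + z.re ^ 2 := by
    rw [norm_add_sq_real, norm_smul, he, inner_smul_right, mul_one, Real.norm_eq_abs, sq_abs]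
    ring
  have h2 : ‖z.im • e‖ ^ 2 = z.im ^ 2 := by
    rw [norm_smul, he, mul_one, Real.norm_eq_abs, sq_abs]
  have h3 : inner ℝ (w + z.re • e) (z.im • e) = z.im * (inner ℝ w e + z.re) := by
    rw [inner_smul_right, inner_add_left, real_inner_smul_left, real_inner_self_eq_norm_sq, he]
    ring
  apply Complex.ext
  · rw [freqSq_re, h1, h2]
    simp [pow_two]
    ring
  · rw [freqSq_im, h3]
    simp [pow_two]
    ring

lemma hasDerivAt_freq_line (w : E n) {e : E n} (he : ‖e‖ = 1) {z : ℂ}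
    (hz : 4 * Real.pi * |z.im| < m) :
    HasDerivAt (fun z : ℂ => freq m (w + z.re • e) (z.im • e))
      (4 * Real.pi ^ 2 * (((inner ℝ w e : ℝ) : ℂ) + z) / freq m (w + z.re • e) (z.im • e)) z := by
  have hη : 4 * Real.pi * ‖z.im • e‖ < m := by
    rwa [norm_smul, he, mul_one, Real.norm_eq_abs]
  have hs := freqSq_mem_slitPlane (w := w + z.re • e) hη
  have hne := freq_ne_zero (w := w + z.re • e) hη
  have h1 : HasDerivAt (fun z : ℂ => freqSq m (w + z.re • e) (z.im • e))
      (4 * Real.pi ^ 2 * (2 * (inner ℝ w e : ℝ) + 2 * z)) z := by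
    have h : HasDerivAt (fun z : ℂ => (m : ℂ) ^ 2 + 4 * Real.pi ^ 2 *
        ((‖w‖ : ℂ) ^ 2 + 2 * z * (inner ℝ w e : ℝ) + z ^ 2))
        (4 * Real.pi ^ 2 * (2 * 1 * (inner ℝ w e : ℝ) + 2 * z)) z := by
      refine HasDerivAt.const_add _ (HasDerivAt.const_mul _ (HasDerivAt.add ?_ ?_))
      · exact HasDerivAt.const_add _ (((hasDerivAt_id z).const_mul _).mul_const _)
      · simpa using (hasDerivAt_pow 2 z)
    rw [mul_one] at h
    exact h.congr_of_eventuallyEq (Eventually.of_forall fun z => freqSq_line w he z)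
  have hd := ((Complex.differentiableAt_sqrt hs).hasDerivAt.comp z h1)
  have hd' : DifferentiableAt ℂ (fun z : ℂ => freq m (w + z.re • e) (z.im • e)) z :=
    hd.differentiableAt
  -- The derivative is identified by differentiating the square of the frequency, a polynomial along
  -- the line.
  have h2 := hd'.hasDerivAt.pow 2
  have h3 : HasDerivAt ((fun z : ℂ => freq m (w + z.re • e) (z.im • e)) ^ 2)
      (4 * Real.pi ^ 2 * (2 * (inner ℝ w e : ℝ) + 2 * z)) z :=
    h1.congr_of_eventuallyEq (Eventually.of_forall fun z => freq_sq _ _)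
  have h4 := h2.unique h3
  have h5 : deriv (fun z : ℂ => freq m (w + z.re • e) (z.im • e)) z =
      4 * Real.pi ^ 2 * (((inner ℝ w e : ℝ) : ℂ) + z) / freq m (w + z.re • e) (z.im • e) := by
    rw [eq_div_iff hne]
    simp only [Nat.cast_ofNat, Nat.add_one_sub_one, pow_one] at h4
    linear_combination h4 / 2
  rw [← h5]
  exact hd'.hasDerivAt

lemma inner_sq_le_of_norm_eq_one (w : E n) {e : E n} (he : ‖e‖ = 1) :
    inner ℝ w e ^ 2 ≤ ‖w‖ ^ 2 := by
  have h := abs_real_inner_le_norm w e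
  rw [he, mul_one] at h
  rw [← sq_abs]
  gcongr

/-- Along horizontal lines in the upper half-plane, the imaginary part of the frequency grows. -/
lemma im_freq_deriv_ge (w : E n) {e : E n} (he : ‖e‖ = 1) {τ : ℝ} (h0 : 0 ≤ τ)
    (hτ : 4 * Real.pi * τ < m) :
    3 * Real.pi ^ 2 * τ * m ^ 2 / ‖freq m w (τ • e)‖ ^ 3 ≤
      (4 * Real.pi ^ 2 * ((inner ℝ w e : ℝ) + τ * Complex.I) / freq m w (τ • e)).im := by
  have hη : 4 * Real.pi * ‖τ • e‖ < m := by
    rwa [norm_smul, he, mul_one, Real.norm_of_nonneg h0]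
  have hpi := Real.pi_pos
  have hp := freq_re_pos (w := w) hη
  have hre := congrArg Complex.re (freq_sq (m := m) w (τ • e))
  have him := congrArg Complex.im (freq_sq (m := m) w (τ • e))
  rw [freqSq_re, norm_smul, he, mul_one, Real.norm_of_nonneg h0] at hre
  rw [freqSq_im, inner_smul_right] at him
  have hN := Complex.sq_norm (freq m w (τ • e))
  rw [Complex.normSq_apply] at hN
  have hle := Complex.re_le_norm (freq m w (τ • e))
  have hcs := inner_sq_le_of_norm_eq_one w he
  set f := freq m w (τ • e)
  set σ : ℝ := inner ℝ w e
  set N := ‖f‖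
  have hNp : 0 < N := hp.trans_le hle
  simp only [pow_two, Complex.mul_re, Complex.mul_im] at hre him
  have hval : (4 * Real.pi ^ 2 * ((σ : ℂ) + τ * Complex.I) / f).im =
      4 * Real.pi ^ 2 * (τ * f.re - σ * f.im) / N ^ 2 := by
    have : (4 * (Real.pi : ℂ) ^ 2 * ((σ : ℂ) + τ * Complex.I)) =
        ((4 * Real.pi ^ 2 * σ : ℝ) : ℂ) + ((4 * Real.pi ^ 2 * τ : ℝ) : ℂ) * Complex.I := by
      push_cast; ring
    rw [this, Complex.div_im, Complex.normSq_apply, ← hN]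
    simp only [Complex.add_re, Complex.add_im, Complex.re_ofReal_mul, Complex.im_ofReal_mul,
      Complex.ofReal_re, Complex.ofReal_im, Complex.I_re, Complex.I_im]
    ring
  rw [hval]
  -- Multiplying by `Re f` and using both parts of the equation for `f²` gives `τ(m² - 4π²τ² +
  -- 4π²(‖w‖² - σ²) + (Im f)²)`. Cauchy–Schwarz makes the third term nonnegative, and the tube
  -- condition makes the first two at least `3m²/4`: this is the strict convexity due to the mass.
  have hprod : 3 / 4 * τ * m ^ 2 ≤ f.re * (τ * f.re - σ * f.im) := by
    have e1 : f.re * f.im = 4 * Real.pi ^ 2 * (τ * σ) := by linarith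
    have e2 : f.re * (τ * f.re - σ * f.im) =
        τ * (m ^ 2 - 4 * Real.pi ^ 2 * τ ^ 2 + 4 * Real.pi ^ 2 * (‖w‖ ^ 2 - σ ^ 2) + f.im ^ 2) := by
      linear_combination τ * hre - σ * e1
    rw [e2]
    have e3 : 0 ≤ 4 * Real.pi ^ 2 * (‖w‖ ^ 2 - σ ^ 2) := by
      have := sub_nonneg.2 hcs
      positivity
    have e4 : 4 * Real.pi ^ 2 * τ ^ 2 ≤ m ^ 2 / 4 := by
      have : 0 ≤ 4 * Real.pi * τ := by positivity
      nlinarith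
    nlinarith [mul_nonneg h0 e3, mul_nonneg h0 (sq_nonneg f.im), mul_nonneg h0 (sub_nonneg.2 e4)]
  have hD : 0 ≤ τ * f.re - σ * f.im := by
    by_contra hneg
    push Not at hneg
    have := mul_neg_of_pos_of_neg hp hneg
    have : 0 ≤ 3 / 4 * τ * m ^ 2 := by positivity
    linarith
  rw [div_le_div_iff₀ (by positivity) (by positivity)]
  have h5 : 3 / 4 * τ * m ^ 2 ≤ N * (τ * f.re - σ * f.im) :=
    hprod.trans (mul_le_mul_of_nonneg_right hle hD)
  have h6 : 0 ≤ 4 * Real.pi ^ 2 * N ^ 2 := by positivity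
  have := mul_le_mul_of_nonneg_left h5 h6
  calc _ = 4 * Real.pi ^ 2 * N ^ 2 * (3 / 4 * τ * m ^ 2) := by ring
    _ ≤ _ := this
    _ = _ := by ring

/-- The derivative bound is integrated along the segment of length `r`, on which the frequency is at
most `(2m + 2π)(1 + ‖w‖ + r)`; hence the cube in the denominator. -/
lemma im_freq_sub_ge (w : E n) {e : E n} (he : ‖e‖ = 1) {τ r : ℝ} (h0 : 0 ≤ τ)
    (hτ : 4 * Real.pi * τ < m) (hr : 0 ≤ r) :
    3 * Real.pi ^ 2 * m ^ 2 / (2 * m + 2 * Real.pi) ^ 3 * τ * r / (1 + ‖w‖ + r) ^ 3 ≤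
      (freq m (w + r • e) (τ • e)).im - (freq m w (τ • e)).im := by
  have hpi := Real.pi_pos
  have hm : 0 < m := lt_of_le_of_lt (by positivity) hτ
  have hη : 4 * Real.pi * ‖τ • e‖ < m := by
    rwa [norm_smul, he, mul_one, Real.norm_of_nonneg h0]
  have hd (s : ℝ) : HasDerivAt (fun s : ℝ => (freq m (w + s • e) (τ • e)).im)
      (4 * Real.pi ^ 2 * ((inner ℝ (w + s • e) e : ℝ) + τ * Complex.I) /
        freq m (w + s • e) (τ • e)).im s := by
    have h := hasDerivAt_freq_line (m := m) w he (z := (s : ℂ) + τ * Complex.I)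
      (by simpa [abs_of_nonneg h0] using hτ)
    have hl : HasDerivAt (fun s : ℝ => (s : ℂ) + τ * Complex.I) 1 s :=
      (hasDerivAt_id s).ofReal_comp.add_const _
    have h2 := h.scomp s hl
    have h3 : HasDerivAt (fun s : ℝ => freq m (w + s • e) (τ • e))
        (4 * Real.pi ^ 2 * ((inner ℝ (w + s • e) e : ℝ) + τ * Complex.I) /
          freq m (w + s • e) (τ • e)) s := by
      have e1 : (((inner ℝ (w + s • e) e : ℝ) : ℂ) + τ * Complex.I) =
          ((inner ℝ w e : ℝ) : ℂ) + ((s : ℂ) + τ * Complex.I) := by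
        rw [inner_add_left, real_inner_smul_left, real_inner_self_eq_norm_sq, he]
        push_cast; ring
      rw [e1]
      simpa [Function.comp_def] using h2
    exact (Complex.imCLM.hasFDerivAt.comp_hasDerivAt s h3)
  have := Convex.mul_sub_le_image_sub_of_le_deriv (convex_Icc 0 r)
    (f := fun s : ℝ => (freq m (w + s • e) (τ • e)).im)
    (C := 3 * Real.pi ^ 2 * m ^ 2 / (2 * m + 2 * Real.pi) ^ 3 * τ / (1 + ‖w‖ + r) ^ 3)
    (fun s _ => (hd s).continuousAt.continuousWithinAt)
    (fun s _ => (hd s).differentiableAt.differentiableWithinAt) ?_ 0 (left_mem_Icc.2 hr)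
    r (right_mem_Icc.2 hr) hr
  · simp only [zero_smul, add_zero, sub_zero] at this
    refine le_trans (le_of_eq ?_) this
    ring
  · intro s hs
    rw [interior_Icc] at hs
    rw [(hd s).deriv]
    refine le_trans ?_ (im_freq_deriv_ge (w + s • e) he h0 hτ)
    have hN : ‖freq m (w + s • e) (τ • e)‖ ≤ (2 * m + 2 * Real.pi) * (1 + ‖w‖ + r) := by
      refine (norm_freq_le _ hη).trans ?_
      have : ‖w + s • e‖ ≤ ‖w‖ + r := by
        refine (norm_add_le _ _).trans ?_
        rw [norm_smul, he, mul_one, Real.norm_of_nonneg hs.1.le]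
        linarith [hs.2]
      exact mul_le_mul_of_nonneg_left (by linarith) (by positivity)
    have hNp : 0 < ‖freq m (w + s • e) (τ • e)‖ := norm_pos_iff.2 (freq_ne_zero hη)
    calc _ = 3 * Real.pi ^ 2 * τ * m ^ 2 / ((2 * m + 2 * Real.pi) * (1 + ‖w‖ + r)) ^ 3 := by
          field_simp
      _ ≤ _ := by gcongr

end Frequency

/-! ### Holomorphic amplitudes. -/

section Amplitude

variable {n : ℕ} {m : ℝ}

/-- Amplitudes `a w η`, thought of as functions of the complex frequency `w + i η`: holomorphic
along complex lines and rapidly decreasing in the tube `4 π ‖η‖ < m`. -/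
structure IsAmplitude (m : ℝ) (a : E n → E n → ℂ) : Prop where
  differentiableAt : ∀ w e : E n, ‖e‖ = 1 → ∀ z : ℂ, 4 * Real.pi * |z.im| < m →
    DifferentiableAt ℂ (fun z : ℂ => a (w + z.re • e) (z.im • e)) z
  continuousOn : ContinuousOn (fun p : E n × E n => a p.1 p.2) {p | 4 * Real.pi * ‖p.2‖ < m}
  bound : ∀ N : ℕ, ∃ C, 0 ≤ C ∧ ∀ w η : E n, 4 * Real.pi * ‖η‖ < m →
    ‖a w η‖ ≤ C * decayWeight N w

lemma four_pi_norm_smul_lt {e : E n} (he : ‖e‖ = 1) {τ : ℝ} (hτ : 4 * Real.pi * |τ| < m) :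
    4 * Real.pi * ‖τ • e‖ < m := by
  rwa [norm_smul, he, mul_one, Real.norm_eq_abs]

/-- Schwarz reflection: it continues the conjugate of the amplitude holomorphically from real
frequencies, where plain conjugation would not be holomorphic. -/
lemma IsAmplitude.reflect {a : E n → E n → ℂ} (ha : IsAmplitude m a) :
    IsAmplitude m (fun w η => starRingEnd ℂ (a w (-η))) where
  differentiableAt w e he z hz := by
    have h := (ha.differentiableAt w e he (starRingEnd ℂ z) (by simpa using hz)).conj_conj
    simp only [Complex.conj_conj] at h
    refine h.congr_of_eventuallyEq (Eventually.of_forall fun z => ?_)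
    simp [Function.comp_def]
  continuousOn := by
    have h : ContinuousOn (fun p : E n × E n => a p.1 (-p.2)) {p | 4 * Real.pi * ‖p.2‖ < m} :=
      ha.continuousOn.comp (f := fun p : E n × E n => (p.1, -p.2)) (by fun_prop)
        (fun p hp => by simpa using hp)
    exact Complex.continuous_conj.comp_continuousOn h
  bound N := by
    obtain ⟨C, hC, h⟩ := ha.bound N
    refine ⟨C, hC, fun w η hη => ?_⟩
    rw [RCLike.norm_conj]
    exact h w (-η) (by simpa using hη)

lemma decayWeight_succ (N : ℕ) (w : E n) : decayWeight N w = (1 + ‖w‖) * decayWeight (N + 1) w := by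
  have : 0 < 1 + ‖w‖ := by positivity
  unfold decayWeight
  field_simp
  ring

lemma IsAmplitude.freq_mul {a : E n → E n → ℂ} (hm : 0 < m) (ha : IsAmplitude m a) :
    IsAmplitude m (fun w η => freq m w η * a w η) where
  differentiableAt w e he z hz :=
    (hasDerivAt_freq_line w he hz).differentiableAt.mul (ha.differentiableAt w e he z hz)
  continuousOn := continuousOn_freq.mul ha.continuousOn
  bound N := by
    obtain ⟨C, hC, h⟩ := ha.bound (N + 1)
    refine ⟨(2 * m + 2 * Real.pi) * C, by positivity, fun w η hη => ?_⟩
    rw [norm_mul, decayWeight_succ]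
    calc _ ≤ ((2 * m + 2 * Real.pi) * (1 + ‖w‖)) * (C * decayWeight (N + 1) w) :=
          mul_le_mul (norm_freq_le w hη) (h w η hη) (norm_nonneg _) (by positivity)
      _ = _ := by ring

/-- The mass bounds the frequency below by `m/2`, so division is harmless. -/
lemma IsAmplitude.freq_inv_mul {a : E n → E n → ℂ} (hm : 0 < m) (ha : IsAmplitude m a) :
    IsAmplitude m (fun w η => (freq m w η)⁻¹ * a w η) where
  differentiableAt w e he z hz :=
    ((hasDerivAt_freq_line w he hz).differentiableAt.inv
      (freq_ne_zero (four_pi_norm_smul_lt he hz))).mul (ha.differentiableAt w e he z hz)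
  continuousOn := (continuousOn_freq.inv₀ fun _ hp => freq_ne_zero hp).mul ha.continuousOn
  bound N := by
    obtain ⟨C, hC, h⟩ := ha.bound N
    refine ⟨(m / 2)⁻¹ * C, by positivity, fun w η hη => ?_⟩
    rw [norm_mul, mul_assoc, norm_inv]
    have := norm_freq_ge (w := w) hη
    exact mul_le_mul (by gcongr) (h w η hη) (norm_nonneg _) (by positivity)

lemma differentiable_integral_exp_mul {φ : E n → ℂ} (hφ : Continuous φ)
    (hc : HasCompactSupport φ) {α β : E n → ℂ} (hα : Continuous α) (hβ : Continuous β) :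
    Differentiable ℂ fun z : ℂ => ∫ x, Complex.exp (α x + z * β x) * φ x := by
  intro z
  have hcont (z : ℂ) : Continuous fun x => Complex.exp (α x + z * β x) * φ x := by fun_prop
  have hbound : Continuous fun x => Real.exp (‖α x‖ + (‖z‖ + 1) * ‖β x‖) * ‖β x‖ * ‖φ x‖ := by
    fun_prop
  refine (hasDerivAt_integral_of_dominated_loc_of_deriv_le (Metric.ball_mem_nhds z one_pos)
    (F := fun z x => Complex.exp (α x + z * β x) * φ x)
    (F' := fun z x => Complex.exp (α x + z * β x) * β x * φ x)
    (bound := fun x => Real.exp (‖α x‖ + (‖z‖ + 1) * ‖β x‖) * ‖β x‖ * ‖φ x‖)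
    (Eventually.of_forall fun z => (hcont z).aestronglyMeasurable)
    ((hcont z).integrable_of_hasCompactSupport hc.mul_left)
    (by fun_prop : Continuous fun x => Complex.exp (α x + z * β x) * β x * φ x).aestronglyMeasurable
    ?_ (hbound.integrable_of_hasCompactSupport hc.norm.mul_left) ?_).2.differentiableAt
  · refine Eventually.of_forall fun x y hy => ?_
    rw [norm_mul, norm_mul]
    gcongr
    refine (Complex.norm_exp_le_exp_norm _).trans (Real.exp_le_exp.2 ?_)
    refine (norm_add_le _ _).trans ?_
    rw [norm_mul]
    gcongr
    have h1 : ‖y - z‖ < 1 := by simpa [dist_eq_norm] using hy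
    have h2 := norm_le_norm_add_norm_sub' y z
    linarith
  · refine Eventually.of_forall fun x y _ => ?_
    have h : HasDerivAt (fun y : ℂ => α x + y * β x) (β x) y := by
      simpa using ((hasDerivAt_id y).mul_const (β x)).const_add (α x)
    exact h.cexp.mul_const _

lemma isAmplitude_laplaceTransform (hn : 1 ≤ n) (m : ℝ) {φ : E n → ℂ}
    (hφ : ContDiff ℝ (⊤ : ℕ∞) φ) (hc : HasCompactSupport φ) :
    IsAmplitude m (fun w η : E n =>
      laplaceTransform φ (cvec ((2 * Real.pi) • η) (-(2 * Real.pi) • w))) where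
  differentiableAt w e he z hz := by
    have h := differentiable_integral_exp_mul hφ.continuous hc
      (α := fun x => ((-(2 * Real.pi) * inner ℝ w x : ℝ) : ℂ) * Complex.I)
      (β := fun x => ((-(2 * Real.pi) * inner ℝ e x : ℝ) : ℂ) * Complex.I)
      (by fun_prop) (by fun_prop) z
    refine h.congr_of_eventuallyEq (Eventually.of_forall fun z => ?_)
    unfold laplaceTransform
    refine integral_congr_ae (Eventually.of_forall fun x => ?_)
    simp only [wave_cvec, real_inner_smul_left, inner_add_left]
    congr 2
    push_cast
    linear_combination (-2 * Real.pi * (inner ℝ e x : ℝ) * Complex.I) * Complex.re_add_im z +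
      2 * Real.pi * z.im * (inner ℝ e x : ℝ) * Complex.I_sq
  continuousOn := by
    have h := (continuous_laplaceTransform hφ.continuous hc).comp
      (f := fun p : E n × E n => ((2 * Real.pi) • p.2, -(2 * Real.pi) • p.1)) (by fun_prop)
    exact h.continuousOn
  bound N := by
    obtain ⟨R, hs⟩ := exists_support_radius hc
    obtain ⟨C, hC, h⟩ := laplaceTransform_decay hn hφ hs N
    refine ⟨C * Real.exp (|R| * m), by positivity, fun w η hη => ?_⟩
    refine le_mul_decayWeight (norm_nonneg _) ((h _ _).trans ?_)
    gcongr
    · exact le_abs_self R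
    · rw [norm_smul, Real.norm_of_nonneg (by positivity)]
      have : 0 ≤ Real.pi * ‖η‖ := by positivity
      linarith

end Amplitude

/-! ### Contour shift in several variables. -/

section ContourShift

variable {n : ℕ}

lemma decayWeight_add_le (N : ℕ) {w v : E n} (hv : ‖v‖ ≤ 1) :
    decayWeight N (w + v) ≤ 2 ^ N * decayWeight N w := by
  unfold decayWeight
  rw [← div_eq_mul_inv, inv_le_comm₀ (by positivity) (by positivity), inv_div,
    div_le_iff₀ (by positivity), ← mul_pow]
  have h : ‖w‖ ≤ ‖w + v‖ + ‖v‖ := by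
    simpa using norm_sub_le (w + v) v
  have := norm_nonneg (w + v)
  gcongr
  linarith

lemma integrable_prod_translate {g : E n → ℂ} (hg : Continuous g) {C : ℝ} (hC : 0 ≤ C)
    (hb : ∀ w, ‖g w‖ ≤ C * decayWeight (n + 1) w) {e : E n} (he : ‖e‖ = 1) :
    Integrable (fun p : E n × ℝ => g (p.1 + p.2 • e))
      (volume.prod (volume.restrict (Ioc (0 : ℝ) 1))) := by
  have h1 : Integrable (fun p : E n × ℝ => (C * 2 ^ (n + 1) * decayWeight (n + 1) p.1) * (1 : ℝ))
      (volume.prod (volume.restrict (Ioc (0 : ℝ) 1))) :=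
    (integrable_decayWeight.const_mul _).mul_prod (integrable_const (1 : ℝ))
  refine h1.mono' (by fun_prop) ?_
  have h2 : ∀ᵐ p : E n × ℝ ∂(volume.prod (volume.restrict (Ioc (0 : ℝ) 1))),
      p.2 ∈ Ioc (0 : ℝ) 1 :=
    Measure.quasiMeasurePreserving_snd.ae (ae_restrict_mem measurableSet_Ioc)
  filter_upwards [h2] with p hp
  rw [mul_one, mul_assoc]
  refine (hb _).trans (mul_le_mul_of_nonneg_left (decayWeight_add_le _ ?_) hC)
  rw [norm_smul, he, mul_one, Real.norm_of_nonneg hp.1.le]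
  exact hp.2

/-- Averaging over translates by at most one unit leaves the integral unchanged, and provides the
horizontal sides of a rectangle of width one in the contour argument. -/
lemma integral_integral_translate {g : E n → ℂ} (hg : Continuous g) {C : ℝ} (hC : 0 ≤ C)
    (hb : ∀ w, ‖g w‖ ≤ C * decayWeight (n + 1) w) {e : E n} (he : ‖e‖ = 1) :
    Integrable (fun w => ∫ x in (0 : ℝ)..1, g (w + x • e)) ∧
      ∫ w, ∫ x in (0 : ℝ)..1, g (w + x • e) = ∫ w, g w := by
  have hI := integrable_prod_translate hg hC hb he
  simp only [intervalIntegral.integral_of_le zero_le_one]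
  refine ⟨hI.integral_prod_left, ?_⟩
  rw [integral_integral_swap hI]
  simp only [integral_add_right_eq_self]
  simp

/-- Shift of the contour of integration in the direction of a unit vector. -/
lemma integral_eq_integral_shift {F : E n → ℝ → ℂ} {e : E n} (he : ‖e‖ = 1) {τ C : ℝ}
    (hτ : 0 ≤ τ) (hC : 0 ≤ C)
    (hd : ∀ w, ∀ z : ℂ, z.im ∈ Icc 0 τ →
      DifferentiableAt ℂ (fun z : ℂ => F (w + z.re • e) z.im) z)
    (hcont : ContinuousOn (fun p : E n × ℝ => F p.1 p.2) (univ ×ˢ Icc 0 τ))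
    (hb : ∀ w, ∀ s ∈ Icc 0 τ, ‖F w s‖ ≤ C * decayWeight (n + 1) w) :
    ∫ w, F w 0 = ∫ w, F w τ := by
  have hslice (s : ℝ) (hs : s ∈ Icc 0 τ) : Continuous fun w => F w s := by
    rw [← continuousOn_univ]
    exact hcont.comp (f := fun w => (w, s)) (by fun_prop) fun w _ => ⟨mem_univ _, hs⟩
  obtain ⟨hi0, h0⟩ := integral_integral_translate (hslice 0 (left_mem_Icc.2 hτ)) hC
    (fun w => hb w 0 (left_mem_Icc.2 hτ)) he
  obtain ⟨hi1, h1⟩ := integral_integral_translate (hslice τ (right_mem_Icc.2 hτ)) hC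
    (fun w => hb w τ (right_mem_Icc.2 hτ)) he
  have hG : Integrable fun w => ∫ y in (0 : ℝ)..τ, F w y := by
    simp only [intervalIntegral.integral_of_le hτ]
    have hI : Integrable (fun p : E n × ℝ => F p.1 p.2)
        (volume.prod (volume.restrict (Ioc (0 : ℝ) τ))) := by
      have h1 : Integrable (fun p : E n × ℝ => (C * decayWeight (n + 1) p.1) * (1 : ℝ))
          (volume.prod (volume.restrict (Ioc (0 : ℝ) τ))) :=
        (integrable_decayWeight.const_mul _).mul_prod (integrable_const (1 : ℝ))
      refine h1.mono' ?_ ?_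
      · have h2 : (volume : Measure (E n)).prod (volume.restrict (Ioc (0 : ℝ) τ)) =
            (volume.prod volume).restrict (univ ×ˢ Ioc (0 : ℝ) τ) := by
          rw [← Measure.prod_restrict, Measure.restrict_univ]
        rw [h2]
        exact (hcont.mono (prod_mono_right Ioc_subset_Icc_self)).aestronglyMeasurable
          (MeasurableSet.univ.prod measurableSet_Ioc)
      · have h2 : ∀ᵐ p : E n × ℝ ∂(volume.prod (volume.restrict (Ioc (0 : ℝ) τ))),
            p.2 ∈ Ioc (0 : ℝ) τ :=
          Measure.quasiMeasurePreserving_snd.ae (ae_restrict_mem measurableSet_Ioc)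
        filter_upwards [h2] with p hp
        rw [mul_one]
        exact hb _ _ (Ioc_subset_Icc_self hp)
    exact hI.integral_prod_left
  -- Cauchy's theorem on the rectangle of width one and height `τ` based at `w`, without slicing the
  -- space into lines or going to infinity.
  have hrect (w : E n) : (∫ x in (0 : ℝ)..1, F (w + x • e) 0) -
      (∫ x in (0 : ℝ)..1, F (w + x • e) τ) +
      Complex.I * ((∫ y in (0 : ℝ)..τ, F (w + e) y) - ∫ y in (0 : ℝ)..τ, F w y) = 0 := by
    have h := Complex.integral_boundary_rect_eq_zero_of_differentiableOn
      (fun z : ℂ => F (w + z.re • e) z.im) 0 (1 + τ * Complex.I) (fun z hz => by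
        refine (hd w z ?_).differentiableWithinAt
        have := (Complex.mem_reProdIm.1 hz).2
        simpa [uIcc_of_le hτ] using this)
    simp only [Complex.zero_re, Complex.zero_im, Complex.add_re, Complex.one_re, Complex.mul_re,
      Complex.ofReal_re, Complex.I_re, mul_zero, Complex.ofReal_im, Complex.I_im, mul_one, sub_self,
      add_zero, Complex.add_im, Complex.one_im, Complex.mul_im, zero_add, Complex.ofReal_zero,
      zero_mul, zero_smul, Complex.ofReal_one, one_smul, smul_eq_mul] at h
    linear_combination h
  have hsum : ∫ w, ((∫ x in (0 : ℝ)..1, F (w + x • e) 0) -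
      (∫ x in (0 : ℝ)..1, F (w + x • e) τ) +
      Complex.I * ((∫ y in (0 : ℝ)..τ, F (w + e) y) - ∫ y in (0 : ℝ)..τ, F w y)) = 0 := by
    simp only [hrect, integral_zero]
  have hG' : Integrable fun w => ∫ y in (0 : ℝ)..τ, F (w + e) y := hG.comp_add_right e
  -- The two vertical sides are translates of each other by `e`, so they cancel once integrated over
  -- `w`.
  have hGe : ∫ w, ∫ y in (0 : ℝ)..τ, F (w + e) y = ∫ w, ∫ y in (0 : ℝ)..τ, F w y :=
    integral_add_right_eq_self (fun w => ∫ y in (0 : ℝ)..τ, F w y) e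
  have hA : Integrable fun w => (∫ x in (0 : ℝ)..1, F (w + x • e) 0) -
      ∫ x in (0 : ℝ)..1, F (w + x • e) τ := hi0.sub hi1
  have hB : Integrable fun w => (∫ y in (0 : ℝ)..τ, F (w + e) y) - ∫ y in (0 : ℝ)..τ, F w y :=
    hG'.sub hG
  rw [integral_add hA (hB.const_mul Complex.I), integral_sub hi0 hi1,
    integral_const_mul, integral_sub hG' hG, hGe, h0, h1] at hsum
  simpa [sub_eq_zero] using hsum

end ContourShift

/-! ### The dispersive estimate by autocorrelation. -/

section Dispersion

variable {n : ℕ} {m : ℝ}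

/-- The oscillating integrand `e^{i t ω(w)} a(w)`. -/
def oscillating (m : ℝ) (a : E n → E n → ℂ) (t : ℝ) (w : E n) : ℂ :=
  Complex.exp (t * freq m w 0 * Complex.I) * a w 0

lemma norm_oscillating (a : E n → E n → ℂ) (t : ℝ) (w : E n) :
    ‖oscillating m a t w‖ = ‖a w 0‖ := by
  rw [oscillating, norm_mul, freq_zero_right, Complex.norm_exp]
  simp

lemma IsAmplitude.continuous_oscillating {a : E n → E n → ℂ} (hm : 0 < m) (ha : IsAmplitude m a)
    (t : ℝ) : Continuous (oscillating m a t) := by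
  have hmap : MapsTo (fun w : E n => (w, (0 : E n))) univ {p | 4 * Real.pi * ‖p.2‖ < m} :=
    fun w _ => by simpa using hm
  have h1 : ContinuousOn (fun w : E n => freq m w 0) univ :=
    continuousOn_freq.comp (f := fun w : E n => (w, (0 : E n))) (by fun_prop) hmap
  have h2 : ContinuousOn (fun w : E n => a w 0) univ :=
    ha.continuousOn.comp (f := fun w : E n => (w, (0 : E n))) (by fun_prop) hmap
  rw [continuousOn_univ] at h1 h2
  unfold oscillating
  fun_prop

/-- Trades the exponential damping for polynomial decay in `y`, at the price of a power of `W` that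
the amplitudes can absorb. -/
lemma exp_neg_div_le {k : ℕ} {W y : ℝ} (hW : 1 ≤ W) (hy : 0 ≤ y) :
    Real.exp (-(y / W ^ 3)) ≤ k.factorial * Real.exp 1 * W ^ (3 * k) * ((1 + y) ^ k)⁻¹ := by
  have hW0 : 0 < W := by linarith
  have h1 : 1 + y ≤ W ^ 3 * (1 + y / W ^ 3) := by
    have : W ^ 3 * (1 + y / W ^ 3) = W ^ 3 + y := by field_simp
    rw [this]
    linarith [one_le_pow₀ hW (n := 3)]
  have h2 : (1 + y / W ^ 3) ^ k ≤ k.factorial * Real.exp (1 + y / W ^ 3) := by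
    have := Real.pow_div_factorial_le_exp (1 + y / W ^ 3) (by positivity) k
    rw [div_le_iff₀ (by positivity)] at this
    linarith
  rw [← div_eq_mul_inv, le_div_iff₀ (by positivity)]
  calc Real.exp (-(y / W ^ 3)) * (1 + y) ^ k
      ≤ Real.exp (-(y / W ^ 3)) * (W ^ 3 * (1 + y / W ^ 3)) ^ k := by gcongr
    _ = Real.exp (-(y / W ^ 3)) * W ^ (3 * k) * (1 + y / W ^ 3) ^ k := by rw [mul_pow]; ring
    _ ≤ Real.exp (-(y / W ^ 3)) * W ^ (3 * k) * (k.factorial * Real.exp (1 + y / W ^ 3)) := by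
        gcongr
    _ = k.factorial * (Real.exp (-(y / W ^ 3)) * Real.exp (1 + y / W ^ 3)) * W ^ (3 * k) := by ring
    _ = _ := by rw [← Real.exp_add]; ring_nf

/-- Order `4k` is chosen so that, after `3k` powers are spent on the loss `W ^ (3k)`, order `k`
survives. -/
lemma decayWeight_mul_pow_le (k : ℕ) (w u : E n) :
    decayWeight (4 * k) (w + u) * decayWeight (4 * k) w * (1 + ‖w‖ + ‖u‖) ^ (3 * k) ≤
      8 ^ k * decayWeight k w := by
  have hA := norm_nonneg w
  have hB := norm_nonneg (w + u)
  have hu : ‖u‖ ≤ ‖w + u‖ + ‖w‖ := by simpa using norm_sub_le (w + u) w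
  have hW : 1 + ‖w‖ + ‖u‖ ≤ 2 * ((1 + ‖w‖) * (1 + ‖w + u‖)) := by
    nlinarith [mul_nonneg hA hB]
  unfold decayWeight
  rw [← mul_inv, ← div_eq_inv_mul, div_le_iff₀ (by positivity)]
  calc (1 + ‖w‖ + ‖u‖) ^ (3 * k) ≤ (2 * ((1 + ‖w‖) * (1 + ‖w + u‖))) ^ (3 * k) := by gcongr
    _ = 8 ^ k * ((1 + ‖w‖) ^ (3 * k) * (1 + ‖w + u‖) ^ (3 * k)) := by
        rw [mul_pow, mul_pow, pow_mul]; norm_num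
    _ ≤ 8 ^ k * ((1 + ‖w‖) ^ (3 * k) * (1 + ‖w + u‖) ^ (4 * k)) := by
        gcongr
        · linarith
        · norm_num
    _ = 8 ^ k * ((1 + ‖w‖) ^ k)⁻¹ * ((1 + ‖w + u‖) ^ (4 * k) * (1 + ‖w‖) ^ (4 * k)) := by
        have : (1 + ‖w‖) ^ (4 * k) = (1 + ‖w‖) ^ k * (1 + ‖w‖) ^ (3 * k) := by
          rw [← pow_add]; congr 1; ring
        rw [this]
        have : (1 + ‖w‖) ^ k ≠ 0 := by positivity
        field_simp

lemma decayWeight_antitone {N N' : ℕ} (h : N ≤ N') (w : E n) :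
    decayWeight N' w ≤ decayWeight N w := by
  unfold decayWeight
  have := norm_nonneg w
  gcongr
  linarith

lemma decayWeight_le_one (N : ℕ) (w : E n) : decayWeight N w ≤ 1 := by
  simpa [decayWeight] using decayWeight_antitone (Nat.zero_le N) w

lemma exists_unit_vector (hn : 1 ≤ n) (u : E n) : ∃ e : E n, ‖e‖ = 1 ∧ u = ‖u‖ • e := by
  by_cases hu : u = 0
  · refine ⟨EuclideanSpace.single ⟨0, hn⟩ 1, by simp, by simp [hu]⟩
  · have : ‖u‖ ≠ 0 := norm_ne_zero_iff.2 hu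
    exact ⟨‖u‖⁻¹ • u, by simp [norm_smul, this], by simp [smul_smul, this]⟩

/-- The analytic continuation of the correlation integrand in the direction `e`. -/
def correlation (m : ℝ) (a : E n → E n → ℂ) (t : ℝ) (u e w : E n) (τ : ℝ) : ℂ :=
  Complex.exp (t * (freq m (w + u) (τ • e) - freq m w (τ • e)) * Complex.I) *
    (a (w + u) (τ • e) * starRingEnd ℂ (a w (-(τ • e))))

lemma correlation_zero (a : E n → E n → ℂ) (t : ℝ) (u e w : E n) :
    correlation m a t u e w 0 =
      oscillating m a t (w + u) * starRingEnd ℂ (oscillating m a t w) := by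
  simp only [correlation, oscillating, zero_smul, neg_zero, freq_zero_right, map_mul,
    ← Complex.exp_conj, Complex.conj_ofReal, Complex.conj_I]
  rw [mul_mul_mul_comm, ← Complex.exp_add]
  congr 2
  ring

lemma norm_correlation_le {a : E n → E n → ℂ} (t : ℝ) (u w : E n) {e : E n} (he : ‖e‖ = 1)
    {τ : ℝ} (hτ : 4 * Real.pi * |τ| < m) {C : ℝ} {N : ℕ}
    (h : ∀ w η : E n, 4 * Real.pi * ‖η‖ < m → ‖a w η‖ ≤ C * decayWeight N w) :
    ‖correlation m a t u e w τ‖ ≤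
      Real.exp (-(t * ((freq m (w + u) (τ • e)).im - (freq m w (τ • e)).im))) *
        (C ^ 2 * (decayWeight N (w + u) * decayWeight N w)) := by
  have hη := four_pi_norm_smul_lt he hτ
  rw [correlation, norm_mul, norm_mul, Complex.norm_exp, RCLike.norm_conj]
  have h1 : (t * (freq m (w + u) (τ • e) - freq m w (τ • e)) * Complex.I).re =
      -(t * ((freq m (w + u) (τ • e)).im - (freq m w (τ • e)).im)) := by
    rw [mul_assoc, Complex.re_ofReal_mul, Complex.mul_I_re, Complex.sub_im]
    ring
  rw [h1]
  refine mul_le_mul_of_nonneg_left ?_ (Real.exp_pos _).le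
  calc _ ≤ (C * decayWeight N (w + u)) * (C * decayWeight N w) :=
        mul_le_mul (h _ _ hη) (h _ _ (by rwa [norm_neg])) (norm_nonneg _)
          ((norm_nonneg _).trans (h _ _ hη))
    _ = _ := by ring

/-- Shifting parallel to `u` gives the difference of frequencies a nonnegative imaginary part at
every intermediate height, so for `t ≥ 0` the exponential stays bounded by one along the
deformation. -/
lemma IsAmplitude.correlation_shift {a : E n → E n → ℂ} (hm : 0 < m)
    (ha : IsAmplitude m a) {t : ℝ} (ht : 0 ≤ t) (u : E n) {e : E n} (he : ‖e‖ = 1)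
    (hu : u = ‖u‖ • e) {τ : ℝ} (h0 : 0 ≤ τ) (hτ : 4 * Real.pi * τ < m) :
    ∫ w, correlation m a t u e w 0 = ∫ w, correlation m a t u e w τ := by
  obtain ⟨C, hC, hb⟩ := ha.bound (n + 1)
  have hs {s : ℝ} (hs : s ∈ Icc 0 τ) : 4 * Real.pi * |s| < m := by
    rw [abs_of_nonneg hs.1]
    refine lt_of_le_of_lt ?_ hτ
    have := hs.2
    gcongr
  refine integral_eq_integral_shift he h0 (sq_nonneg C) (fun w z hz => ?_) ?_ (fun w s hs' => ?_)
  · have hz' := hs hz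
    have hw (z : ℂ) : w + z.re • e + u = w + u + z.re • e := by abel
    simp only [correlation, hw]
    have h1 := (hasDerivAt_freq_line (m := m) (w + u) he hz').differentiableAt
    have h2 := (hasDerivAt_freq_line (m := m) w he hz').differentiableAt
    exact ((((h1.sub h2).const_mul (t : ℂ)).mul_const Complex.I).cexp).mul
      ((ha.differentiableAt (w + u) e he z hz').mul
        (ha.reflect.differentiableAt w e he z hz'))
  · have hmap : MapsTo (fun p : E n × ℝ => (p.1, p.2 • e)) (univ ×ˢ Icc 0 τ)
        {p | 4 * Real.pi * ‖p.2‖ < m} := fun p hp => four_pi_norm_smul_lt he (hs hp.2)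
    have hmap' : MapsTo (fun p : E n × ℝ => (p.1 + u, p.2 • e)) (univ ×ˢ Icc 0 τ)
        {p | 4 * Real.pi * ‖p.2‖ < m} := fun p hp => four_pi_norm_smul_lt he (hs hp.2)
    have h1 := continuousOn_freq.comp (by fun_prop) hmap
    have h2 := continuousOn_freq.comp (by fun_prop) hmap'
    have h3 := ha.reflect.continuousOn.comp (by fun_prop) hmap
    have h4 := ha.continuousOn.comp (by fun_prop) hmap'
    exact ((((h2.sub h1).const_smul (t : ℂ)).mul
      (continuousOn_const (c := Complex.I))).cexp).mul (h4.mul h3)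
  · refine (norm_correlation_le t u w he (hs hs') hb).trans ?_
    have h1 := im_freq_sub_ge (m := m) w he (r := ‖u‖) hs'.1
      (by have := hs hs'; rwa [abs_of_nonneg hs'.1] at this) (norm_nonneg u)
    rw [← hu] at h1
    have h2 : 0 ≤ (freq m (w + u) (s • e)).im - (freq m w (s • e)).im := by
      refine le_trans ?_ h1
      have := hs'.1
      positivity
    have h3 : Real.exp (-(t * ((freq m (w + u) (s • e)).im - (freq m w (s • e)).im))) ≤ 1 := by
      rw [Real.exp_le_one_iff]
      have := mul_nonneg ht h2
      linarith
    have h4 := mul_le_of_le_one_left (decayWeight_nonneg (n + 1) w)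
      (decayWeight_le_one (n + 1) (w + u))
    have h5 := decayWeight_nonneg (n + 1) w
    have h6 := decayWeight_nonneg (n + 1) (w + u)
    calc _ ≤ 1 * (C ^ 2 * (decayWeight (n + 1) (w + u) * decayWeight (n + 1) w)) := by gcongr
      _ ≤ _ := by
        rw [one_mul]
        gcongr

/-- On the shifted contour the integrand carries a factor `exp(-c t|u| / (1 + ‖w‖ + ‖u‖)³)`; its
polynomial form depends on `u` only through `t|u|`, up to weights integrable in `w`. -/
lemma IsAmplitude.norm_integral_correlation_le {a : E n → E n → ℂ} (hn : 1 ≤ n) (hm : 0 < m)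
    (ha : IsAmplitude m a) : ∃ C c : ℝ, 0 ≤ C ∧ 0 < c ∧ ∀ t : ℝ, 0 < t → ∀ u : E n,
      ‖∫ w, oscillating m a t (w + u) * starRingEnd ℂ (oscillating m a t w)‖ ≤
        C * decayWeight (n + 1) ((c * t) • u) := by
  obtain ⟨C, hC, hb⟩ := ha.bound (4 * (n + 1))
  have hpi := Real.pi_pos
  -- Half the height of the tube: any positive height inside it would do.
  set τ : ℝ := m / (8 * Real.pi) with hτdef
  have hτ0 : 0 < τ := by positivity
  have hτ : 4 * Real.pi * τ < m := by
    rw [hτdef]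
    field_simp
    linarith
  set c : ℝ := 3 * Real.pi ^ 2 * m ^ 2 / (2 * m + 2 * Real.pi) ^ 3 * τ with hc
  have hc0 : 0 < c := by positivity
  set D : ℝ := (n + 1).factorial * Real.exp 1 * C ^ 2 * 8 ^ (n + 1) with hD
  have hI : 0 ≤ ∫ w : E n, decayWeight (n + 1) w := integral_nonneg fun w => decayWeight_nonneg _ w
  refine ⟨D * ∫ w : E n, decayWeight (n + 1) w, c, by positivity, hc0, fun t ht u => ?_⟩
  obtain ⟨e, he, hu⟩ := exists_unit_vector hn u
  simp only [← correlation_zero (m := m) a t u e]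
  rw [ha.correlation_shift hm ht.le u he hu hτ0.le hτ]
  set y : ℝ := c * t * ‖u‖ with hy
  have hy0 : 0 ≤ y := by positivity
  have hdw : decayWeight (n + 1) ((c * t) • u) = ((1 + y) ^ (n + 1))⁻¹ := by
    rw [decayWeight, norm_smul, Real.norm_of_nonneg (by positivity)]
  have key (w : E n) : ‖correlation m a t u e w τ‖ ≤
      D * ((1 + y) ^ (n + 1))⁻¹ * decayWeight (n + 1) w := by
    refine (norm_correlation_le t u w he (by rwa [abs_of_pos hτ0]) hb).trans ?_
    have h1 := im_freq_sub_ge (m := m) w he (r := ‖u‖) hτ0.le hτ (norm_nonneg u)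
    rw [← hu] at h1
    set W := 1 + ‖w‖ + ‖u‖ with hWdef
    have hW : 1 ≤ W := by
      have := norm_nonneg w
      have := norm_nonneg u
      linarith
    have h2 : Real.exp (-(t * ((freq m (w + u) (τ • e)).im - (freq m w (τ • e)).im))) ≤
        Real.exp (-(y / W ^ 3)) := by
      refine Real.exp_le_exp.2 (neg_le_neg ?_)
      refine le_trans (le_of_eq ?_) (mul_le_mul_of_nonneg_left h1 ht.le)
      rw [hy, hc]
      ring
    have h3 := h2.trans (exp_neg_div_le (k := n + 1) hW hy0)
    have h4 := decayWeight_mul_pow_le (n + 1) w u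
    have h5 := decayWeight_nonneg (4 * (n + 1)) w
    have h6 := decayWeight_nonneg (4 * (n + 1)) (w + u)
    calc _ ≤ (n + 1).factorial * Real.exp 1 * W ^ (3 * (n + 1)) * ((1 + y) ^ (n + 1))⁻¹ *
          (C ^ 2 * (decayWeight (4 * (n + 1)) (w + u) * decayWeight (4 * (n + 1)) w)) :=
          mul_le_mul_of_nonneg_right h3 (by positivity)
      _ = (n + 1).factorial * Real.exp 1 * ((1 + y) ^ (n + 1))⁻¹ * C ^ 2 *
          (decayWeight (4 * (n + 1)) (w + u) * decayWeight (4 * (n + 1)) w *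
            W ^ (3 * (n + 1))) := by ring
      _ ≤ (n + 1).factorial * Real.exp 1 * ((1 + y) ^ (n + 1))⁻¹ * C ^ 2 *
          (8 ^ (n + 1) * decayWeight (n + 1) w) :=
          mul_le_mul_of_nonneg_left h4 (by positivity)
      _ = _ := by rw [hD]; ring
  refine (norm_integral_le_of_norm_le (integrable_decayWeight.const_mul _)
    (Eventually.of_forall key)).trans (le_of_eq ?_)
  rw [integral_const_mul, hdw]
  ring

/-- `|∫ g|²` is the integral of the autocorrelation of `g`. -/
lemma norm_integral_sq_le {g : E n → ℂ} (hi : Integrable g) :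
    ‖∫ w, g w‖ ^ 2 ≤ ∫ u, ‖∫ w, g (w + u) * starRingEnd ℂ (g w)‖ := by
  have hi' : Integrable fun w => starRingEnd ℂ (g w) :=
    Complex.conjCLE.toContinuousLinearMap.integrable_comp hi
  have hprod : Integrable (fun p : E n × E n => starRingEnd ℂ (g p.1) * g p.2)
      (volume.prod volume) := hi'.mul_prod hi
  -- The shear `(w, u) ↦ (w, w + u)` preserves the product measure and brings out the
  -- autocorrelation.
  have hmp := measurePreserving_prod_add (volume : Measure (E n)) (volume : Measure (E n))
  have hshear : Integrable (fun p : E n × E n => starRingEnd ℂ (g p.1) * g (p.1 + p.2))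
      (volume.prod volume) := hmp.integrable_comp_of_integrable hprod
  have h1 : ∫ p : E n × E n, starRingEnd ℂ (g p.1) * g (p.1 + p.2) ∂(volume.prod volume) =
      ∫ p : E n × E n, starRingEnd ℂ (g p.1) * g p.2 ∂(volume.prod volume) := by
    have hm : AEStronglyMeasurable (fun p : E n × E n => starRingEnd ℂ (g p.1) * g p.2)
        (Measure.map (fun z : E n × E n => (z.1, z.1 + z.2)) (volume.prod volume)) := by
      rw [hmp.map_eq]
      exact hprod.aestronglyMeasurable
    have := integral_map hmp.measurable.aemeasurable hm
    rw [hmp.map_eq] at this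
    exact this.symm
  have h2 : ‖∫ w, g w‖ ^ 2 =
      ‖∫ p : E n × E n, starRingEnd ℂ (g p.1) * g p.2 ∂(volume.prod volume)‖ := by
    rw [integral_prod_mul (fun w => starRingEnd ℂ (g w)) g, integral_conj, norm_mul,
      RCLike.norm_conj, sq]
  rw [h2, ← h1, integral_prod_symm _ hshear]
  refine (norm_integral_le_integral_norm _).trans (le_of_eq ?_)
  simp only [mul_comm]

/-- The dispersive estimate for oscillating integrals. -/
lemma IsAmplitude.dispersive {a : E n → E n → ℂ} (hn : 1 ≤ n) (hm : 0 < m)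
    (ha : IsAmplitude m a) : ∃ C : ℝ, 0 ≤ C ∧ ∀ t : ℝ, 0 < t → ∀ x : E n,
      ‖∫ w, Complex.exp (2 * Real.pi * (inner ℝ w x : ℝ) * Complex.I) * oscillating m a t w‖ ^ 2 ≤
        C / t ^ n := by
  obtain ⟨C, c, hC, hc, h⟩ := ha.norm_integral_correlation_le hn hm
  obtain ⟨A, hA, hb⟩ := ha.bound (n + 1)
  have hI : 0 ≤ ∫ w : E n, decayWeight (n + 1) w := integral_nonneg fun w => decayWeight_nonneg _ w
  refine ⟨C * (∫ w : E n, decayWeight (n + 1) w) / c ^ n, by positivity, fun t ht x => ?_⟩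
  set g : E n → ℂ := fun w =>
    Complex.exp (2 * Real.pi * (inner ℝ w x : ℝ) * Complex.I) * oscillating m a t w with hgdef
  have hosc := ha.continuous_oscillating hm t
  have hg : Continuous g := by
    rw [hgdef]
    fun_prop
  have hunit (w : E n) : ‖Complex.exp (2 * Real.pi * (inner ℝ w x : ℝ) * Complex.I)‖ = 1 := by
    have : (2 * Real.pi * (inner ℝ w x : ℝ) * Complex.I : ℂ) =
        ((2 * Real.pi * inner ℝ w x : ℝ) : ℂ) * Complex.I := by push_cast; ring
    rw [this, Complex.norm_exp_ofReal_mul_I]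
  have hi : Integrable g := by
    refine (integrable_decayWeight.const_mul A).mono' hg.aestronglyMeasurable
      (Eventually.of_forall fun w => ?_)
    rw [hgdef]
    simp only
    rw [norm_mul, hunit, one_mul, norm_oscillating]
    exact hb w 0 (by simpa using hm)
  refine (norm_integral_sq_le hi).trans ?_
  -- The character only contributes a phase independent of `w`, which makes the estimate uniform in
  -- `x`.
  have hcor (u : E n) : ‖∫ w, g (w + u) * starRingEnd ℂ (g w)‖ ≤
      C * decayWeight (n + 1) ((c * t) • u) := by
    refine le_trans (le_of_eq ?_) (h t ht u)
    have : ∀ w, g (w + u) * starRingEnd ℂ (g w) =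
        Complex.exp (2 * Real.pi * (inner ℝ u x : ℝ) * Complex.I) *
          (oscillating m a t (w + u) * starRingEnd ℂ (oscillating m a t w)) := by
      intro w
      simp only [hgdef, map_mul, ← Complex.exp_conj, Complex.conj_ofReal, Complex.conj_I,
        inner_add_left, Complex.conj_ofNat]
      rw [mul_mul_mul_comm, ← Complex.exp_add]
      congr 2
      push_cast
      ring
    simp only [this]
    rw [integral_const_mul, norm_mul, hunit, one_mul]
  have hct : 0 < c * t := mul_pos hc ht
  have hint : Integrable fun u : E n => C * decayWeight (n + 1) ((c * t) • u) :=
    (integrable_decayWeight.comp_smul hct.ne').const_mul C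
  refine (integral_mono_of_nonneg (Eventually.of_forall fun u => norm_nonneg _) hint
    (Eventually.of_forall hcor)).trans (le_of_eq ?_)
  -- Rescaling `u` by `c t` produces the factor `t^{-n}`.
  rw [integral_const_mul, Measure.integral_comp_smul]
  simp only [finrank_euclideanSpace, Fintype.card_fin, smul_eq_mul]
  rw [abs_of_pos (by positivity), mul_pow]
  field_simp

end Dispersion

/-! ### Uniform decay of the dual evolution. -/

section Decay

variable {n : ℕ} {m : ℝ}

/-- The Fourier character `e^{2πi⟨w, x⟩}`. -/
def character (w x : E n) : ℂ := Complex.exp (2 * Real.pi * (inner ℝ w x : ℝ) * Complex.I)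

lemma norm_character (w x : E n) : ‖character w x‖ = 1 := by
  have : (2 * Real.pi * (inner ℝ w x : ℝ) * Complex.I : ℂ) =
      ((2 * Real.pi * inner ℝ w x : ℝ) : ℂ) * Complex.I := by push_cast; ring
  rw [character, this, Complex.norm_exp_ofReal_mul_I]

lemma continuous_character (x : E n) : Continuous fun w => character w x := by
  unfold character
  fun_prop

lemma conj_character (w x : E n) : starRingEnd ℂ (character w x) = character w (-x) := by
  rw [character, character, ← Complex.exp_conj]
  simp [Complex.conj_ofNat]

lemma continuous_freq_zero (hm : 0 < m) : Continuous fun w : E n => freq m w 0 := by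
  rw [← continuousOn_univ]
  exact continuousOn_freq.comp (f := fun w : E n => (w, (0 : E n))) (by fun_prop)
    fun w _ => by simpa using hm

lemma IsAmplitude.integrable_mul {a : E n → E n → ℂ} (hm : 0 < m) (ha : IsAmplitude m a)
    {c : E n → ℂ} (hc : Continuous c) (hc1 : ∀ w, ‖c w‖ ≤ 1) :
    Integrable fun w => c w * a w 0 := by
  obtain ⟨A, hA, hb⟩ := ha.bound (n + 1)
  have hcont : ContinuousOn (fun w : E n => a w 0) univ :=
    ha.continuousOn.comp (f := fun w : E n => (w, (0 : E n))) (by fun_prop)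
      fun w _ => by simpa using hm
  rw [continuousOn_univ] at hcont
  refine (integrable_decayWeight.const_mul A).mono' (hc.mul hcont).aestronglyMeasurable
    (Eventually.of_forall fun w => ?_)
  rw [norm_mul]
  exact (mul_le_of_le_one_left (norm_nonneg _) (hc1 w)).trans (hb w 0 (by simpa using hm))

lemma le_div_sqrt_of_sq_le {a C t : ℝ} (ht : 0 < t) (h : a ^ 2 ≤ C / t ^ n) :
    a ≤ √C / √(t ^ n) := by
  rw [← Real.sqrt_div' _ (by positivity)]
  exact Real.le_sqrt_of_sq_le h

lemma IsAmplitude.norm_integral_exp_le {a : E n → E n → ℂ} (hn : 1 ≤ n) (hm : 0 < m)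
    (ha : IsAmplitude m a) : ∃ C : ℝ, 0 ≤ C ∧ ∀ t : ℝ, 0 < t → ∀ x : E n,
      ‖∫ w, character w x * Complex.exp (freq m w 0 * t * Complex.I) * a w 0‖ ≤ C / √(t ^ n) ∧
      ‖∫ w, character w x * Complex.exp (-(freq m w 0 * t) * Complex.I) * a w 0‖ ≤
        C / √(t ^ n) := by
  obtain ⟨C, hC, h⟩ := ha.dispersive hn hm
  -- The phase of opposite sign is reduced to the first by conjugation, which reflects the amplitude
  -- and replaces `x` by `-x`.
  obtain ⟨C', hC', h'⟩ := ha.reflect.dispersive hn hm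
  refine ⟨√C + √C', by positivity, fun t ht x => ⟨?_, ?_⟩⟩
  · have := le_div_sqrt_of_sq_le ht (h t ht x)
    refine le_trans (le_of_eq ?_) (this.trans ?_)
    · congr 2
      ext w
      rw [oscillating, character, mul_assoc, mul_comm (freq m w 0)]
    · gcongr
      linarith [Real.sqrt_nonneg C']
  · have := le_div_sqrt_of_sq_le ht (h' t ht (-x))
    refine le_trans (le_of_eq ?_) (this.trans ?_)
    · rw [← RCLike.norm_conj (K := ℂ), ← integral_conj]
      congr 2
      ext w
      rw [map_mul, map_mul, conj_character, ← Complex.exp_conj, oscillating, character,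
        freq_zero_right, neg_zero, mul_assoc]
      congr 3
      simp only [map_mul, map_neg, Complex.conj_ofReal, Complex.conj_I]
      ring
    · gcongr
      linarith [Real.sqrt_nonneg C]

lemma norm_exp_freq (w : E n) (t : ℝ) :
    ‖Complex.exp (freq m w 0 * t * Complex.I)‖ = 1 ∧
      ‖Complex.exp (-(freq m w 0 * t) * Complex.I)‖ = 1 := by
  rw [freq_zero_right]
  constructor
  · rw [← Complex.ofReal_mul, Complex.norm_exp_ofReal_mul_I]
  · rw [← Complex.ofReal_mul, ← Complex.ofReal_neg, Complex.norm_exp_ofReal_mul_I]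

lemma IsAmplitude.norm_integral_trig_le {a : E n → E n → ℂ} (hn : 1 ≤ n) (hm : 0 < m)
    (ha : IsAmplitude m a) : ∃ C : ℝ, 0 ≤ C ∧ ∀ t : ℝ, 0 < t → ∀ x : E n,
      (Integrable (fun w => character w x * Complex.cos (freq m w 0 * t) * a w 0) ∧
      ‖∫ w, character w x * Complex.cos (freq m w 0 * t) * a w 0‖ ≤ C / √(t ^ n)) ∧
      Integrable (fun w => character w x * Complex.sin (freq m w 0 * t) * a w 0) ∧
      ‖∫ w, character w x * Complex.sin (freq m w 0 * t) * a w 0‖ ≤ C / √(t ^ n) := by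
  obtain ⟨C, hC, h⟩ := ha.norm_integral_exp_le hn hm
  refine ⟨C, hC, fun t ht x => ?_⟩
  obtain ⟨hp, hq⟩ := h t ht x
  have hfreq := continuous_freq_zero (n := n) hm
  have hch := continuous_character x
  have ip : Integrable fun w =>
      character w x * Complex.exp (freq m w 0 * t * Complex.I) * a w 0 :=
    ha.integrable_mul hm (by fun_prop) fun w => by
      rw [norm_mul, norm_character, (norm_exp_freq w t).1, one_mul]
  have iq : Integrable fun w =>
      character w x * Complex.exp (-(freq m w 0 * t) * Complex.I) * a w 0 :=
    ha.integrable_mul hm (by fun_prop) fun w => by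
      rw [norm_mul, norm_character, (norm_exp_freq w t).2, one_mul]
  have ecos : (fun w => character w x * Complex.cos (freq m w 0 * t) * a w 0) = fun w =>
      2⁻¹ * (character w x * Complex.exp (freq m w 0 * t * Complex.I) * a w 0 +
        character w x * Complex.exp (-(freq m w 0 * t) * Complex.I) * a w 0) := by
    ext w
    rw [Complex.cos]
    ring
  have esin : (fun w => character w x * Complex.sin (freq m w 0 * t) * a w 0) = fun w =>
      (Complex.I / 2) * (character w x * Complex.exp (-(freq m w 0 * t) * Complex.I) * a w 0 -
        character w x * Complex.exp (freq m w 0 * t * Complex.I) * a w 0) := by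
    ext w
    rw [Complex.sin]
    ring
  rw [ecos, esin]
  refine ⟨⟨(ip.add iq).const_mul _, ?_⟩, (iq.sub ip).const_mul _, ?_⟩
  · rw [integral_const_mul, integral_add ip iq, norm_mul, norm_inv, Complex.norm_ofNat]
    have := norm_add_le (∫ w, character w x * Complex.exp (freq m w 0 * t * Complex.I) * a w 0)
      (∫ w, character w x * Complex.exp (-(freq m w 0 * t) * Complex.I) * a w 0)
    linarith
  · rw [integral_const_mul, integral_sub iq ip, norm_mul, norm_div, Complex.norm_I,
      Complex.norm_ofNat]
    have := norm_sub_le (∫ w, character w x * Complex.exp (-(freq m w 0 * t) * Complex.I) * a w 0)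
      (∫ w, character w x * Complex.exp (freq m w 0 * t * Complex.I) * a w 0)
    linarith

lemma freq_zero_sq (w : E n) :
    freq m w 0 ^ 2 = (m : ℂ) ^ 2 - ∑ k, cvec 0 (-(2 * Real.pi) • w) k ^ 2 := by
  rw [freq_sq, sum_cvec_sq, freqSq, norm_smul, norm_neg, Real.norm_of_nonneg (by positivity)]
  simp
  ring

/-- Solutions of the adjoint equation decay like `t^{-n/2}`, uniformly in space. -/
theorem IsAdjointEvolution.norm_le (hn : 1 ≤ n) (hm : 0 < m) {Ψ : State n} (hΨ : IsTestPair Ψ) :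
    ∃ C : ℝ, 0 ≤ C ∧ ∀ t : ℝ, 0 < t → ∀ Φ : State n, IsAdjointEvolution m t Ψ Φ →
      ∀ x, ‖Φ x‖ ≤ C / √(t ^ n) := by
  have hA (i : Fin 2) : IsAmplitude m (fun w η : E n =>
      conjTransform (cvec ((2 * Real.pi) • η) (-(2 * Real.pi) • w)) (fun x => Ψ x i)) :=
    isAmplitude_laplaceTransform hn m (isTest_conj (hΨ.component i)).1
      (isTest_conj (hΨ.component i)).2
  obtain ⟨C₀, hC₀, h₀⟩ := (hA 0).norm_integral_trig_le hn hm
  obtain ⟨C₁, hC₁, h₁⟩ := (hA 1).norm_integral_trig_le hn hm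
  obtain ⟨C₂, hC₂, h₂⟩ := ((hA 1).freq_mul hm).norm_integral_trig_le hn hm
  obtain ⟨C₃, hC₃, h₃⟩ := ((hA 0).freq_inv_mul hm).norm_integral_trig_le hn hm
  refine ⟨C₀ + C₁ + C₂ + C₃, by positivity, fun t ht Φ hΦ x => ?_⟩
  have hwave : wave (cvec (0 : E n) 0) x = 1 := by simp [wave_cvec]
  have hinv (i : Fin 2) : starRingEnd ℂ (Φ x i) =
      ∫ w, character w x * conjTransform (cvec 0 (-(2 * Real.pi) • w)) (fun x => Φ x i) := by
    have := wave_mul_eq_integral hn (isTest_conj (hΦ.1.component i)).1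
      (isTest_conj (hΦ.1.component i)).2 0 x
    rwa [hwave, one_mul] at this
  have hs : 0 < √(t ^ n) := by positivity
  have hle {a : ℝ} {b c : ℝ} (h : a ≤ b / √(t ^ n) + c / √(t ^ n))
      (hbc : b + c ≤ C₀ + C₁ + C₂ + C₃) : a ≤ (C₀ + C₁ + C₂ + C₃) / √(t ^ n) := by
    refine h.trans ?_
    rw [← add_div]
    gcongr
  refine (pi_norm_le_iff_of_nonneg (by positivity)).2 (Fin.forall_fin_two.2 ⟨?_, ?_⟩)
  · rw [← RCLike.norm_conj, hinv 0]
    -- The propagator formula splits the inversion integral into cosine and sine parts; the factor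
    -- `ω`, or `ω⁻¹` in the other component, is absorbed into the amplitude.
    have e (w : E n) : character w x *
        conjTransform (cvec 0 (-(2 * Real.pi) • w)) (fun x => Φ x 0) =
        character w x * Complex.cos (freq m w 0 * t) *
          conjTransform (cvec ((2 * Real.pi) • 0) (-(2 * Real.pi) • w)) (fun x => Ψ x 0) -
        character w x * Complex.sin (freq m w 0 * t) * (freq m w 0 *
          conjTransform (cvec ((2 * Real.pi) • 0) (-(2 * Real.pi) • w)) (fun x => Ψ x 1)) := by
      rw [(hΦ.transforms hΨ (freq_zero_sq w)).1, smul_zero]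
      ring
    simp only [e]
    rw [integral_sub (h₀ t ht x).1.1 (h₂ t ht x).2.1]
    refine hle ((norm_sub_le _ _).trans (add_le_add (h₀ t ht x).1.2 (h₂ t ht x).2.2)) ?_
    linarith
  · rw [← RCLike.norm_conj, hinv 1]
    have e (w : E n) : character w x *
        conjTransform (cvec 0 (-(2 * Real.pi) • w)) (fun x => Φ x 1) =
        character w x * Complex.sin (freq m w 0 * t) * ((freq m w 0)⁻¹ *
          conjTransform (cvec ((2 * Real.pi) • 0) (-(2 * Real.pi) • w)) (fun x => Ψ x 0)) +
        character w x * Complex.cos (freq m w 0 * t) *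
          conjTransform (cvec ((2 * Real.pi) • 0) (-(2 * Real.pi) • w)) (fun x => Ψ x 1) := by
      obtain ⟨S, hS, -, hT⟩ := (hΦ.transforms hΨ (freq_zero_sq w)).2
      have hne : freq m w 0 ≠ 0 := freq_ne_zero (by simpa using hm)
      rw [hT, smul_zero, ← hS]
      field_simp
    simp only [e]
    rw [integral_add (h₃ t ht x).2.1 (h₁ t ht x).1.1]
    refine hle ((norm_add_le _ _).trans (add_le_add (h₃ t ht x).2.2 (h₁ t ht x).1.2)) ?_
    linarith

end Decay

/-! ### Rooms, moments and sums over rooms. -/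

section Rooms

variable {n : ℕ} {m : ℝ}

lemma measurableSet_room (hn : 1 ≤ n) (d ρ : ℝ) (j : ℤ) : MeasurableSet (room hn d ρ j) := by
  have h : Continuous fun x : E n => x ⟨n - 1, by omega⟩ := by fun_prop
  exact (measurableSet_le measurable_const h.measurable).inter
    (measurableSet_le h.measurable measurable_const)

lemma abs_apply_le_norm (x : E n) (i : Fin n) : |x i| ≤ ‖x‖ := by
  simpa using PiLp.norm_apply_le x i

/-- The set lies in a box with one side `d` and the `n - 1` others of length `2T`. -/
lemma volume_room_inter_le (hn : 1 ≤ n) {d ρ T : ℝ} (hd : 0 ≤ d) (hT : 0 ≤ T) (j : ℤ) :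
    volume.real (room hn d ρ j ∩ Metric.closedBall 0 T) ≤ d * (2 * T) ^ (n - 1) := by
  set l : Fin n := ⟨n - 1, by omega⟩ with hl
  set I : Fin n → Set ℝ := fun i =>
    if i = l then Icc (j * (d + ρ)) (j * (d + ρ) + d) else Icc (-T) T with hI
  have hsub : room hn d ρ j ∩ Metric.closedBall 0 T ⊆
      (WithLp.ofLp : E n → Fin n → ℝ) ⁻¹' (univ.pi I) := by
    rintro x ⟨hx, hxT⟩ i -
    simp only [hI]
    split_ifs with h
    · rw [h]
      exact hx
    · have : |x i| ≤ T := (abs_apply_le_norm x i).trans (by simpa using hxT)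
      exact abs_le.1 this
  have hIm : MeasurableSet (univ.pi I) := by
    refine MeasurableSet.univ_pi fun i => ?_
    simp only [hI]
    split_ifs <;> exact measurableSet_Icc
  have hvol : volume ((WithLp.ofLp : E n → Fin n → ℝ) ⁻¹' (univ.pi I)) =
      ENNReal.ofReal (d * (2 * T) ^ (n - 1)) := by
    rw [(PiLp.volume_preserving_ofLp (Fin n)).measure_preimage hIm.nullMeasurableSet,
      volume_pi_pi, ← Finset.mul_prod_erase _ _ (Finset.mem_univ l)]
    have h1 : volume (I l) = ENNReal.ofReal d := by
      simp [hI]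
    have h2 : ∀ i ∈ Finset.univ.erase l, volume (I i) = ENNReal.ofReal (2 * T) := by
      intro i hi
      simp only [hI, if_neg (Finset.ne_of_mem_erase hi), Real.volume_Icc]
      congr 1
      ring
    rw [h1, Finset.prod_congr rfl h2, Finset.prod_const, Finset.card_erase_of_mem
      (Finset.mem_univ l), Finset.card_univ, Fintype.card_fin,
      ENNReal.ofReal_mul hd, ENNReal.ofReal_pow (by positivity)]
  rw [Measure.real]
  refine ENNReal.toReal_le_of_le_ofReal (by positivity) ?_
  rw [← hvol]
  exact measure_mono hsub

/-- Properties of `U₀'(t) Ψ`: measurability, dispersive decay and finite speed of propagation. -/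
lemma exists_adjointGroup_bounds (hn : 1 ≤ n) (hm : 0 < m) {Ψ : State n} (hΨ : IsTestPair Ψ) :
    ∃ A R : ℝ, 0 ≤ A ∧ 0 ≤ R ∧ ∀ t : ℝ, 0 < t → Measurable (adjointGroup m t Ψ) ∧
      (∀ x, ‖adjointGroup m t Ψ x‖ ≤ A / √(t ^ n)) ∧
      ∀ x, t + R < ‖x‖ → adjointGroup m t Ψ x = 0 := by
  obtain ⟨A, hA, h⟩ := IsAdjointEvolution.norm_le hn hm hΨ
  obtain ⟨R, hR⟩ := hΨ.2.isCompact.isBounded.subset_closedBall (0 : E n)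
  refine ⟨A, max R 0, hA, le_max_right _ _, fun t ht => ?_⟩
  by_cases hex : ∃ Φ, IsAdjointEvolution m t Ψ Φ
  · have hspec : IsAdjointEvolution m t Ψ (adjointGroup m t Ψ) := by
      rw [adjointGroup, dif_pos hex]
      exact hex.choose_spec
    exact ⟨hspec.1.1.continuous.measurable, h t ht _ hspec, fun x hx =>
      hspec.eq_zero_of_lt_norm hn hm.le ht.le hΨ (le_max_right R 0)
        (hR.trans (Metric.closedBall_subset_closedBall (le_max_left _ _))) hx⟩
  -- Here `adjointGroup` takes its default value `0`, for which all bounds are trivial; no existence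
  -- theorem for the dual evolution is required.
  · rw [adjointGroup, dif_neg hex]
    refine ⟨measurable_const, fun x => ?_, fun _ _ => rfl⟩
    simp only [Pi.zero_apply, norm_zero]
    positivity

variable {Ω : Type*} [MeasurableSpace Ω] {P : Measure Ω} [IsProbabilityMeasure P]
  {Y₀ : Ω → State n} {Λ : ℝ} {Ψ : State n}

lemma integral_roomVar_fourth_le (hn : 1 ≤ n) {K : ℝ≥0} (hK : mixingIntegral P Y₀ ≤ K)
    (hY : AEMeasurable (fun p : Ω × E n => Y₀ p.1 p.2) (P.prod volume)) (h0 : CondS0 P Y₀)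
    (hb : BoundedBy P Y₀ Λ) {A R t : ℝ} (hR : 0 ≤ R) (ht : 1 < t)
    (hmeas : Measurable (adjointGroup m t Ψ))
    (hbd : ∀ x, ‖adjointGroup m t Ψ x‖ ≤ A / √(t ^ n))
    (hsupp : ∀ x, t + R < ‖x‖ → adjointGroup m t Ψ x = 0) {d : ℝ} (hd : 0 ≤ d) (ρ : ℝ) (j : ℤ) :
    Integrable (fun ω => |roomVar hn m Ψ (Y₀ ω) d ρ t j| ^ 4) P ∧
      ∫ ω, |roomVar hn m Ψ (Y₀ ω) d ρ t j| ^ 4 ∂P ≤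
        60 * A ^ 4 * ((2 * (1 + R)) ^ (n - 1) * pairBound n K) ^ 2 * Λ ^ 4 * d ^ 2 / t ^ 2 := by
  have ht0 : 0 < t := by linarith
  set f := (room hn d ρ j).indicator (adjointGroup m t Ψ) with hf
  set S := room hn d ρ j ∩ Metric.closedBall 0 (t + R) with hS
  have hM : ∀ x, ‖f x‖ ≤ A / √(t ^ n) := fun x =>
    (norm_indicator_le_norm_self _ _).trans (hbd x)
  have hfS : ∀ x ∉ S, f x = 0 := by
    intro x hx
    by_cases hr : x ∈ room hn d ρ j
    · rw [hf, indicator_of_mem hr]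
      refine hsupp x ?_
      by_contra hle
      push Not at hle
      exact hx ⟨hr, by simpa using hle⟩
    · exact indicator_of_notMem hr _
  obtain ⟨hi, hle⟩ := integral_pairing_fourth_le hn hK hY h0 hb
    (hmeas.indicator (measurableSet_room hn d ρ j)) hM
    ((measurableSet_room hn d ρ j).inter measurableSet_closedBall)
    (Metric.isBounded_closedBall.subset inter_subset_right) hfS
  refine ⟨hi, hle.trans ?_⟩
  have hpb := pairBound_nonneg n (K := (K : ℝ)) K.2
  have hvol : volume.real S ≤ d * ((2 * (1 + R)) ^ (n - 1) * t ^ (n - 1)) := by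
    refine (volume_room_inter_le hn hd (by positivity) j).trans ?_
    rw [← mul_pow]
    have : 2 * (t + R) ≤ 2 * (1 + R) * t := by nlinarith
    gcongr
  have hsq : (√(t ^ n)) ^ 4 = (t ^ n) ^ 2 := by
    rw [show (4 : ℕ) = 2 * 2 from rfl, pow_mul, Real.sq_sqrt (by positivity)]
  have htn : t ^ n = t ^ (n - 1) * t := by
    rw [← pow_succ]
    congr 1
    omega
  -- Power count: `(t^{-n/2})⁴ (d t^{n-1})² = d²/t²`.
  calc _ ≤ 60 * (Λ * (A / √(t ^ n))) ^ 4 *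
        (d * ((2 * (1 + R)) ^ (n - 1) * t ^ (n - 1)) * pairBound n K) ^ 2 := by
        have : 0 ≤ volume.real S := measureReal_nonneg
        gcongr
    _ = _ := by
        rw [mul_pow, div_pow, hsq, htn]
        field_simp

/-- Points of the room satisfy `|xⁿ| ≥ (|j| - 1) d`, the extra `d` being lost for negative `j`,
where the wall nearest the origin is the upper one. Far rooms thus miss the support. -/
lemma roomVar_eq_zero (hn : 1 ≤ n) {T t : ℝ}
    (hsupp : ∀ x, T < ‖x‖ → adjointGroup m t Ψ x = 0) {d ρ : ℝ} (hd : 0 ≤ d) (hρ : 0 ≤ ρ) {j : ℤ}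
    (hj : T + d < |(j : ℝ)| * d) (Y : State n) : roomVar hn m Ψ Y d ρ t j = 0 := by
  have h : (room hn d ρ j).indicator (adjointGroup m t Ψ) = 0 := by
    ext1 x
    by_cases hx : x ∈ room hn d ρ j
    · rw [indicator_of_mem hx]
      refine hsupp x (lt_of_lt_of_le ?_ (abs_apply_le_norm x ⟨n - 1, by omega⟩))
      obtain ⟨h1, h2⟩ := hx
      rcases le_total 0 (j : ℝ) with h | h
      · rw [abs_of_nonneg h] at hj
        refine lt_of_lt_of_le ?_ (le_abs_self _)
        nlinarith [mul_nonneg h hρ]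
      · rw [abs_of_nonpos h] at hj
        refine lt_of_lt_of_le ?_ (neg_le_abs _)
        nlinarith [mul_nonneg (neg_nonneg.2 h) hρ]
    · exact indicator_of_notMem hx _
  rw [roomVar, h]
  simp [pairing]

lemma tsum_le_of_support {f : ℤ → ℝ≥0∞} {N B : ℝ} (hN : 0 ≤ N) (hB : 0 ≤ B)
    (hf : ∀ j, f j ≤ ENNReal.ofReal B) (h0 : ∀ j : ℤ, N < |(j : ℝ)| → f j = 0) :
    ∑' j, f j ≤ ENNReal.ofReal ((2 * N + 1) * B) := by
  have hfl : (0 : ℤ) ≤ ⌊N⌋ := Int.floor_nonneg.2 hN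
  rw [tsum_eq_sum (s := Finset.Icc (-⌊N⌋) ⌊N⌋) fun j hj => h0 j ?_]
  · refine (Finset.sum_le_card_nsmul _ _ _ fun j _ => hf j).trans ?_
    rw [nsmul_eq_mul, Int.card_Icc, ← ENNReal.ofReal_natCast, ← ENNReal.ofReal_mul (by positivity)]
    refine ENNReal.ofReal_le_ofReal (mul_le_mul_of_nonneg_right ?_ hB)
    have h1 : ((⌊N⌋ + 1 - -⌊N⌋).toNat : ℝ) = 2 * (⌊N⌋ : ℝ) + 1 := by
      have : ((⌊N⌋ + 1 - -⌊N⌋).toNat : ℤ) = 2 * ⌊N⌋ + 1 := by omega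
      exact_mod_cast this
    rw [h1]
    linarith [Int.floor_le N]
  · by_contra hle
    push Not at hle
    refine hj (Finset.mem_Icc.2 ?_)
    have := abs_le.1 hle
    constructor
    · rw [neg_le, Int.le_floor]
      push_cast
      linarith
    · rw [Int.le_floor]
      exact this.2

lemma tsum_lintegral_roomVar_le (hn : 1 ≤ n) {C R t d ρ : ℝ} (hC : 0 ≤ C) (hR : 0 ≤ R)
    (ht : 1 < t) (hd : 0 < d) (hρ : 0 ≤ ρ)
    (hsupp : ∀ x, t + R < ‖x‖ → adjointGroup m t Ψ x = 0)
    (hmom : ∀ j : ℤ, Integrable (fun ω => |roomVar hn m Ψ (Y₀ ω) d ρ t j| ^ 4) P ∧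
      ∫ ω, |roomVar hn m Ψ (Y₀ ω) d ρ t j| ^ 4 ∂P ≤ C * d ^ 2 / t ^ 2) :
    ∑' j : ℤ, ∫⁻ ω, ‖roomVar hn m Ψ (Y₀ ω) d ρ t j‖ₑ ^ 4 ∂P ≤
      ENNReal.ofReal (C * (2 * (1 + R) * (d / t) + 3 * (d / t) ^ 2)) := by
  have ht0 : 0 < t := by linarith
  -- At most `2N + 1` rooms contribute; times `C d²/t²` this is of order `d/t + (d/t)²`.
  refine (tsum_le_of_support (N := (t + R + d) / d) (B := C * d ^ 2 / t ^ 2) (by positivity)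
    (by positivity) (fun j => ?_) fun j hj => ?_).trans (ENNReal.ofReal_le_ofReal ?_)
  · have h1 : ∫⁻ ω, ‖roomVar hn m Ψ (Y₀ ω) d ρ t j‖ₑ ^ 4 ∂P =
        ENNReal.ofReal (∫ ω, |roomVar hn m Ψ (Y₀ ω) d ρ t j| ^ 4 ∂P) := by
      rw [ofReal_integral_eq_lintegral_ofReal (hmom j).1
        (Eventually.of_forall fun ω => by positivity)]
      refine lintegral_congr fun ω => ?_
      rw [ENNReal.ofReal_pow (abs_nonneg _), ← Real.norm_eq_abs, ofReal_norm]
    rw [h1]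
    exact ENNReal.ofReal_le_ofReal (hmom j).2
  · rw [div_lt_iff₀ hd] at hj
    simp [roomVar_eq_zero hn hsupp hd.le hρ hj]
  · have h1 : (2 * ((t + R + d) / d) + 1) * (C * d ^ 2 / t ^ 2) =
        C * (2 * ((t + R) / t) * (d / t) + 3 * (d / t) ^ 2) := by
      field_simp
      ring
    rw [h1]
    have h2 : (t + R) / t ≤ 1 + R := by
      rw [div_le_iff₀ ht0]
      nlinarith
    gcongr

lemma tendsto_div_of_isEquivalent {d : ℝ → ℝ}
    (hd : Asymptotics.IsEquivalent atTop d (fun t => t / Real.log t)) :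
    Tendsto (fun t => d t / t) atTop (𝓝 0) := by
  have h1 : Asymptotics.IsEquivalent atTop (fun t => d t / t) (fun t => t / Real.log t / t) :=
    hd.div Asymptotics.IsEquivalent.refl
  refine h1.symm.tendsto_nhds ?_
  refine Tendsto.congr' ?_ Real.tendsto_log_atTop.inv_tendsto_atTop
  filter_upwards [eventually_gt_atTop 0] with t ht
  simp only [Pi.inv_apply]
  field_simp

/-- Chebyshev: where `|r| > ε` one has `r² ≤ r⁴/ε²`. -/
lemma lintegral_indicator_sq_le (r : Ω → ℝ) {ε : ℝ} (hε : 0 < ε) :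
    ∫⁻ ω, {ω | ε < |r ω|}.indicator (fun ω => ‖r ω‖ₑ ^ 2) ω ∂P ≤
      (ENNReal.ofReal ε ^ 2)⁻¹ * ∫⁻ ω, ‖r ω‖ₑ ^ 4 ∂P := by
  have hε' : ENNReal.ofReal ε ^ 2 ≠ 0 := by simpa using hε
  have hεt : ENNReal.ofReal ε ^ 2 ≠ ∞ := by finiteness
  rw [← lintegral_const_mul' _ _ (ENNReal.inv_ne_top.2 hε')]
  refine lintegral_mono fun ω => ?_
  refine indicator_apply_le' (fun hω => ?_) fun _ => bot_le
  rw [← ENNReal.div_eq_inv_mul, ENNReal.le_div_iff_mul_le (Or.inl hε') (Or.inl hεt),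
    show (4 : ℕ) = 2 + 2 from rfl, pow_add]
  gcongr
  rw [← ofReal_norm, Real.norm_eq_abs]
  exact ENNReal.ofReal_le_ofReal (le_of_lt hω)

end Rooms

end KleinGordon

end

/-! ### The fourth moment bound and the Lindeberg condition. -/

theorem theoremp5p1 {n : ℕ} (hn : 1 ≤ n) (m : ℝ) (hm : 0 < m)
    (Ψ : KleinGordon.State n) (hΨ : KleinGordon.IsTestPair Ψ) (K : ℝ≥0) :
    ∃ C : ℝ, 0 < C ∧
      ∀ (Ω : Type*) [MeasurableSpace Ω] (P : Measure Ω) [IsProbabilityMeasure P]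
        (Y₀ : Ω → KleinGordon.State n) (Λ : ℝ) (d ρ : ℝ → ℝ),
        KleinGordon.IsRandomState m P Y₀ →
        KleinGordon.CondS0 P Y₀ →
        KleinGordon.CondS1 P Y₀ →
        KleinGordon.CondS2 m P Y₀ →
        KleinGordon.CondS3 P Y₀ →
        KleinGordon.mixingIntegral P Y₀ ≤ K →
        KleinGordon.BoundedBy P Y₀ Λ →
        (∀ t, 0 < t → 1 ≤ d t) →
        (∀ t, 0 < t → 0 < ρ t) →
        -- the fourth moment bound
        (∀ t, 1 < t → ∀ j : ℤ,
          Integrable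
            (fun ω => |KleinGordon.roomVar hn m Ψ (Y₀ ω) (d t) (ρ t) t j| ^ 4) P ∧
          ∫ ω, |KleinGordon.roomVar hn m Ψ (Y₀ ω) (d t) (ρ t) t j| ^ 4 ∂P
            ≤ C * Λ ^ 4 * d t ^ 2 / t ^ 2) ∧
        -- the Lindeberg condition
        (∀ δ : ℝ, 0 < δ → δ < 1 →
          Asymptotics.IsEquivalent atTop d (fun t => t / Real.log t) →
          Asymptotics.IsEquivalent atTop ρ (fun t => t ^ (1 - δ)) →
          Tendsto (fun t => ∑' j : ℤ,
              ∫⁻ ω, ‖KleinGordon.roomVar hn m Ψ (Y₀ ω) (d t) (ρ t) t j‖ₑ ^ 4 ∂P)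
            atTop (𝓝 0) ∧
          ∀ ε : ℝ, 0 < ε →
            Tendsto (fun t => ∑' j : ℤ,
                ∫⁻ ω, {ω | ε < |KleinGordon.roomVar hn m Ψ (Y₀ ω) (d t) (ρ t) t j|}.indicator
                  (fun ω => ‖KleinGordon.roomVar hn m Ψ (Y₀ ω) (d t) (ρ t) t j‖ₑ ^ 2) ω ∂P)
              atTop (𝓝 0)) := by
  obtain ⟨A, R, hA, hR, hΦ⟩ := KleinGordon.exists_adjointGroup_bounds hn hm hΨ
  set C : ℝ :=
    60 * A ^ 4 * ((2 * (1 + R)) ^ (n - 1) * KleinGordon.pairBound n K) ^ 2 with hCdef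
  have hC : 0 ≤ C := by positivity
  -- The added `1` only secures strict positivity. Everything in `C` depends on `Ψ`, `n`, `m` and
  -- the bound `K` for `φ̄`.
  refine ⟨C + 1, by positivity, ?_⟩
  intro Ω _ P _ Y₀ Λ d ρ hY h0 _ _ _ hK hb hd hρ
  have hmom : ∀ t, 1 < t → ∀ j : ℤ,
      Integrable
        (fun ω => |KleinGordon.roomVar hn m Ψ (Y₀ ω) (d t) (ρ t) t j| ^ 4) P ∧
      ∫ ω, |KleinGordon.roomVar hn m Ψ (Y₀ ω) (d t) (ρ t) t j| ^ 4 ∂P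
        ≤ (C + 1) * Λ ^ 4 * d t ^ 2 / t ^ 2 := by
    intro t ht j
    have ht0 : 0 < t := by linarith
    obtain ⟨h1, h2, h3⟩ := hΦ t ht0
    obtain ⟨hi, hle⟩ := KleinGordon.integral_roomVar_fourth_le hn hK hY.1 h0 hb hR ht h1 h2 h3
      (zero_le_one.trans (hd t ht0)) (ρ t) j
    refine ⟨hi, hle.trans ?_⟩
    have : C ≤ C + 1 := by linarith
    gcongr
  refine ⟨hmom, fun δ _ _ hdt _ => ?_⟩
  -- Of the asymptotics of the widths, only `d t / t → 0` enters.
  have hlim : Tendsto (fun t => ENNReal.ofReal ((C + 1) * Λ ^ 4 *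
      (2 * (1 + R) * (d t / t) + 3 * (d t / t) ^ 2))) atTop (𝓝 0) := by
    have h := KleinGordon.tendsto_div_of_isEquivalent hdt
    have h2 := ((h.const_mul (2 * (1 + R))).add ((h.pow 2).const_mul 3)).const_mul
      ((C + 1) * Λ ^ 4)
    simpa using ENNReal.tendsto_ofReal h2
  have hfour : Tendsto (fun t => ∑' j : ℤ,
      ∫⁻ ω, ‖KleinGordon.roomVar hn m Ψ (Y₀ ω) (d t) (ρ t) t j‖ₑ ^ 4 ∂P) atTop (𝓝 0) := by
    refine tendsto_of_tendsto_of_tendsto_of_le_of_le' tendsto_const_nhds hlim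
      (Eventually.of_forall fun _ => bot_le) ?_
    filter_upwards [eventually_gt_atTop 1] with t ht
    have ht0 : 0 < t := by linarith
    exact KleinGordon.tsum_lintegral_roomVar_le hn (by positivity) hR ht
      (zero_lt_one.trans_le (hd t ht0)) (hρ t ht0).le (hΦ t ht0).2.2 (hmom t ht)
  refine ⟨hfour, fun ε hε => ?_⟩
  have hε' : ENNReal.ofReal ε ^ 2 ≠ 0 := by simpa using hε
  have hscaled := ENNReal.Tendsto.const_mul (a := (ENNReal.ofReal ε ^ 2)⁻¹) hfour
    (Or.inr (ENNReal.inv_ne_top.2 hε'))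
  rw [mul_zero] at hscaled
  refine tendsto_of_tendsto_of_tendsto_of_le_of_le tendsto_const_nhds hscaled
    (fun _ => bot_le) fun t => ?_
  simp only
  rw [← ENNReal.tsum_mul_left]
  exact ENNReal.tsum_le_tsum fun j => KleinGordon.lintegral_indicator_sq_le _ hε
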